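/- Let $d\ge 0$, $N\ge 1$, $T\in\mathbb R$, let $V:\mathbb R^d\to\mathbb R$, and let $\Omega\subseteq[0,T]\times\mathbb R^d$ be a nonempty open subset of $\mathbb R\times\mathbb R^d$. For $j=1,\dots,N$ let $b_j\in C^\infty(\Omega;\mathbb C)$ be nowhere zero on $\Omega$, and let $S_j\in C^\infty(\Omega;\mathbb R)$ satisfy $\partial_tS_j+\frac12|\nabla S_j|^2+V=0$ on $\Omega$. Suppose that $\nabla S_j(t,x)\ne\nabla S_k(t,x)$ for all $(t,x)\in\Omega$ and all $j\neq k$ (here $\nabla$ is the gradient in $x$). For $0<\varepsilon\le1$ and $t\in[0,T]$ let $\psi^\varepsilon(t,\cdot)\in H^1(\mathbb R^d;\mathbb C)$, where $\psi^\varepsilon$ and $\nabla\psi^\varepsilon$ are jointly measurable in $(t,x)$ and $\sup_{0<\varepsilon\le1,\,t\in[0,T]}\|\psi^\varepsilon(t,\cdot)\|_{L^2(\mathbb R^d)}<\infty$. Suppose that on $\Omega$ $$\psi^\varepsilon(t,x)=\sum_{j=1}^N b_j(t,x)\,e^{iS_j(t,x)/\varepsilon}+r_\varepsilon(t,x),$$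 where $r_\varepsilon\to0$ and $\varepsilon\nabla r_\varepsilon\to0$ in $L^2_{\rm loc}(\Omega)$ as $\varepsilon\to0_+$. Put $\rho^\varepsilon=|\psi^\varepsilon|^2$, $J^\varepsilon=\varepsilon\,\mathrm{Im}(\overline{\psi^\varepsilon}\nabla\psi^\varepsilon)$, $u^\varepsilon=J^\varepsilon/\rho^\varepsilon$, and let $$\beta^\varepsilon(t,x,p)=\rho^\varepsilon(t,x)\,\delta(p-u^\varepsilon(t,x))$$ be the Bohmian measure of $\psi^\varepsilon(t,\cdot)$ on $\mathbb R^d_x\times\mathbb R^d_p$. If $\varepsilon_n\to0_+$, a limiting Bohmian measure over $\Omega$ along $(\varepsilon_n)$ is a locally finite Borel measure $\beta$ on $\Omega\times\mathbb R^d_p$ such that $$\int_0^T\!\!\iint\varphi(t,x,p)\,\beta^{\varepsilon_n}(t,dx,dp)\,dt\to\int\varphi\,d\beta\qquad\text{for all }\varphi\in C_c(\Omega\times\mathbb R^d_p).$$ Let $$w^\varepsilon(t,x,p)=\frac1{(2\pi)^d}\int_{\mathbb R^d}\psi^\varepsilon\bigl(t,x-\tfrac\varepsilon2\eta\bigr)\,\overline{\psi^\varepsilon\bigl(t,x+\tfrac\varepsilon2\eta\bigr)}\,e^{i\eta\cdot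 p}\,d\eta$$ be the Wigner transform of $\psi^\varepsilon$; its limit as $\varepsilon\to0_+$, in the sense of distributions on $\Omega\times\mathbb R^d_p$, is called the Wigner measure over $\Omega$. Then the following hold. 1. The Wigner measure over $\Omega$ exists and is $$w(t,x,p)=\sum_{j=1}^N|b_j(t,x)|^2\,\delta(p-\nabla S_j(t,x)).$$ 2. Every sequence $\varepsilon_n\to0_+$ has a subsequence along which a limiting Bohmian measure over $\Omega$ exists. 3. For every sequence $\varepsilon_n\to0_+$ and every limiting Bohmian measure $\beta$ over $\Omega$ along $(\varepsilon_n)$, one has $\beta=w$, as measures on $\Omega\times\mathbb R^d_p$, if and only if $N=1$. -/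

import Mathlib

open MeasureTheory Set Filter Topology
open scoped ContDiff

noncomputable section

/-- Position (or momentum) space `ℝ^d`, with its Euclidean norm. -/
abbrev RSpace (d : ℕ) : Type := EuclideanSpace ℝ (Fin d)

/-- The `k`-th coordinate vector of `ℝ^d`. -/
def coordVec {d : ℕ} (k : Fin d) : RSpace d := EuclideanSpace.single k 1

/-- `f ∈ H¹(ℝ^d; ℂ)` with weak gradient `g`: both are square integrable, and
`∫ f ∂_k χ = - ∫ χ g_k` for all test functions `χ` and all `k`. -/
def IsH1WithGrad {d : ℕ} (f : RSpace d → ℂ) (g : RSpace d → EuclideanSpace ℂ (Fin d)) : Prop :=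
  MemLp f 2 volume ∧ MemLp g 2 volume ∧
    ∀ χ : RSpace d → ℝ, ContDiff ℝ ∞ χ → HasCompactSupport χ → ∀ k : Fin d,
      ∫ x, f x * ((fderiv ℝ χ x (coordVec k) : ℝ) : ℂ) = - ∫ x, ((χ x : ℝ) : ℂ) * g x k

/-- The current density `J = ε Im (conj f * ∇f)`, where `g` is the gradient of `f`. -/
def currentDensity {d : ℕ} (ε : ℝ) (f : RSpace d → ℂ) (g : RSpace d → EuclideanSpace ℂ (Fin d))
    (x : RSpace d) : RSpace d :=
  WithLp.toLp 2 fun k => ε * (starRingEnd ℂ (f x) * g x k).im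

/-- The velocity field `u = J / ρ` with `ρ = |f|²`. Its value where `ρ = 0` is irrelevant for the
Bohmian measure. -/
def bohmVelocity {d : ℕ} (ε : ℝ) (f : RSpace d → ℂ) (g : RSpace d → EuclideanSpace ℂ (Fin d))
    (x : RSpace d) : RSpace d :=
  (‖f x‖ ^ 2)⁻¹ • currentDensity ε f g x

/-- The Bohmian measure `ρ(x) δ(p - u(x))` on `ℝ^d_x × ℝ^d_p` of a wave function `f ∈ H¹` with
gradient `g`: the image of `ρ dx` under `x ↦ (x, u(x))`. -/
def bohmianMeasure {d : ℕ} (ε : ℝ) (f : RSpace d → ℂ)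
    (g : RSpace d → EuclideanSpace ℂ (Fin d)) : Measure (RSpace d × RSpace d) :=
  (volume.withDensity fun x => ENNReal.ofReal (‖f x‖ ^ 2)).map
    fun x => (x, bohmVelocity ε f g x)

/-- The `ε`-scaled Wigner transform
`(2π)^{-d} ∫ f(x - εη/2) conj (f(x + εη/2)) e^{i η·p} dη`. -/
def wignerTransform {d : ℕ} (ε : ℝ) (f : RSpace d → ℂ) (x p : RSpace d) : ℂ :=
  ((2 * Real.pi : ℝ) : ℂ)⁻¹ ^ d *
    ∫ η : RSpace d, f (x - (ε / 2) • η) * starRingEnd ℂ (f (x + (ε / 2) • η)) *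
      Complex.exp (Complex.I * ((inner ℝ η p : ℝ) : ℂ))

/-- The part `{(t, x, p) | (t, x) ∈ Ω}` of phase space-time that lies over `Ω`. -/
def overSet {d : ℕ} (Ω : Set (ℝ × RSpace d)) : Set (ℝ × RSpace d × RSpace d) :=
  {z | (z.1, z.2.1) ∈ Ω}

/-- `β` is locally finite over `Ω`: it is finite on the compact subsets of `Ω × ℝ^d_p`. -/
def LocallyFiniteOver {d : ℕ} (Ω : Set (ℝ × RSpace d))
    (β : Measure (ℝ × RSpace d × RSpace d)) : Prop :=
  ∀ K : Set (ℝ × RSpace d × RSpace d), IsCompact K → K ⊆ overSet Ω → β K < ⊤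

/-- `β = β(t, dx, dp) dt` is a limiting Bohmian measure over `Ω ⊆ [0,T] × ℝ^d` of the family
`ψ^ε(t, ·)` (with gradients `G^ε(t, ·)`), as `ε → 0` along the filter `l`: the Bohmian measures
`β^ε(t, dx, dp) dt` converge weakly-* to `β` over `Ω`. -/
def IsLimitingBohmianMeasure {d : ℕ} (T : ℝ) (Ω : Set (ℝ × RSpace d))
    (ψ : ℝ → ℝ → RSpace d → ℂ) (G : ℝ → ℝ → RSpace d → EuclideanSpace ℂ (Fin d))
    (l : Filter ℝ) (β : Measure (ℝ × RSpace d × RSpace d)) : Prop :=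
  LocallyFiniteOver Ω β ∧
    ∀ φ : ℝ × RSpace d × RSpace d → ℝ, Continuous φ → HasCompactSupport φ →
      tsupport φ ⊆ overSet Ω →
      Tendsto
        (fun ε : ℝ => ∫ t in Icc 0 T, ∫ z, φ (t, z) ∂(bohmianMeasure ε (ψ ε t) (G ε t)))
        l (𝓝 (∫ z, φ z ∂β))

/-- `w = w(t, dx, dp) dt` is the Wigner measure over `Ω ⊆ [0,T] × ℝ^d` of the family `ψ^ε(t, ·)`,
as `ε → 0` along the filter `l`: the Wigner transforms converge to `w` over `Ω`, in the sense of
distributions. -/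
def IsWignerMeasure {d : ℕ} (T : ℝ) (Ω : Set (ℝ × RSpace d))
    (ψ : ℝ → ℝ → RSpace d → ℂ)
    (l : Filter ℝ) (w : Measure (ℝ × RSpace d × RSpace d)) : Prop :=
  LocallyFiniteOver Ω w ∧
    ∀ φ : ℝ × RSpace d × RSpace d → ℝ, ContDiff ℝ ∞ φ → HasCompactSupport φ →
      tsupport φ ⊆ overSet Ω →
      Tendsto
        (fun ε : ℝ => ∫ t in Icc 0 T, ∫ x, ∫ p,
          ((φ (t, x, p) : ℝ) : ℂ) * wignerTransform ε (ψ ε t) x p)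
        l (𝓝 ((∫ z, φ z ∂w : ℝ) : ℂ))

/-- The spatial gradient `∇S(t, x)`. -/
def spaceGrad {d : ℕ} (S : ℝ × RSpace d → ℝ) (t : ℝ) (x : RSpace d) : RSpace d :=
  gradient (fun y => S (t, y)) x

/-- `S` solves the Hamilton-Jacobi equation `∂_t S + |∇S|²/2 + V = 0` on `Ω`. -/
def SolvesHamiltonJacobi {d : ℕ} (V : RSpace d → ℝ) (Ω : Set (ℝ × RSpace d))
    (S : ℝ × RSpace d → ℝ) : Prop :=
  ∀ t x, (t, x) ∈ Ω →
    deriv (fun s => S (s, x)) t + (1 / 2) * ‖spaceGrad S t x‖ ^ 2 + V x = 0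

/-- The superposition `∑_j b_j(t, x) e^{i S_j(t, x) / ε}`. -/
def wkbSum {d N : ℕ} (b : Fin N → ℝ × RSpace d → ℂ) (S : Fin N → ℝ × RSpace d → ℝ)
    (ε t : ℝ) (x : RSpace d) : ℂ :=
  ∑ j, b j (t, x) * Complex.exp (Complex.I * ((S j (t, x) / ε : ℝ) : ℂ))

/-- The spatial gradient of `wkbSum`. -/
def wkbSumGrad {d N : ℕ} (b : Fin N → ℝ × RSpace d → ℂ) (S : Fin N → ℝ × RSpace d → ℝ)
    (ε t : ℝ) (x : RSpace d) : EuclideanSpace ℂ (Fin d) :=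
  WithLp.toLp 2 fun k => fderiv ℝ (fun y => wkbSum b S ε t y) x (coordVec k)

/-- `ψ^ε = ∑_j b_j e^{i S_j / ε} + r_ε` on `Ω`, where `r_ε → 0` and `ε ∇ r_ε → 0` in `L²_loc(Ω)`
as `ε → 0+`. The remainder `r_ε` is the difference of `ψ^ε` and the superposition, and `∇ r_ε` is
the difference of their gradients. -/
def HasWKBForm {d N : ℕ} (Ω : Set (ℝ × RSpace d)) (b : Fin N → ℝ × RSpace d → ℂ)
    (S : Fin N → ℝ × RSpace d → ℝ)
    (ψ : ℝ → ℝ → RSpace d → ℂ) (G : ℝ → ℝ → RSpace d → EuclideanSpace ℂ (Fin d)) : Prop :=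
  ∀ K : Set (ℝ × RSpace d), IsCompact K → K ⊆ Ω →
    Tendsto (fun ε : ℝ =>
        eLpNorm (fun y : ℝ × RSpace d => ψ ε y.1 y.2 - wkbSum b S ε y.1 y.2) 2
          (volume.restrict K)) (𝓝[>] 0) (𝓝 0) ∧
    Tendsto (fun ε : ℝ =>
        eLpNorm (fun y : ℝ × RSpace d => ε • (G ε y.1 y.2 - wkbSumGrad b S ε y.1 y.2)) 2
          (volume.restrict K)) (𝓝[>] 0) (𝓝 0)

/-- The measure `∑_j |b_j(t, x)|² δ(p - ∇S_j(t, x))` over `Ω`: the sum of the images of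
`|b_j|² dt dx` on `Ω` under `(t, x) ↦ (t, x, ∇S_j(t, x))`. -/
def multiPhaseMeasure {d N : ℕ} (Ω : Set (ℝ × RSpace d)) (b : Fin N → ℝ × RSpace d → ℂ)
    (S : Fin N → ℝ × RSpace d → ℝ) : Measure (ℝ × RSpace d × RSpace d) :=
  ∑ j, ((volume.restrict Ω).withDensity fun y => ENNReal.ofReal (‖b j y‖ ^ 2)).map
    fun y => (y.1, y.2, spaceGrad (S j) y.1 y.2)

end

/-! The three assertions rest on one analytic fact, nonstationary phase (`tendsto_integral_oscExp`):
where a phase θ has no critical point, the integral of A e^{iθ/ε} vanishes in the limit. Distinct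
spatial gradients make every difference S_j - S_k noncritical in space-time, so in quadratic
expressions of the superposition only diagonal terms survive. Remainders small in L²_loc do not
affect such expressions (`tendsto_integral_mul_sub_zero`).

Wigner measure. Integrating the momentum variable against a test function φ turns the Wigner
transform into an η-integral of two-point correlations at distance εη, weighted by the momentum
Fourier transform of φ. At this scale S_j(x ± εη/2)/ε is S_j/ε ± η·∇S_j/2 up to o(1). For fixed η
the correlation thus tends to the sum of |b_j|² e^{-iη·∇S_j}. The Fourier weight decays rapidly,
uniformly in (t,x), so dominated convergence applies in η, and Fourier inversion evaluates φ at p =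
∇S_j.

Existence. The Bohmian measures on phase space-time have mass at most C²T. Sequential Banach-Alaoglu
on continuous functions on the one-point compactification, followed by the Riesz representation
theorem, gives vague limits.

One phase. With q = ∇S, the components of ρ(u - q) are the imaginary parts of the conjugate of ψ
times the components of ε∇ψ - iqψ. The second factor tends to 0 in L²_loc, so the velocity error is
small in ρ-weighted L¹ and the limit is mono-kinetic.

Several phases. For every real h one has ρ(u·e)² ≤ |ε e·∇ψ - hψ|², because a real multiple of ψ
carries no current (`norm_sq_mul_inner_velocityOf_sq_le`). With h = 0 the right side tends weakly to
the second momentum moment of w in direction e. With h a small multiple of the interference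
oscillation of two phases, a surrogate for ε e·∇log √ρ that needs no division by ρ, the right side
drops by a fixed amount (`exists_energy_gap`). The cross term gains linearly in the size of h, while
its square costs quadratically. The two phases are chosen so that their gradients at a base point
are at maximal distance. Their difference is then attained by no other pair, so exactly one product
of phases resonates with h. Hence the limiting Bohmian measure has strictly less energy than w. -/

noncomputable section

/-! ### Cutoffs and regularity read off from the topological support. -/

section Support

variable {E F G : Type*} [NormedAddCommGroup E] [NormedSpace ℝ E]
  [NormedAddCommGroup F] [NormedSpace ℝ F] [NormedAddCommGroup G] [NormedSpace ℝ G]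

/-- A function which is smooth at every point of its topological support is smooth. -/
theorem contDiff_of_contDiffAt_tsupport {n : ℕ∞} {f : E → F}
    (h : ∀ x ∈ tsupport f, ContDiffAt ℝ n f x) : ContDiff ℝ n f := by
  refine contDiff_iff_contDiffAt.2 fun x => ?_
  by_cases hx : x ∈ tsupport f
  · exact h x hx
  · exact (contDiffAt_const (c := (0 : F))).congr_of_eventuallyEq
      (notMem_tsupport_iff_eventuallyEq.1 hx)

/-- A function which is continuous at every point of its topological support is continuous. -/
theorem continuous_of_continuousAt_tsupport {X Z : Type*} [TopologicalSpace X]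
    [TopologicalSpace Z] [Zero Z] {f : X → Z}
    (h : ∀ x ∈ tsupport f, ContinuousAt f x) : Continuous f := by
  refine continuous_iff_continuousAt.2 fun x => ?_
  by_cases hx : x ∈ tsupport f
  · exact h x hx
  · exact (continuousAt_const (y := (0 : Z))).congr (notMem_tsupport_iff_eventuallyEq.1 hx).symm

/-- A continuous compactly supported factor extends a continuous function on an open set. -/
theorem continuous_mul_of_tsupport_subset {X : Type*} [TopologicalSpace X] {U : Set X}
    (hU : IsOpen U) {f g : X → ℂ} (hf : Continuous f) (hfU : tsupport f ⊆ U)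
    (hg : ContinuousOn g U) : Continuous fun x => f x * g x := by
  refine continuous_of_continuousAt_tsupport fun x hx => ?_
  have hxf : x ∈ tsupport f := tsupport_mul_subset_left hx
  exact hf.continuousAt.mul (hg.continuousAt (hU.mem_nhds (hfU hxf)))

variable [FiniteDimensional ℝ E]

/-- Smooth cutoff functions. -/
theorem exists_smooth_cutoff {K U : Set E} (hK : IsCompact K) (hU : IsOpen U) (hKU : K ⊆ U) :
    ∃ χ : E → ℝ, ContDiff ℝ ∞ χ ∧ HasCompactSupport χ ∧ tsupport χ ⊆ U ∧
      (∀ x, 0 ≤ χ x ∧ χ x ≤ 1) ∧ ∀ x ∈ K, χ x = 1 := by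
  obtain ⟨L, hL, hKL, hLU⟩ := exists_compact_between hK hU hKU
  obtain ⟨χ, h1, h2, h3, h4⟩ := exists_contMDiff_support_eq_eq_one_iff (modelWithCornersSelf ℝ E)
    (n := ⊤) (isOpen_interior (s := L)) hK.isClosed hKL
  have hsub : tsupport χ ⊆ L := by
    rw [tsupport, h3]
    exact closure_minimal interior_subset hL.isClosed
  refine ⟨χ, h1.contDiff, hL.of_isClosed_subset (isClosed_tsupport _) hsub, hsub.trans hLU,
    fun x => h2 (mem_range_self x), fun x hx => (h4 x).1 hx⟩

end Support

/-! ### Nonstationary phase. -/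

section NonstationaryPhase

/-- The oscillating exponential `e^{i θ / ε}`. -/
def oscExp {E : Type*} (θ : E → ℝ) (ε : ℝ) (y : E) : ℂ := Complex.exp (Complex.I * ((θ y / ε : ℝ) : ℂ))

theorem norm_oscExp {E : Type*} (θ : E → ℝ) (ε : ℝ) (y : E) : ‖oscExp θ ε y‖ = 1 := by
  rw [oscExp, mul_comm]; exact Complex.norm_exp_ofReal_mul_I _

variable {E : Type*} [NormedAddCommGroup E] [NormedSpace ℝ E]

theorem fderiv_oscExp {θ : E → ℝ} {y : E} (h : DifferentiableAt ℝ θ y) (ε : ℝ) (v : E) :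
    fderiv ℝ (oscExp θ ε) y v = Complex.I * ((fderiv ℝ θ y v / ε : ℝ) : ℂ) * oscExp θ ε y := by
  have h1 : HasFDerivAt (fun y => θ y / ε) (ε⁻¹ • fderiv ℝ θ y) y := by
    simpa [div_eq_inv_mul] using h.hasFDerivAt.const_mul ε⁻¹
  have h2 := ((Complex.ofRealCLM.hasFDerivAt.comp y h1).const_mul Complex.I).cexp
  have h3 : HasFDerivAt (oscExp θ ε) _ y := h2
  rw [h3.fderiv]
  simp [oscExp, div_eq_inv_mul]
  ring

theorem contDiffAt_oscExp {θ : E → ℝ} {y : E} (h : ContDiffAt ℝ ∞ θ y) (ε : ℝ) :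
    ContDiffAt ℝ ∞ (oscExp θ ε) y := by
  unfold oscExp
  exact (contDiffAt_const.mul (Complex.ofRealCLM.contDiff.contDiffAt.comp y
    (h.div_const ε))).cexp

variable [FiniteDimensional ℝ E]
  [MeasurableSpace E] [BorelSpace E] {μ : Measure E} [μ.IsAddHaarMeasure]

/-- The principle of nonstationary phase for smooth amplitudes. -/
theorem tendsto_integral_oscExp_of_contDiff {U : Set E} (hU : IsOpen U) {θ : E → ℝ}
    (hθ : ContDiffOn ℝ ∞ θ U) (hcrit : ∀ y ∈ U, fderiv ℝ θ y ≠ 0)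
    {A : E → ℂ} (hA : ContDiff ℝ ∞ A) (hAc : HasCompactSupport A) (hAU : tsupport A ⊆ U) :
    Tendsto (fun ε => ∫ y, A y * oscExp θ ε y ∂μ) (𝓝[>] 0) (𝓝 0) := by
  let v := Module.finBasis ℝ E
  -- In basis coordinates Q plays the role of |∇θ|²; no inner product on `E` is needed, only that Q
  -- vanishes exactly at critical points.
  let Q : E → ℝ := fun y => ∑ k, (fderiv ℝ θ y (v k)) ^ 2
  have hθat : ∀ y ∈ U, ContDiffAt ℝ ∞ θ y := fun y hy => hθ.contDiffAt (hU.mem_nhds hy)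
  have hdat : ∀ y ∈ U, ∀ k, ContDiffAt ℝ ∞ (fun z => fderiv ℝ θ z (v k)) y := fun y hy k =>
    ((hθat y hy).fderiv_right (m := ∞) (by simp)).clm_apply contDiffAt_const
  have hQat : ∀ y ∈ U, ContDiffAt ℝ ∞ Q y := fun y hy =>
    ContDiffAt.sum fun k _ => (hdat y hy k).pow 2
  have hQ : ∀ y ∈ U, Q y ≠ 0 := by
    intro y hy h0
    have h1 := (Finset.sum_eq_zero_iff_of_nonneg fun k _ => sq_nonneg _).1 h0
    refine hcrit y hy (ContinuousLinearMap.coe_injective (v.ext fun k => ?_))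
    simpa using h1 k (Finset.mem_univ k)
  -- The classical vector field A∇θ/|∇θ|²: the sum of B_k ∂_k e^{iθ/ε} equals (i/ε) A e^{iθ/ε}, so
  -- one integration by parts yields a factor ε.
  let B : Fin (Module.finrank ℝ E) → E → ℂ := fun k y =>
    A y * ((fderiv ℝ θ y (v k) / Q y : ℝ) : ℂ)
  have hBsupp : ∀ k, tsupport (B k) ⊆ tsupport A := fun k => tsupport_mul_subset_left
  have hBc : ∀ k, HasCompactSupport (B k) := fun k => hAc.mul_right
  have hB : ∀ k, ContDiff ℝ ∞ (B k) := fun k => by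
    refine contDiff_of_contDiffAt_tsupport fun y hy => ?_
    have hy' := hAU (hBsupp k hy)
    exact hA.contDiffAt.mul (Complex.ofRealCLM.contDiff.contDiffAt.comp y
      ((hdat y hy' k).div (hQat y hy') (hQ y hy')))
  have hintg : ∀ (f : E → ℂ) (ε : ℝ), Continuous f → HasCompactSupport f → tsupport f ⊆ U →
      Integrable (fun y => f y * oscExp θ ε y) μ := by
    intro f ε hf hfc hfU
    refine (continuous_mul_of_tsupport_subset hU hf hfU fun y hy => ?_).integrable_of_hasCompactSupport
      hfc.mul_right
    exact (contDiffAt_oscExp (hθat y hy) ε).continuousAt.continuousWithinAt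
  have hdB : ∀ k, Continuous (fun y => fderiv ℝ (B k) y (v k)) := fun k =>
    ((hB k).continuous_fderiv (by simp)).clm_apply continuous_const
  have hdBs : ∀ k, tsupport (fun y => fderiv ℝ (B k) y (v k)) ⊆ tsupport (B k) := fun k =>
    tsupport_fderiv_apply_subset ℝ (v k)
  have hdBc : ∀ k, HasCompactSupport (fun y => fderiv ℝ (B k) y (v k)) := fun k =>
    (hBc k).of_isClosed_subset (isClosed_tsupport _) (hdBs k)
  have hpt : ∀ ε : ℝ, ε ≠ 0 → ∀ y, A y * oscExp θ ε y =
      ∑ k, (ε / Complex.I) * (B k y * fderiv ℝ (oscExp θ ε) y (v k)) := by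
    intro ε hε y
    by_cases hy : y ∈ U
    · have hQC : ((Q y : ℝ) : ℂ) ≠ 0 := by exact_mod_cast hQ y hy
      have hεC : (ε : ℂ) ≠ 0 := by exact_mod_cast hε
      have hsum : ((Q y : ℝ) : ℂ) = ∑ k, ((fderiv ℝ θ y (v k) : ℝ) : ℂ) ^ 2 := by
        simp [Q]
      have : ∀ k, (ε / Complex.I) * (B k y * fderiv ℝ (oscExp θ ε) y (v k)) =
          (A y * oscExp θ ε y / Q y) * ((fderiv ℝ θ y (v k) : ℝ) : ℂ) ^ 2 := by
        intro k
        rw [fderiv_oscExp ((hθat y hy).differentiableAt (by simp))]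
        simp only [B]
        push_cast
        field_simp
      simp_rw [this]
      rw [← Finset.mul_sum, ← hsum]
      field_simp
    · have : A y = 0 := image_eq_zero_of_notMem_tsupport fun h => hy (hAU h)
      simp [B, this]
  have hkey : ∀ ε : ℝ, ε ≠ 0 → ∫ y, A y * oscExp θ ε y ∂μ =
      ∑ k, (ε / Complex.I) * -∫ y, fderiv ℝ (B k) y (v k) * oscExp θ ε y ∂μ := by
    intro ε hε
    have hI : ∀ k, Integrable (fun y => B k y * fderiv ℝ (oscExp θ ε) y (v k)) μ := by
      intro k
      refine (continuous_mul_of_tsupport_subset hU (hB k).continuous ((hBsupp k).trans hAU)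
        fun y hy => ?_).integrable_of_hasCompactSupport (hBc k).mul_right
      exact (((contDiffAt_oscExp (hθat y hy) ε).fderiv_right (m := ∞) (by simp)).clm_apply
        contDiffAt_const).continuousAt.continuousWithinAt
    simp_rw [hpt ε hε]
    rw [integral_finsetSum _ fun k _ => (hI k).const_mul _]
    refine Finset.sum_congr rfl fun k _ => ?_
    rw [integral_const_mul]
    congr 1
    refine integral_mul_fderiv_eq_neg_fderiv_mul_of_integrable ?_ (hI k) ?_ ?_ ?_
    · exact hintg _ ε (hdB k) (hdBc k) ((hdBs k).trans ((hBsupp k).trans hAU))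
    · exact hintg _ ε (hB k).continuous (hBc k) ((hBsupp k).trans hAU)
    · exact fun y _ => (hB k).contDiffAt.differentiableAt (by simp)
    · exact fun y hy => (contDiffAt_oscExp (hθat y (hAU (hBsupp k hy))) ε).differentiableAt
        (by simp)
  have hbound : ∀ ε ∈ Ioi (0 : ℝ), ‖∫ y, A y * oscExp θ ε y ∂μ‖ ≤
      ε * ∑ k, ∫ y, ‖fderiv ℝ (B k) y (v k)‖ ∂μ := by
    intro ε hε
    have hε : 0 < ε := hε
    rw [hkey ε hε.ne', Finset.mul_sum]
    refine (norm_sum_le _ _).trans (Finset.sum_le_sum fun k _ => ?_)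
    rw [norm_mul, norm_neg, norm_div, Complex.norm_I, div_one, Complex.norm_real,
      Real.norm_of_nonneg hε.le]
    gcongr
    refine (norm_integral_le_integral_norm _).trans (le_of_eq ?_)
    simp [norm_oscExp]
  refine squeeze_zero_norm' (eventually_nhdsWithin_of_forall hbound) ?_
  have : Tendsto (fun ε : ℝ => ε * ∑ k, ∫ y, ‖fderiv ℝ (B k) y (v k)‖ ∂μ) (𝓝 0) (𝓝 0) := by
    simpa using (tendsto_id (α := ℝ) (x := 𝓝 0)).mul_const
      (∑ k, ∫ y, ‖fderiv ℝ (B k) y (v k)‖ ∂μ)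
  exact this.mono_left nhdsWithin_le_nhds

/-- The principle of nonstationary phase: `∫ A e^{i θ / ε} → 0` if `θ` has no critical point near
the support of the integrable amplitude `A`. -/
theorem tendsto_integral_oscExp {U K : Set E} (hU : IsOpen U) (hK : IsCompact K) (hKU : K ⊆ U)
    {θ : E → ℝ} (hθ : ContDiffOn ℝ ∞ θ U) (hcrit : ∀ y ∈ U, fderiv ℝ θ y ≠ 0)
    {A : E → ℂ} (hA : Integrable A μ) (hAK : ∀ y ∉ K, A y = 0) :
    Tendsto (fun ε => ∫ y, A y * oscExp θ ε y ∂μ) (𝓝[>] 0) (𝓝 0) := by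
  obtain ⟨χ, hχ, hχc, hχU, hχ1, hχK⟩ := exists_smooth_cutoff hK hU hKU
  rw [Metric.tendsto_nhds]
  intro δ hδ
  -- Density of smooth functions in L¹ reduces to the smooth case. Since g need not be supported in
  -- U, it is χg that takes the place of A.
  obtain ⟨g, hgc, hg, hgA⟩ := (memLp_one_iff_integrable.2 hA).exist_eLpNorm_sub_le (by simp) le_rfl
    (half_pos hδ)
  have hχg : ContDiff ℝ ∞ fun y => (χ y : ℂ) * g y :=
    (Complex.ofRealCLM.contDiff.comp hχ).mul hg
  have hts : tsupport (fun y => (χ y : ℂ) * g y) ⊆ tsupport χ := by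
    refine closure_mono fun y hy h => hy ?_
    simp [h]
  have hχgc : HasCompactSupport fun y => (χ y : ℂ) * g y :=
    hχc.of_isClosed_subset (isClosed_tsupport _) hts
  have hlim := tendsto_integral_oscExp_of_contDiff (μ := μ) hU hθ hcrit hχg hχgc (hts.trans hχU)
  rw [Metric.tendsto_nhds] at hlim
  filter_upwards [hlim (δ / 2) (half_pos hδ)] with ε h1
  rw [dist_zero_right] at h1 ⊢
  have hosc : ∀ f : E → ℂ, Integrable f μ → (∀ y ∉ U, f y = 0) →
      Integrable (fun y => f y * oscExp θ ε y) μ := by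
    intro f hf hf0
    have hcont : ContinuousOn (oscExp θ ε) U := fun y hy =>
      (contDiffAt_oscExp (hθ.contDiffAt (hU.mem_nhds hy)) ε).continuousAt.continuousWithinAt
    have hm : AEStronglyMeasurable (U.indicator (oscExp θ ε)) μ :=
      (aestronglyMeasurable_indicator_iff hU.measurableSet).2
        (hcont.aestronglyMeasurable hU.measurableSet)
    have heq : (fun y => f y * oscExp θ ε y) = fun y => f y * U.indicator (oscExp θ ε) y := by
      ext y
      by_cases hy : y ∈ U
      · rw [indicator_of_mem hy]
      · simp [hf0 y hy]
    rw [heq]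
    refine hf.mono (hf.aestronglyMeasurable.mul hm) (Eventually.of_forall fun y => ?_)
    rw [norm_mul]
    refine mul_le_of_le_one_right (norm_nonneg _) ?_
    exact (norm_indicator_le_norm_self _ _).trans (norm_oscExp θ ε y).le
  have hA0 : ∀ y ∉ U, A y = 0 := fun y hy => hAK y fun h => hy (hKU h)
  have hχ0 : ∀ y ∉ U, (χ y : ℂ) * g y = 0 := fun y hy => by
    have : χ y = 0 := image_eq_zero_of_notMem_tsupport fun h => hy (hχU h)
    simp [this]
  have hχgi : Integrable (fun y => (χ y : ℂ) * g y) μ :=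
    hχg.continuous.integrable_of_hasCompactSupport hχgc
  have hsub : ∫ y, A y * oscExp θ ε y ∂μ - ∫ y, (χ y : ℂ) * g y * oscExp θ ε y ∂μ =
      ∫ y, (A y - (χ y : ℂ) * g y) * oscExp θ ε y ∂μ := by
    rw [← integral_sub (hosc A hA hA0) (hosc _ hχgi hχ0)]
    simp_rw [sub_mul]
  have hgi : Integrable g μ := hg.continuous.integrable_of_hasCompactSupport hgc
  have hb : ‖∫ y, (A y - (χ y : ℂ) * g y) * oscExp θ ε y ∂μ‖ ≤ δ / 2 := by
    have hle : ∫ y, ‖(A - g) y‖ ∂μ ≤ δ / 2 := by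
      rw [integral_norm_eq_lintegral_enorm (hA.sub hgi).aestronglyMeasurable,
        ← eLpNorm_one_eq_lintegral_enorm]
      exact ENNReal.toReal_le_of_le_ofReal (half_pos hδ).le hgA
    refine (norm_integral_le_integral_norm _).trans (le_trans (integral_mono_of_nonneg
      (Eventually.of_forall fun y => norm_nonneg _) (hA.sub hgi).norm
      (Eventually.of_forall fun y => ?_)) hle)
    -- As χ = 1 where A lives, A - χg = χ(A - g): the cutoff does not spoil the L¹ error.
    have hA' : A y = χ y * A y := by
      by_cases hy : y ∈ K
      · simp [hχK y hy]
      · simp [hAK y hy]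
    simp only [norm_mul, norm_oscExp, mul_one]
    rw [hA', ← mul_sub, norm_mul, Complex.norm_real, Real.norm_of_nonneg (hχ1 y).1]
    exact mul_le_of_le_one_left (norm_nonneg _) (hχ1 y).2
  calc ‖∫ y, A y * oscExp θ ε y ∂μ‖
      = ‖∫ y, (A y - (χ y : ℂ) * g y) * oscExp θ ε y ∂μ
          + ∫ y, (χ y : ℂ) * g y * oscExp θ ε y ∂μ‖ := by rw [← hsub]; simp
    _ < δ / 2 + δ / 2 := (norm_add_le _ _).trans_lt (add_lt_add_of_le_of_lt hb h1)
    _ = δ := add_halves δ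

end NonstationaryPhase

/-! ### Stability of quadratic expressions under L²-small errors. -/

section Perturbation

variable {ι α : Type*} {l : Filter ι} [MeasurableSpace α] {μ : Measure α}

/-- Hölder's inequality for products of two square integrable functions. -/
theorem lintegral_enorm_mul_le {f g : α → ℂ} (hf : AEStronglyMeasurable f μ)
    (hg : AEStronglyMeasurable g μ) :
    ∫⁻ y, ‖f y * g y‖ₑ ∂μ ≤ eLpNorm f 2 μ * eLpNorm g 2 μ := by
  have := eLpNorm_le_eLpNorm_mul_eLpNorm_of_nnnorm (p := 2) (q := 2) (r := 1) hf hg (· * ·) 1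
    (Eventually.of_forall fun x => by simp)
  simpa [eLpNorm_one_eq_lintegral_enorm] using this

theorem MeasureTheory.MemLp.integrable_mul_two {f g : α → ℂ} (hf : MemLp f 2 μ)
    (hg : MemLp g 2 μ) : Integrable (fun y => f y * g y) μ := by
  refine ⟨hf.1.mul hg.1, ?_⟩
  exact (lintegral_enorm_mul_le hf.1 hg.1).trans_lt (ENNReal.mul_lt_top hf.2 hg.2)

theorem tendsto_zero_of_tendsto_enorm {E : Type*} [NormedAddCommGroup E] {f : ι → E}
    (h : Tendsto (fun i => ‖f i‖ₑ) l (𝓝 0)) : Tendsto f l (𝓝 0) := by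
  rw [tendsto_zero_iff_norm_tendsto_zero]
  have := (ENNReal.tendsto_toReal ENNReal.zero_ne_top).comp h
  simpa [Function.comp_def] using this

/-- Weighted integrals of products are stable under perturbations of the factors that are
small in `L²`. -/
theorem tendsto_integral_mul_sub_zero {w : α → ℂ} {M : NNReal} (hwm : AEStronglyMeasurable w μ)
    (hw : ∀ᵐ y ∂μ, ‖w y‖ ≤ M) {X X' Z Z' : ι → α → ℂ} {C : NNReal}
    (hXm : ∀ᶠ i in l, AEStronglyMeasurable (X i) μ) (hX'm : ∀ᶠ i in l, AEStronglyMeasurable (X' i) μ)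
    (hZm : ∀ᶠ i in l, AEStronglyMeasurable (Z i) μ) (hZ'm : ∀ᶠ i in l, AEStronglyMeasurable (Z' i) μ)
    (hX : Tendsto (fun i => eLpNorm (fun y => X i y - X' i y) 2 μ) l (𝓝 0))
    (hZ : Tendsto (fun i => eLpNorm (fun y => Z i y - Z' i y) 2 μ) l (𝓝 0))
    (hX' : ∀ᶠ i in l, eLpNorm (X' i) 2 μ ≤ C) (hZ' : ∀ᶠ i in l, eLpNorm (Z' i) 2 μ ≤ C) :
    Tendsto (fun i => ∫ y, w y * (X i y * Z i y) ∂μ - ∫ y, w y * (X' i y * Z' i y) ∂μ)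
      l (𝓝 0) := by
  refine tendsto_zero_of_tendsto_enorm ?_
  have hlim : Tendsto (fun i => (M : ENNReal) *
      (eLpNorm (fun y => X i y - X' i y) 2 μ * eLpNorm (fun y => Z i y - Z' i y) 2 μ
        + eLpNorm (fun y => X i y - X' i y) 2 μ * C
        + C * eLpNorm (fun y => Z i y - Z' i y) 2 μ)) l (𝓝 (M * (0 * 0 + 0 * C + C * 0))) := by
    refine ENNReal.Tendsto.const_mul ?_ (Or.inr ENNReal.coe_ne_top)
    refine ((ENNReal.Tendsto.mul hX (Or.inr ENNReal.zero_ne_top) hZ (Or.inr ENNReal.zero_ne_top)).add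
      (ENNReal.Tendsto.mul_const hX (Or.inr ENNReal.coe_ne_top))).add
      (ENNReal.Tendsto.const_mul hZ (Or.inr ENNReal.coe_ne_top))
  simp only [mul_zero, zero_mul, add_zero] at hlim
  have hX1 : ∀ᶠ i in l, eLpNorm (fun y => X i y - X' i y) 2 μ < 1 :=
    hX.eventually_lt_const one_pos
  have hZ1 : ∀ᶠ i in l, eLpNorm (fun y => Z i y - Z' i y) 2 μ < 1 :=
    hZ.eventually_lt_const one_pos
  refine tendsto_of_tendsto_of_tendsto_of_le_of_le' tendsto_const_nhds hlim
    (Eventually.of_forall fun i => zero_le) ?_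
  filter_upwards [hXm, hX'm, hZm, hZ'm, hX1, hZ1, hX', hZ'] with i m1 m2 m3 m4 x1 z1 x2 z2
  have LX' : MemLp (X' i) 2 μ := ⟨m2, x2.trans_lt ENNReal.coe_lt_top⟩
  have LZ' : MemLp (Z' i) 2 μ := ⟨m4, z2.trans_lt ENNReal.coe_lt_top⟩
  have LdX : MemLp (fun y => X i y - X' i y) 2 μ := ⟨m1.sub m2, x1.trans ENNReal.one_lt_top⟩
  have LdZ : MemLp (fun y => Z i y - Z' i y) 2 μ := ⟨m3.sub m4, z1.trans ENNReal.one_lt_top⟩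
  have LX : MemLp (X i) 2 μ := by
    have := LdX.add LX'
    simpa [Pi.add_def] using this
  have LZ : MemLp (Z i) 2 μ := by
    have := LdZ.add LZ'
    simpa [Pi.add_def] using this
  have hbd : ∀ {f : α → ℂ}, Integrable f μ → Integrable (fun y => w y * f y) μ := fun hf =>
    hf.bdd_mul hwm hw
  rw [← integral_sub (hbd (LX.integrable_mul_two LZ)) (hbd (LX'.integrable_mul_two LZ'))]
  calc ‖∫ y, (w y * (X i y * Z i y) - w y * (X' i y * Z' i y)) ∂μ‖ₑ
      ≤ ∫⁻ y, ‖w y * (X i y * Z i y) - w y * (X' i y * Z' i y)‖ₑ ∂μ :=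
        enorm_integral_le_lintegral_enorm _
    _ ≤ ∫⁻ y, (M : ENNReal) * ((‖(X i y - X' i y) * (Z i y - Z' i y)‖ₑ +
          ‖(X i y - X' i y) * Z' i y‖ₑ) + ‖X' i y * (Z i y - Z' i y)‖ₑ) ∂μ := by
        refine lintegral_mono_ae ?_
        filter_upwards [hw] with y hy
        -- Expanding around the primed factors makes every term contain an error, so only X' and Z'
        -- need an a priori L² bound.
        have : w y * (X i y * Z i y) - w y * (X' i y * Z' i y) =
          w y * ((X i y - X' i y) * (Z i y - Z' i y) + (X i y - X' i y) * Z' i y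
            + X' i y * (Z i y - Z' i y)) := by ring
        rw [this, enorm_mul]
        gcongr
        · rw [enorm_eq_nnnorm]; exact_mod_cast hy
        · exact (enorm_add_le _ _).trans (by gcongr; exact enorm_add_le _ _)
    _ = M * ((∫⁻ y, ‖(X i y - X' i y) * (Z i y - Z' i y)‖ₑ ∂μ +
          ∫⁻ y, ‖(X i y - X' i y) * Z' i y‖ₑ ∂μ) + ∫⁻ y, ‖X' i y * (Z i y - Z' i y)‖ₑ ∂μ) := by
        rw [lintegral_const_mul' _ _ ENNReal.coe_ne_top, lintegral_add_right',
          lintegral_add_right']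
        · exact ((m1.sub m2).mul m4).enorm
        · exact (m2.mul (m3.sub m4)).enorm
    _ ≤ _ := by
        gcongr
        · exact lintegral_enorm_mul_le (m1.sub m2) (m3.sub m4)
        · exact (lintegral_enorm_mul_le (m1.sub m2) m4).trans (by gcongr; exact le_rfl)
        · exact (lintegral_enorm_mul_le m2 (m3.sub m4)).trans (by gcongr; exact le_rfl)

end Perturbation

/-! ### Spatial gradients as slices of space-time derivatives. -/

section SpaceGrad

variable {d : ℕ} {Ω : Set (ℝ × RSpace d)} {S : ℝ × RSpace d → ℝ}

theorem fderiv_slice {F : Type*} [NormedAddCommGroup F] [NormedSpace ℝ F]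
    {f : ℝ × RSpace d → F} {t : ℝ} {x : RSpace d} (h : DifferentiableAt ℝ f (t, x)) :
    fderiv ℝ (fun z => f (t, z)) x = (fderiv ℝ f (t, x)).comp (ContinuousLinearMap.inr ℝ ℝ _) :=
  (h.hasFDerivAt.comp x (hasFDerivAt_prodMk_right t x)).fderiv

theorem inner_spaceGrad {y : ℝ × RSpace d} (h : DifferentiableAt ℝ S y) (e : RSpace d) :
    inner ℝ (spaceGrad S y.1 y.2) e = fderiv ℝ S y (0, e) := by
  rw [spaceGrad, gradient, InnerProductSpace.toDual_symm_apply, fderiv_slice h]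
  simp

theorem continuousOn_spaceGrad (hΩ : IsOpen Ω) (hS : ContDiffOn ℝ ∞ S Ω) :
    ContinuousOn (fun y => spaceGrad S y.1 y.2) Ω := by
  have h1 : ContinuousOn (fun y => (InnerProductSpace.toDual ℝ (RSpace d)).symm
      ((fderiv ℝ S y).comp (ContinuousLinearMap.inr ℝ ℝ _))) Ω :=
    (InnerProductSpace.toDual ℝ (RSpace d)).symm.continuous.comp_continuousOn
      ((hS.continuousOn_fderiv_of_isOpen hΩ (by simp)).clm_comp continuousOn_const)
  refine h1.congr fun y hy => ?_
  have := fderiv_slice ((hS.contDiffAt (hΩ.mem_nhds hy)).differentiableAt (by simp))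
    (t := y.1) (x := y.2)
  simp only [spaceGrad, gradient, this]

/-- The space-time derivative in the directions (0, e) determines the spatial gradient. This turns
the assumption on the gradients into the noncriticality that nonstationary phase asks for. -/
theorem fderiv_ne_zero_of_spaceGrad_ne {S₁ S₂ : ℝ × RSpace d → ℝ} {y : ℝ × RSpace d}
    (h₁ : DifferentiableAt ℝ S₁ y) (h₂ : DifferentiableAt ℝ S₂ y)
    (h : spaceGrad S₁ y.1 y.2 ≠ spaceGrad S₂ y.1 y.2) :
    fderiv ℝ (fun z => S₁ z - S₂ z) y ≠ 0 := by
  intro h0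
  rw [fderiv_fun_sub h₁ h₂] at h0
  refine h (ext_inner_right ℝ fun e => ?_)
  rw [inner_spaceGrad h₁, inner_spaceGrad h₂, sub_eq_zero.1 h0]

end SpaceGrad

instance instIsAddHaarMeasureSpaceTime {d : ℕ} :
    (volume : Measure (ℝ × RSpace d)).IsAddHaarMeasure := by
  rw [Measure.volume_eq_prod]; infer_instance

/-! ### Superpositions of oscillating exponentials. -/

section AmpSum

variable {ι X : Type*} [Fintype ι]

/-- The superposition `∑_j F_j e^{i S_j / ε}`. -/
def ampSum (F : ι → X → ℂ) (S : ι → X → ℝ) (ε : ℝ) (y : X) : ℂ :=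
  ∑ j, F j y * oscExp (S j) ε y

theorem norm_ampSum_le (F : ι → X → ℂ) (S : ι → X → ℝ) (ε : ℝ) (y : X) :
    ‖ampSum F S ε y‖ ≤ ∑ j, ‖F j y‖ :=
  (norm_sum_le _ _).trans (Finset.sum_le_sum fun j _ => by rw [norm_mul, norm_oscExp, mul_one])

theorem conj_oscExp (θ : X → ℝ) (ε : ℝ) (y : X) :
    starRingEnd ℂ (oscExp θ ε y) = oscExp (fun z => -θ z) ε y := by
  rw [oscExp, oscExp, ← Complex.exp_conj]
  simp [neg_div]

theorem oscExp_mul (θ θ' : X → ℝ) (ε : ℝ) (y : X) :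
    oscExp θ ε y * oscExp θ' ε y = oscExp (fun z => θ z + θ' z) ε y := by
  rw [oscExp, oscExp, oscExp, ← Complex.exp_add]
  push_cast
  ring_nf

theorem oscExp_mul_conj (θ θ' : X → ℝ) (ε : ℝ) (y : X) :
    oscExp θ ε y * starRingEnd ℂ (oscExp θ' ε y) = oscExp (fun z => θ z - θ' z) ε y := by
  rw [conj_oscExp, oscExp_mul]; rfl

variable [TopologicalSpace X]

theorem ContinuousOn.oscExp {θ : X → ℝ} {s : Set X} (h : ContinuousOn θ s) (ε : ℝ) :
    ContinuousOn (oscExp θ ε) s := by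
  unfold _root_.oscExp
  exact (continuousOn_const.mul (Complex.continuous_ofReal.comp_continuousOn
    (h.div_const ε))).cexp

theorem ContinuousOn.ampSum {F : ι → X → ℂ} {S : ι → X → ℝ} {s : Set X}
    (hF : ∀ j, ContinuousOn (F j) s) (hS : ∀ j, ContinuousOn (S j) s) (ε : ℝ) :
    ContinuousOn (ampSum F S ε) s :=
  continuousOn_finsetSum _ fun j _ => (hF j).mul ((hS j).oscExp ε)

variable [T2Space X] [MeasurableSpace X] [BorelSpace X] {μ : Measure X} [IsFiniteMeasureOnCompacts μ]

/-- The exponentials have modulus one, so a bound of the amplitudes on K controls the superposition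
uniformly in ε. -/
theorem exists_eLpNorm_ampSum_le {F : ι → X → ℂ} (S : ι → X → ℝ) {K : Set X} (hK : IsCompact K)
    (hF : ∀ j, ContinuousOn (F j) K) :
    ∃ C : NNReal, ∀ ε, eLpNorm (ampSum F S ε) 2 (μ.restrict K) ≤ C := by
  obtain ⟨M, hM⟩ := hK.exists_bound_of_continuousOn
    (continuousOn_finsetSum Finset.univ fun j _ => (hF j).norm)
  refine ⟨((μ.restrict K) univ ^ (2 : ENNReal).toReal⁻¹ * ENNReal.ofReal M).toNNReal, fun ε => ?_⟩
  rw [ENNReal.coe_toNNReal]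
  · refine eLpNorm_le_of_ae_bound ((ae_restrict_iff' hK.measurableSet).2
      (Eventually.of_forall fun y hy => ?_))
    exact (norm_ampSum_le F S ε y).trans ((le_abs_self _).trans (hM y hy))
  · refine ENNReal.mul_ne_top (ENNReal.rpow_ne_top_of_nonneg (by positivity) ?_)
      ENNReal.ofReal_ne_top
    rw [Measure.restrict_apply_univ]
    exact hK.measure_lt_top.ne

end AmpSum

/-! ### Off-diagonal terms vanish weakly. -/

section Quadratic

/-- A continuous function with compact support, with the further factor only continuous near the
support. -/
theorem integrable_mul_of_tsupport_subset {E : Type*} [TopologicalSpace E] [T2Space E]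
    [MeasurableSpace E] [BorelSpace E] {μ : Measure E} [IsFiniteMeasureOnCompacts μ] {U : Set E} (hU : IsOpen U) {χ f : E → ℂ}
    (hχ : Continuous χ) (hχc : HasCompactSupport χ) (hχU : tsupport χ ⊆ U)
    (hf : ContinuousOn f U) : Integrable (fun y => χ y * f y) μ :=
  (continuous_mul_of_tsupport_subset hU hχ hχU hf).integrable_of_hasCompactSupport hχc.mul_right

variable {E : Type*} [NormedAddCommGroup E] [NormedSpace ℝ E] [FiniteDimensional ℝ E]
  [MeasurableSpace E] [BorelSpace E] {μ : Measure E} [μ.IsAddHaarMeasure]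

theorem tendsto_integral_mul_oscExp {U : Set E} (hU : IsOpen U) {χ f : E → ℂ}
    (hχ : Continuous χ) (hχc : HasCompactSupport χ) (hχU : tsupport χ ⊆ U)
    (hf : ContinuousOn f U) {θ : E → ℝ} (hθ : ContDiffOn ℝ ∞ θ U)
    (hcrit : ∀ y ∈ U, fderiv ℝ θ y ≠ 0) :
    Tendsto (fun ε => ∫ y, χ y * f y * oscExp θ ε y ∂μ) (𝓝[>] 0) (𝓝 0) :=
  tendsto_integral_oscExp hU hχc hχU hθ hcrit (integrable_mul_of_tsupport_subset hU hχ hχc hχU hf)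
    fun y hy => by simp [image_eq_zero_of_notMem_tsupport hy]

/-- Weak limits of quadratic expressions in superpositions with distinct phases. -/
theorem tendsto_integral_ampSum_mul_conj {ι : Type*} [Fintype ι] {U : Set E} (hU : IsOpen U)
    {χ : E → ℂ} (hχ : Continuous χ) (hχc : HasCompactSupport χ) (hχU : tsupport χ ⊆ U)
    {F F' : ι → E → ℂ} (hF : ∀ j, ContinuousOn (F j) U) (hF' : ∀ j, ContinuousOn (F' j) U)
    {S : ι → E → ℝ} (hS : ∀ j, ContDiffOn ℝ ∞ (S j) U)
    (hcrit : ∀ j k, j ≠ k → ∀ y ∈ U, fderiv ℝ (fun z => S j z - S k z) y ≠ 0) :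
    Tendsto (fun ε => ∫ y, χ y * (ampSum F S ε y * starRingEnd ℂ (ampSum F' S ε y)) ∂μ) (𝓝[>] 0)
      (𝓝 (∑ j, ∫ y, χ y * (F j y * starRingEnd ℂ (F' j y)) ∂μ)) := by
  classical
  have hconj : ∀ j, ContinuousOn (fun y => starRingEnd ℂ (F' j y)) U := fun j =>
    Complex.continuous_conj.comp_continuousOn (hF' j)
  have hexp : ∀ ε, ∫ y, χ y * (ampSum F S ε y * starRingEnd ℂ (ampSum F' S ε y)) ∂μ =
      ∑ j, ∑ k, ∫ y, χ y * (F j y * starRingEnd ℂ (F' k y)) *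
        oscExp (fun z => S j z - S k z) ε y ∂μ := by
    intro ε
    have hI : ∀ j k, Integrable (fun y => χ y * (F j y * starRingEnd ℂ (F' k y)) *
        oscExp (fun z => S j z - S k z) ε y) μ := by
      intro j k
      simp_rw [mul_assoc (χ _)]
      exact integrable_mul_of_tsupport_subset hU hχ hχc hχU (((hF j).mul (hconj k)).mul
        (((hS j).continuousOn.sub (hS k).continuousOn).oscExp ε))
    have hpt : ∀ y, χ y * (ampSum F S ε y * starRingEnd ℂ (ampSum F' S ε y)) =
        ∑ j, ∑ k, χ y * (F j y * starRingEnd ℂ (F' k y)) *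
          oscExp (fun z => S j z - S k z) ε y := by
      intro y
      simp only [ampSum, map_sum, map_mul]
      rw [Finset.sum_mul_sum, Finset.mul_sum]
      refine Finset.sum_congr rfl fun j _ => ?_
      rw [Finset.mul_sum]
      refine Finset.sum_congr rfl fun k _ => ?_
      rw [← oscExp_mul_conj]
      ring
    simp_rw [hpt]
    rw [integral_finsetSum _ fun j _ => integrable_finsetSum _ fun k _ => hI j k]
    exact Finset.sum_congr rfl fun j _ => integral_finsetSum _ fun k _ => hI j k
  simp_rw [hexp]
  refine tendsto_finsetSum _ fun j _ => ?_
  -- The diagonal value is spread over k with a Kronecker delta, so that the double sum converges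
  -- term by term.
  have hdiag : ∫ y, χ y * (F j y * starRingEnd ℂ (F' j y)) ∂μ =
      ∑ k, if k = j then ∫ y, χ y * (F j y * starRingEnd ℂ (F' j y)) ∂μ else 0 := by simp
  rw [hdiag]
  refine tendsto_finsetSum _ fun k _ => ?_
  by_cases hkj : k = j
  · subst hkj
    simp [oscExp]
  · simp only [hkj, if_false]
    exact tendsto_integral_mul_oscExp hU hχ hχc hχU ((hF j).mul (hconj k)) ((hS j).sub (hS k))
      (hcrit j k (Ne.symm hkj))

end Quadratic

/-! ### The leading part of the gradient of a WKB state. -/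

section WKB

variable {d N : ℕ} {Ω : Set (ℝ × RSpace d)} {b : Fin N → ℝ × RSpace d → ℂ}
  {S : Fin N → ℝ × RSpace d → ℝ}

theorem wkbSum_eq_ampSum (ε : ℝ) (y : ℝ × RSpace d) : wkbSum b S ε y.1 y.2 = ampSum b S ε y := rfl

/-- The component `e · g` of a complex vector in a real direction. -/
def dirComp {d : ℕ} (e : RSpace d) (g : EuclideanSpace ℂ (Fin d)) : ℂ := ∑ k, (e k : ℂ) * g k

theorem dirComp_sub (e : RSpace d) (g h : EuclideanSpace ℂ (Fin d)) :
    dirComp e (g - h) = dirComp e g - dirComp e h := by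
  simp [dirComp, mul_sub, Finset.sum_sub_distrib]

theorem dirComp_smul (e : RSpace d) (r : ℝ) (g : EuclideanSpace ℂ (Fin d)) :
    dirComp e (r • g) = r * dirComp e g := by
  simp only [dirComp, PiLp.smul_apply, Finset.mul_sum, Complex.real_smul]
  exact Finset.sum_congr rfl fun k _ => by ring

theorem continuous_dirComp (e : RSpace d) : Continuous (dirComp e) := by
  unfold dirComp; fun_prop

theorem norm_dirComp_le (e : RSpace d) (g : EuclideanSpace ℂ (Fin d)) :
    ‖dirComp e g‖ ≤ (∑ k, ‖e k‖) * ‖g‖ := by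
  rw [dirComp, Finset.sum_mul]
  refine (norm_sum_le _ _).trans (Finset.sum_le_sum fun k _ => ?_)
  rw [norm_mul, Complex.norm_real]
  gcongr
  exact PiLp.norm_apply_le g k

theorem dirComp_gradient {f : RSpace d → ℂ} (x e : RSpace d) :
    dirComp e (WithLp.toLp 2 fun k => fderiv ℝ f x (coordVec k)) = fderiv ℝ f x e := by
  have he : e = ∑ k, e k • coordVec k := by
    have := (EuclideanSpace.basisFun (Fin d) ℝ).sum_repr e
    simpa [coordVec] using this.symm
  conv_rhs => rw [he]
  simp [dirComp, map_sum]

/-- The product rule separates two scales: the derivative of the amplitude is O(1), that of the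
exponential O(1/ε). After multiplication by ε only the latter survives. -/
theorem dirComp_wkbSumGrad (hΩ : IsOpen Ω) (hb : ∀ j, ContDiffOn ℝ ∞ (b j) Ω)
    (hS : ∀ j, ContDiffOn ℝ ∞ (S j) Ω) {y : ℝ × RSpace d} (hy : y ∈ Ω) (ε : ℝ) (e : RSpace d) :
    dirComp e (wkbSumGrad b S ε y.1 y.2) =
      ∑ j, (fderiv ℝ (b j) y (0, e) +
        Complex.I * ((inner ℝ (spaceGrad (S j) y.1 y.2) e / ε : ℝ) : ℂ) * b j y) *
          oscExp (S j) ε y := by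
  have hbd : ∀ j, DifferentiableAt ℝ (b j) y := fun j =>
    ((hb j).contDiffAt (hΩ.mem_nhds hy)).differentiableAt (by simp)
  have hSc : ∀ j, ContDiffAt ℝ ∞ (S j) y := fun j => (hS j).contDiffAt (hΩ.mem_nhds hy)
  have hSd : ∀ j, DifferentiableAt ℝ (S j) y := fun j => (hSc j).differentiableAt (by simp)
  have hod : ∀ j, DifferentiableAt ℝ (oscExp (S j) ε) y := fun j =>
    (contDiffAt_oscExp (hSc j) ε).differentiableAt (by simp)
  have hd : DifferentiableAt ℝ (ampSum b S ε) (y.1, y.2) :=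
    DifferentiableAt.fun_sum fun j _ => (hbd j).mul (hod j)
  have h1 : dirComp e (wkbSumGrad b S ε y.1 y.2) = fderiv ℝ (ampSum b S ε) y (0, e) := by
    rw [wkbSumGrad, dirComp_gradient]
    have := fderiv_slice (t := y.1) (x := y.2) hd
    simp only [wkbSum, ampSum, oscExp] at this ⊢
    rw [this]
    simp
  rw [h1]
  have h2 : HasFDerivAt (ampSum b S ε) (∑ j, (b j y • fderiv ℝ (oscExp (S j) ε) y +
      oscExp (S j) ε y • fderiv ℝ (b j) y)) y :=
    HasFDerivAt.fun_sum fun j _ => (hbd j).hasFDerivAt.mul (hod j).hasFDerivAt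
  rw [h2.fderiv, _root_.sum_apply]
  refine Finset.sum_congr rfl fun j _ => ?_
  simp only [_root_.add_apply, _root_.smul_apply, smul_eq_mul]
  rw [fderiv_oscExp (hSd j), inner_spaceGrad (hSd j)]
  ring

variable {ψ : ℝ → ℝ → RSpace d → ℂ} {G : ℝ → ℝ → RSpace d → EuclideanSpace ℂ (Fin d)}

/-- The amplitudes `i (e · ∇S_j) b_j` of the leading part of `ε e · ∇ψ^ε`. -/
def gradAmp (b : Fin N → ℝ × RSpace d → ℂ) (S : Fin N → ℝ × RSpace d → ℝ) (e : RSpace d)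
    (j : Fin N) (y : ℝ × RSpace d) : ℂ :=
  Complex.I * ((inner ℝ (spaceGrad (S j) y.1 y.2) e : ℝ) : ℂ) * b j y

theorem continuousOn_inner_spaceGrad (hΩ : IsOpen Ω) {S : ℝ × RSpace d → ℝ}
    (hS : ContDiffOn ℝ ∞ S Ω) (e : RSpace d) :
    ContinuousOn (fun y => (inner ℝ (spaceGrad S y.1 y.2) e : ℝ)) Ω :=
  (continuousOn_spaceGrad hΩ hS).inner continuousOn_const

theorem continuousOn_gradAmp (hΩ : IsOpen Ω) (hb : ∀ j, ContDiffOn ℝ ∞ (b j) Ω)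
    (hS : ∀ j, ContDiffOn ℝ ∞ (S j) Ω) (e : RSpace d) (j : Fin N) :
    ContinuousOn (gradAmp b S e j) Ω :=
  (continuousOn_const.mul (Complex.continuous_ofReal.comp_continuousOn
    (continuousOn_inner_spaceGrad hΩ (hS j) e))).mul (hb j).continuousOn

/-- The error consists of the rescaled gradient of the remainder, small by assumption, and ε times a
superposition of the derivatives of the b_j, which is bounded in L²(K). -/
theorem HasWKBForm.tendsto_dirComp (h : HasWKBForm Ω b S ψ G) (hΩ : IsOpen Ω)
    (hb : ∀ j, ContDiffOn ℝ ∞ (b j) Ω) (hS : ∀ j, ContDiffOn ℝ ∞ (S j) Ω)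
    {K : Set (ℝ × RSpace d)} (hK : IsCompact K) (hKΩ : K ⊆ Ω)
    (hGm : ∀ᶠ ε in 𝓝[>] (0 : ℝ), AEStronglyMeasurable (fun y : ℝ × RSpace d => G ε y.1 y.2)
      (volume.restrict K)) (e : RSpace d) :
    Tendsto (fun ε : ℝ => eLpNorm (fun y : ℝ × RSpace d =>
      ε * dirComp e (G ε y.1 y.2) - ampSum (gradAmp b S e) S ε y) 2 (volume.restrict K))
      (𝓝[>] 0) (𝓝 0) := by
  let D : Fin N → ℝ × RSpace d → ℂ := fun j y => fderiv ℝ (b j) y (0, e)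
  have hD : ∀ j, ContinuousOn (D j) Ω := fun j =>
    ((hb j).continuousOn_fderiv_of_isOpen hΩ (by simp)).clm_apply continuousOn_const
  obtain ⟨C, hC⟩ := exists_eLpNorm_ampSum_le (μ := volume) S hK fun j => (hD j).mono hKΩ
  let c : NNReal := ∑ k, ‖e k‖₊
  have hlim : Tendsto (fun ε : ℝ => (c : ENNReal) *
      eLpNorm (fun y : ℝ × RSpace d => ε • (G ε y.1 y.2 - wkbSumGrad b S ε y.1 y.2)) 2
          (volume.restrict K) + ENNReal.ofReal ε * C) (𝓝[>] 0) (𝓝 (c * 0 + ENNReal.ofReal 0 * C)) := by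
    refine (ENNReal.Tendsto.const_mul (h K hK hKΩ).2 (Or.inr ENNReal.coe_ne_top)).add
      (ENNReal.Tendsto.mul_const ?_ (Or.inr ENNReal.coe_ne_top))
    exact ((ENNReal.continuous_ofReal.tendsto 0).mono_left nhdsWithin_le_nhds)
  simp only [mul_zero, ENNReal.ofReal_zero, zero_mul, add_zero] at hlim
  refine tendsto_of_tendsto_of_tendsto_of_le_of_le' tendsto_const_nhds hlim
    (Eventually.of_forall fun i => zero_le) ?_
  filter_upwards [self_mem_nhdsWithin, hGm] with ε hε hGmε
  have hε : 0 < ε := hε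
  have hεC : (ε : ℂ) ≠ 0 := by exact_mod_cast hε.ne'
  have heq : ∀ y ∈ Ω, ε * dirComp e (G ε y.1 y.2) - ampSum (gradAmp b S e) S ε y =
      dirComp e (ε • (G ε y.1 y.2 - wkbSumGrad b S ε y.1 y.2)) + ε * ampSum D S ε y := by
    intro y hy
    rw [dirComp_smul, dirComp_sub, dirComp_wkbSumGrad hΩ hb hS hy]
    have : ∑ j, (fderiv ℝ (b j) y (0, e) +
        Complex.I * ((inner ℝ (spaceGrad (S j) y.1 y.2) e / ε : ℝ) : ℂ) * b j y) *
          oscExp (S j) ε y = ampSum D S ε y + ampSum (gradAmp b S e) S ε y / ε := by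
      simp only [ampSum, D, gradAmp, Finset.sum_div, ← Finset.sum_add_distrib]
      refine Finset.sum_congr rfl fun j _ => ?_
      push_cast
      ring
    rw [this]
    field_simp
    ring
  have hae : (fun y : ℝ × RSpace d =>
      ε * dirComp e (G ε y.1 y.2) - ampSum (gradAmp b S e) S ε y) =ᵐ[volume.restrict K]
      fun y => dirComp e (ε • (G ε y.1 y.2 - wkbSumGrad b S ε y.1 y.2)) + ε * ampSum D S ε y :=
    (ae_restrict_iff' hK.measurableSet).2 (Eventually.of_forall fun y hy => heq y (hKΩ hy))
  have hSc : ∀ j, ContinuousOn (S j) K := fun j => (hS j).continuousOn.mono hKΩ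
  have m2 : AEStronglyMeasurable (fun y => (ε : ℂ) * ampSum D S ε y) (volume.restrict K) :=
    (continuousOn_const.mul (ContinuousOn.ampSum (fun j => (hD j).mono hKΩ) hSc
      ε)).aestronglyMeasurable hK.measurableSet
  have m3 : AEStronglyMeasurable (ampSum (gradAmp b S e) S ε) (volume.restrict K) :=
    (ContinuousOn.ampSum (fun j => (continuousOn_gradAmp hΩ hb hS e j).mono hKΩ) hSc
      ε).aestronglyMeasurable hK.measurableSet
  have m1 : AEStronglyMeasurable (fun y : ℝ × RSpace d =>
      dirComp e (ε • (G ε y.1 y.2 - wkbSumGrad b S ε y.1 y.2))) (volume.restrict K) := by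
    have m4 : AEStronglyMeasurable (fun y : ℝ × RSpace d =>
      ε * dirComp e (G ε y.1 y.2) - ampSum (gradAmp b S e) S ε y) (volume.restrict K) :=
      (((continuous_dirComp e).comp_aestronglyMeasurable hGmε).const_mul _).sub m3
    refine ((m4.congr hae).sub m2).congr (Eventually.of_forall fun y => ?_)
    simp
  rw [eLpNorm_congr_ae hae]
  refine (eLpNorm_add_le m1 m2 (by norm_num)).trans (add_le_add ?_ ?_)
  · refine (eLpNorm_le_nnreal_smul_eLpNorm_of_ae_le_mul (c := c)
      (Eventually.of_forall fun y => ?_) 2).trans (le_of_eq rfl)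
    have := norm_dirComp_le e (ε • (G ε y.1 y.2 - wkbSumGrad b S ε y.1 y.2))
    rw [← NNReal.coe_le_coe]
    simpa [c] using this
  · have : (fun y => (ε : ℂ) * ampSum D S ε y) = (ε : ℂ) • ampSum D S ε := rfl
    rw [this, eLpNorm_const_smul]
    gcongr
    · simp [← ofReal_norm, abs_of_pos hε]
    · exact hC ε

end WKB

/-! ### Measures over an open set are determined by test functions. -/

section Uniqueness

variable {E : Type*} [NormedAddCommGroup E] [NormedSpace ℝ E] [FiniteDimensional ℝ E]
  [MeasurableSpace E] [BorelSpace E]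

/-- Measures which are finite on the compact subsets of an open set `U` agree on `U` if they
integrate the continuous functions with compact support in `U` to the same values. -/
theorem restrict_eq_of_forall_integral_eq {U : Set E} (hU : IsOpen U) {μ ν : Measure E}
    (hμ : ∀ K, IsCompact K → K ⊆ U → μ K < ⊤) (hν : ∀ K, IsCompact K → K ⊆ U → ν K < ⊤)
    (h : ∀ φ : E → ℝ, Continuous φ → HasCompactSupport φ → tsupport φ ⊆ U →
      ∫ z, φ z ∂μ = ∫ z, φ z ∂ν) : μ.restrict U = ν.restrict U := by
  have : LocallyCompactSpace U := hU.locallyCompactSpace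
  let K : ℕ → Set E := fun n => Subtype.val '' compactCovering U n
  have hK : ∀ n, IsCompact (K n) := fun n =>
    (isCompact_compactCovering U n).image continuous_subtype_val
  have hKU : ∀ n, K n ⊆ U := fun n => by rintro _ ⟨y, -, rfl⟩; exact y.2
  have hUK : U = ⋃ n, K n := by
    rw [← image_iUnion, iUnion_compactCovering, image_univ, Subtype.range_coe]
  rw [hUK, Measure.restrict_iUnion_congr]
  intro n
  obtain ⟨χ, hχ, hχc, hχU, hχ1, hχK⟩ := exists_smooth_cutoff (hK n) hU (hKU n)
  -- The measures need be finite only on compact subsets of U. Weighting them by a cutoff makes them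
  -- finite without changing them on K n, and χf is an admissible test function for every bounded
  -- continuous f.
  have hfin : ∀ m : Measure E, (∀ K, IsCompact K → K ⊆ U → m K < ⊤) →
      IsFiniteMeasure (m.withDensity fun y => ENNReal.ofReal (χ y)) := by
    intro m hm
    refine isFiniteMeasure_withDensity (ne_of_lt ?_)
    calc ∫⁻ y, ENNReal.ofReal (χ y) ∂m ≤ ∫⁻ y, (tsupport χ).indicator 1 y ∂m := by
          refine lintegral_mono fun y => ?_
          by_cases hy : y ∈ tsupport χ
          · simpa [hy] using (hχ1 y).2
          · simp [hy, image_eq_zero_of_notMem_tsupport hy]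
      _ = m (tsupport χ) := lintegral_indicator_one (isClosed_tsupport _).measurableSet
      _ < ⊤ := hm _ hχc hχU
  have hrestrict : ∀ m : Measure E,
      (m.withDensity fun y => ENNReal.ofReal (χ y)).restrict (K n) = m.restrict (K n) := by
    intro m
    rw [restrict_withDensity (hK n).measurableSet]
    conv_rhs => rw [← withDensity_one (μ := m.restrict (K n))]
    refine withDensity_congr_ae ((ae_restrict_iff' (hK n).measurableSet).2
      (Eventually.of_forall fun y hy => ?_))
    simp [hχK y hy]
  rw [← hrestrict μ, ← hrestrict ν]
  congr 1
  have := hfin μ hμ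
  have := hfin ν hν
  refine ext_of_forall_integral_eq_of_IsFiniteMeasure fun f => ?_
  have hmeas : Measurable fun y => ENNReal.ofReal (χ y) :=
    ENNReal.measurable_ofReal.comp hχ.continuous.measurable
  rw [integral_withDensity_eq_integral_toReal_smul hmeas (by simp),
    integral_withDensity_eq_integral_toReal_smul hmeas (by simp)]
  simp only [ENNReal.toReal_ofReal (hχ1 _).1, smul_eq_mul]
  exact h _ (hχ.continuous.mul f.continuous) hχc.mul_right
    (tsupport_mul_subset_left.trans hχU)

end Uniqueness

/-! ### Vague sequential compactness. -/

section Compactness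

variable {E : Type*} [NormedAddCommGroup E] [NormedSpace ℝ E] [FiniteDimensional ℝ E]

/-- The one-point compactification is a sphere. Second countability makes its space of continuous
functions separable, as the sequential form of Banach-Alaoglu requires. -/
instance instSecondCountableTopologyOnePoint : SecondCountableTopology (OnePoint E) := by
  have e := onePointEquivSphereOfFinrankEq (ι := Fin (Module.finrank ℝ E + 1)) (V := E) (by simp)
  exact e.isEmbedding.secondCountableTopology

/-- A compactly supported continuous function extends by zero to the point at infinity. -/
theorem exists_continuousMap_onePoint {E : Type*} [TopologicalSpace E] [T2Space E] (φ : CompactlySupportedContinuousMap E ℝ) :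
    ∃ f : C(OnePoint E, ℝ), ∀ x : E, f x = φ x := by
  refine ⟨OnePoint.continuousMapMk φ.toContinuousMap 0 ?_, fun x => rfl⟩
  have h0 : ∀ᶠ x in coclosedCompact E, φ x = 0 := by
    rw [Filter.coclosedCompact_eq_cocompact]
    filter_upwards [φ.hasCompactSupport'.isCompact.compl_mem_cocompact] with x hx
    exact image_eq_zero_of_notMem_tsupport hx
  exact tendsto_const_nhds.congr' (h0.mono fun x hx => hx.symm)

variable [MeasurableSpace E] [BorelSpace E]

/-- Vague sequential compactness of sets of measures of bounded mass. -/
theorem exists_subseq_tendsto_integral (B : ℕ → Measure E) (C : NNReal) (hB : ∀ n, B n univ ≤ C) :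
    ∃ n : ℕ → ℕ, StrictMono n ∧ ∃ β : Measure E, (∀ K, IsCompact K → β K < ⊤) ∧
      ∀ φ : E → ℝ, Continuous φ → HasCompactSupport φ →
        Tendsto (fun k => ∫ z, φ z ∂(B (n k))) atTop (𝓝 (∫ z, φ z ∂β)) := by
  have hfin : ∀ n, IsFiniteMeasure (B n) := fun n => ⟨(hB n).trans_lt ENNReal.coe_lt_top⟩
  have hint : ∀ n (f : C(OnePoint E, ℝ)), Integrable (fun z : E => f z) (B n) := fun n f =>
    Integrable.of_bound (f.continuous.comp OnePoint.continuous_coe).aestronglyMeasurable ‖f‖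
      (Eventually.of_forall fun z => f.norm_coe_le_norm _)
  let ℓ₀ : ℕ → C(OnePoint E, ℝ) →ₗ[ℝ] ℝ := fun n =>
    { toFun := fun f => ∫ z : E, f z ∂(B n)
      map_add' := fun f g => integral_add (hint n f) (hint n g)
      map_smul' := fun c f => integral_const_mul c _ }
  have hℓ₀ : ∀ n f, ‖ℓ₀ n f‖ ≤ C * ‖f‖ := by
    intro n f
    have h1 : ‖∫ z : E, f z ∂(B n)‖ ≤ ‖f‖ * (B n).real univ :=
      norm_integral_le_of_norm_le_const (Eventually.of_forall fun z => f.norm_coe_le_norm _)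
    refine h1.trans ?_
    rw [mul_comm]
    gcongr
    exact ENNReal.toReal_le_coe_of_le_coe (hB n)
  let ℓ : ℕ → WeakDual ℝ C(OnePoint E, ℝ) := fun n =>
    StrongDual.toWeakDual ((ℓ₀ n).mkContinuous C (hℓ₀ n))
  -- Mass that escapes to infinity is recorded by the limit a at the added point, which compactly
  -- supported test functions do not see.
  obtain ⟨a, -, n, hn, ha⟩ := (WeakDual.isSeqCompact_closedBall ℝ C(OnePoint E, ℝ) 0 C)
    (x := ℓ) (fun n => by
      rw [mem_preimage, mem_closedBall_zero_iff]
      exact LinearMap.mkContinuous_norm_le (ℓ₀ n) C.2 (hℓ₀ n))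
  have hlim : ∀ f : C(OnePoint E, ℝ),
      Tendsto (fun k => ∫ z : E, f z ∂(B (n k))) atTop (𝓝 (a f)) := fun f =>
    ((WeakDual.eval_continuous f).tendsto a).comp ha
  choose ext hext using exists_continuousMap_onePoint (E := E)
  have hlim' : ∀ φ : CompactlySupportedContinuousMap E ℝ,
      Tendsto (fun k => ∫ z : E, φ z ∂(B (n k))) atTop (𝓝 (a (ext φ))) := fun φ => by
    simpa only [hext] using hlim (ext φ)
  have hintφ : ∀ k (φ : CompactlySupportedContinuousMap E ℝ), Integrable φ (B k) := fun k φ => by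
    simpa only [hext] using hint k (ext φ)
  -- The extensions `ext φ` are merely chosen, so linearity in φ is obtained from uniqueness of
  -- limits; there only values on E enter.
  let Λ₀ : CompactlySupportedContinuousMap E ℝ →ₗ[ℝ] ℝ :=
    { toFun := fun φ => a (ext φ)
      map_add' := fun φ φ' => by
        refine tendsto_nhds_unique (hlim' (φ + φ')) (((hlim' φ).add (hlim' φ')).congr fun k => ?_)
        exact (integral_add (hintφ _ φ) (hintφ _ φ')).symm
      map_smul' := fun c φ => by
        refine tendsto_nhds_unique (hlim' (c • φ)) (((hlim' φ).const_mul c).congr fun k => ?_)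
        exact (integral_const_mul c _).symm }
  let Λ : CompactlySupportedContinuousMap E ℝ →ₚ[ℝ] ℝ := PositiveLinearMap.mk₀ Λ₀ fun φ hφ =>
    ge_of_tendsto' (hlim' φ) fun k => integral_nonneg fun z => hφ z
  refine ⟨n, hn, RealRMK.rieszMeasure Λ, fun K hK => hK.measure_lt_top, fun φ hφ hφc => ?_⟩
  have := RealRMK.integral_rieszMeasure Λ ⟨⟨φ, hφ⟩, hφc⟩
  have h2 := hlim' ⟨⟨φ, hφ⟩, hφc⟩
  change ∫ z, φ z ∂(RealRMK.rieszMeasure Λ) = a (ext _) at this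
  rw [this]
  exact h2

end Compactness

/-! ### Integration over the time slab. -/

section Slab

variable {d : ℕ}

theorem volume_restrict_slab (T : ℝ) :
    (volume : Measure (ℝ × RSpace d)).restrict (Icc 0 T ×ˢ univ) =
      (volume.restrict (Icc 0 T)).prod volume := by
  rw [Measure.volume_eq_prod, ← Measure.prod_restrict, Measure.restrict_univ]

/-- Tonelli, with the bound C² at each time. For negative T the time interval is empty and
`ENNReal.ofReal T` is zero. -/
theorem eLpNorm_slab_le {T : ℝ} {f : ℝ → RSpace d → ℂ} {C : NNReal}
    (hf : AEStronglyMeasurable (fun y : ℝ × RSpace d => f y.1 y.2)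
      (volume.restrict (Icc 0 T ×ˢ univ)))
    (hC : ∀ t ∈ Icc 0 T, eLpNorm (f t) 2 volume ≤ C) :
    ∫⁻ y, ‖f y.1 y.2‖ₑ ^ 2 ∂(volume.restrict (Icc 0 T ×ˢ univ)) ≤ C ^ 2 * ENNReal.ofReal T := by
  rw [volume_restrict_slab] at hf ⊢
  rw [lintegral_prod _ (hf.enorm.pow_const 2)]
  calc ∫⁻ t in Icc 0 T, ∫⁻ x, ‖f t x‖ₑ ^ 2 ≤ ∫⁻ _ in Icc 0 T, (C : ENNReal) ^ 2 := by
        refine setLIntegral_mono' measurableSet_Icc fun t ht => ?_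
        have h1 := eLpNorm_nnreal_pow_eq_lintegral (f := f t) (μ := volume) (p := 2) (by norm_num)
        simp only [NNReal.coe_ofNat, ENNReal.coe_ofNat, ENNReal.rpow_ofNat] at h1
        rw [← h1]
        gcongr
        exact hC t ht
    _ = C ^ 2 * ENNReal.ofReal T := by simp

theorem memLp_slab {T : ℝ} {f : ℝ → RSpace d → ℂ} {C : NNReal}
    (hf : AEStronglyMeasurable (fun y : ℝ × RSpace d => f y.1 y.2)
      (volume.restrict (Icc 0 T ×ˢ univ)))
    (hC : ∀ t ∈ Icc 0 T, eLpNorm (f t) 2 volume ≤ C) :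
    MemLp (fun y : ℝ × RSpace d => f y.1 y.2) 2 (volume.restrict (Icc 0 T ×ˢ univ)) := by
  refine ⟨hf, ?_⟩
  rw [eLpNorm_lt_top_iff_lintegral_rpow_enorm_lt_top (by simp) (by simp)]
  simpa using (eLpNorm_slab_le hf hC).trans_lt
    (ENNReal.mul_lt_top (ENNReal.pow_lt_top ENNReal.coe_lt_top) ENNReal.ofReal_lt_top)

theorem MeasureTheory.MemLp.integrable_norm_sq' {α : Type*} [MeasurableSpace α] {μ : Measure α}
    {f : α → ℂ} (hf : MemLp f 2 μ) : Integrable (fun y => ‖f y‖ ^ 2) μ :=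
  (memLp_two_iff_integrable_sq_norm hf.1).1 hf

end Slab

/-! ### Bohmian measures on phase space-time. -/

section Bohm

variable {d : ℕ}

/-- The velocity as a function of the values of the wave function and of its gradient. -/
def velocityOf (ε : ℝ) (a : ℂ) (g : EuclideanSpace ℂ (Fin d)) : RSpace d :=
  (‖a‖ ^ 2)⁻¹ • WithLp.toLp 2 fun k => ε * (starRingEnd ℂ a * g k).im

theorem measurable_velocityOf (ε : ℝ) :
    Measurable fun p : ℂ × EuclideanSpace ℂ (Fin d) => velocityOf ε p.1 p.2 := by
  have h1 : Continuous fun p : ℂ × EuclideanSpace ℂ (Fin d) =>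
      (WithLp.toLp 2 fun k => ε * (starRingEnd ℂ p.1 * p.2 k).im : RSpace d) := by
    refine (PiLp.continuous_toLp 2 _).comp (continuous_pi fun k => ?_)
    exact continuous_const.mul (Complex.continuous_im.comp ((Complex.continuous_conj.comp
      continuous_fst).mul ((EuclideanSpace.proj (𝕜 := ℂ) k).continuous.comp continuous_snd)))
  have h2 : Measurable fun p : ℂ × EuclideanSpace ℂ (Fin d) => (‖p.1‖ ^ 2)⁻¹ :=
    (measurable_fst.norm.pow_const 2).inv
  unfold velocityOf
  exact h2.smul h1.measurable

theorem aemeasurable_velocityOf {α : Type*} [MeasurableSpace α] {μ : Measure α}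
    {a : α → ℂ} {g : α → EuclideanSpace ℂ (Fin d)} (ha : AEStronglyMeasurable a μ)
    (hg : AEStronglyMeasurable g μ) (ε : ℝ) :
    AEMeasurable (fun y => velocityOf ε (a y) (g y)) μ := by
  have h1 : AEMeasurable a μ := ha.aemeasurable
  have h2 : AEMeasurable g μ := hg.aemeasurable
  have h3 : AEMeasurable (fun y => (a y, g y)) μ := h1.prodMk h2
  have h4 := (measurable_velocityOf (d := d) ε).comp_aemeasurable h3
  exact h4

/-- Integrals against the image of `‖a‖² μ`. -/
theorem integral_map_withDensity_norm_sq {α Z : Type*} [MeasurableSpace α] {μ : Measure α}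
    [TopologicalSpace Z] [MeasurableSpace Z] [OpensMeasurableSpace Z]
    {a : α → ℂ} (ha : AEStronglyMeasurable a μ)
    {q : α → Z} (hq : AEMeasurable q μ) {φ : Z → ℝ} (hφ : Continuous φ) :
    ∫ z, φ z ∂((μ.withDensity fun y => ENNReal.ofReal (‖a y‖ ^ 2)).map q) =
      ∫ y, ‖a y‖ ^ 2 * φ (q y) ∂μ := by
  rw [integral_map (hq.mono_ac (withDensity_absolutelyContinuous _ _))
    hφ.stronglyMeasurable.aestronglyMeasurable,
    integral_withDensity_eq_integral_toReal_smul₀ _ (by simp)]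
  · simp
  · exact (ha.norm.aemeasurable.pow_const 2).ennreal_ofReal

theorem integral_bohmianMeasure {ε : ℝ} {f : RSpace d → ℂ} {g : RSpace d → EuclideanSpace ℂ (Fin d)}
    (hf : AEStronglyMeasurable f volume) (hg : AEStronglyMeasurable g volume)
    {φ : RSpace d × RSpace d → ℝ} (hφ : Continuous φ) :
    ∫ z, φ z ∂(bohmianMeasure ε f g) = ∫ x, ‖f x‖ ^ 2 * φ (x, bohmVelocity ε f g x) :=
  integral_map_withDensity_norm_sq hf (aemeasurable_id.prodMk (aemeasurable_velocityOf hf hg ε)) hφ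

/-- The Bohmian measure on phase space-time. -/
def bohmianMeasureSlab (T ε : ℝ) (f : ℝ → RSpace d → ℂ)
    (g : ℝ → RSpace d → EuclideanSpace ℂ (Fin d)) : Measure (ℝ × RSpace d × RSpace d) :=
  ((volume.restrict (Icc 0 T ×ˢ univ)).withDensity fun y : ℝ × RSpace d =>
    ENNReal.ofReal (‖f y.1 y.2‖ ^ 2)).map
      fun y => (y.1, y.2, bohmVelocity ε (f y.1) (g y.1) y.2)

variable {T ε : ℝ} {f : ℝ → RSpace d → ℂ} {g : ℝ → RSpace d → EuclideanSpace ℂ (Fin d)} {C : NNReal}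

/-- The mass of an image measure does not depend on the map, so only the density enters and nothing
is asked of the gradient. -/
theorem bohmianMeasureSlab_univ_le
    (hf : AEStronglyMeasurable (fun y : ℝ × RSpace d => f y.1 y.2)
      (volume.restrict (Icc 0 T ×ˢ univ)))
    (hC : ∀ t ∈ Icc 0 T, eLpNorm (f t) 2 volume ≤ C) :
    bohmianMeasureSlab T ε f g univ ≤ (C ^ 2 * T.toNNReal : NNReal) := by
  by_cases hq : AEMeasurable (fun y : ℝ × RSpace d => (y.1, y.2, bohmVelocity ε (f y.1) (g y.1) y.2))
      ((volume.restrict (Icc 0 T ×ˢ univ)).withDensity fun y : ℝ × RSpace d =>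
        ENNReal.ofReal (‖f y.1 y.2‖ ^ 2))
  · rw [bohmianMeasureSlab, Measure.map_apply_of_aemeasurable hq MeasurableSet.univ, preimage_univ,
      withDensity_apply _ MeasurableSet.univ, Measure.restrict_univ]
    refine le_trans (le_of_eq (lintegral_congr fun y => ?_)) ((eLpNorm_slab_le hf hC).trans ?_)
    · rw [ENNReal.ofReal_pow (norm_nonneg _), ofReal_norm]
    · push_cast; rfl
  -- Without measurability `Measure.map` is zero by convention.
  · rw [bohmianMeasureSlab, Measure.map_of_not_aemeasurable hq]
    simp

theorem aemeasurable_bohmVelocity_slab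
    (hf : AEStronglyMeasurable (fun y : ℝ × RSpace d => f y.1 y.2)
      (volume.restrict (Icc 0 T ×ˢ univ)))
    (hg : AEStronglyMeasurable (fun y : ℝ × RSpace d => g y.1 y.2)
      (volume.restrict (Icc 0 T ×ˢ univ))) :
    AEMeasurable (fun y : ℝ × RSpace d => (y.1, y.2, bohmVelocity ε (f y.1) (g y.1) y.2))
      (volume.restrict (Icc 0 T ×ˢ univ)) :=
  measurable_fst.aemeasurable.prodMk (measurable_snd.aemeasurable.prodMk
    (aemeasurable_velocityOf hf hg ε))

theorem integral_bohmianMeasureSlab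
    (hf : AEStronglyMeasurable (fun y : ℝ × RSpace d => f y.1 y.2)
      (volume.restrict (Icc 0 T ×ˢ univ)))
    (hg : AEStronglyMeasurable (fun y : ℝ × RSpace d => g y.1 y.2)
      (volume.restrict (Icc 0 T ×ˢ univ)))
    {φ : ℝ × RSpace d × RSpace d → ℝ} (hφ : Continuous φ) :
    ∫ z, φ z ∂(bohmianMeasureSlab T ε f g) = ∫ y in Icc 0 T ×ˢ univ,
      ‖f y.1 y.2‖ ^ 2 * φ (y.1, y.2, bohmVelocity ε (f y.1) (g y.1) y.2) :=
  integral_map_withDensity_norm_sq hf (aemeasurable_bohmVelocity_slab hf hg) hφ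

/-- The time integral of the integrals against the Bohmian measures. -/
theorem integral_integral_bohmianMeasure
    (hf : AEStronglyMeasurable (fun y : ℝ × RSpace d => f y.1 y.2)
      (volume.restrict (Icc 0 T ×ˢ univ)))
    (hg : AEStronglyMeasurable (fun y : ℝ × RSpace d => g y.1 y.2)
      (volume.restrict (Icc 0 T ×ˢ univ)))
    (hC : ∀ t ∈ Icc 0 T, eLpNorm (f t) 2 volume ≤ C)
    (hfg : ∀ t ∈ Icc 0 T, IsH1WithGrad (f t) (g t))
    {φ : ℝ × RSpace d × RSpace d → ℝ} (hφ : Continuous φ) (hφc : HasCompactSupport φ) :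
    ∫ t in Icc 0 T, ∫ z, φ (t, z) ∂(bohmianMeasure ε (f t) (g t)) =
      ∫ z, φ z ∂(bohmianMeasureSlab T ε f g) := by
  rw [integral_bohmianMeasureSlab hf hg hφ]
  have hint : Integrable (fun y : ℝ × RSpace d =>
      ‖f y.1 y.2‖ ^ 2 * φ (y.1, y.2, bohmVelocity ε (f y.1) (g y.1) y.2))
      (volume.restrict (Icc 0 T ×ˢ univ)) := by
    obtain ⟨M, hM⟩ := hφ.bounded_above_of_compact_support hφc
    exact (memLp_slab hf hC).integrable_norm_sq'.mul_bdd
      (hφ.measurable.comp_aemeasurable (aemeasurable_bohmVelocity_slab hf hg)).aestronglyMeasurable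
      (Eventually.of_forall fun y => hM _)
  rw [volume_restrict_slab] at hint ⊢
  rw [integral_prod _ hint]
  refine setIntegral_congr_fun measurableSet_Icc fun t ht => ?_
  exact integral_bohmianMeasure (hfg t ht).1.1 (hfg t ht).2.1.1
    (hφ.comp (continuous_const.prodMk continuous_id))

end Bohm

/-! ### Existence of limiting Bohmian measures. -/

section Existence

variable {d : ℕ} {T : ℝ} {ψ : ℝ → ℝ → RSpace d → ℂ}
  {G : ℝ → ℝ → RSpace d → EuclideanSpace ℂ (Fin d)} {C : NNReal}

/-- The uniform mass bound gives a vague limit on the whole phase space-time; convergence over Ω is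
a special case. -/
theorem exists_isLimitingBohmianMeasure (Ω : Set (ℝ × RSpace d))
    (hψm : ∀ ε ∈ Ioc (0 : ℝ) 1, AEStronglyMeasurable (fun y : ℝ × RSpace d => ψ ε y.1 y.2)
      (volume.restrict (Icc 0 T ×ˢ univ)))
    (hGm : ∀ ε ∈ Ioc (0 : ℝ) 1, AEStronglyMeasurable (fun y : ℝ × RSpace d => G ε y.1 y.2)
      (volume.restrict (Icc 0 T ×ˢ univ)))
    (hH1 : ∀ ε ∈ Ioc (0 : ℝ) 1, ∀ t ∈ Icc 0 T, IsH1WithGrad (ψ ε t) (G ε t))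
    (hC : ∀ ε ∈ Ioc (0 : ℝ) 1, ∀ t ∈ Icc 0 T, eLpNorm (ψ ε t) 2 volume ≤ C)
    {e : ℕ → ℝ} (he : Tendsto e atTop (𝓝[>] 0)) :
    ∃ n : ℕ → ℕ, StrictMono n ∧ ∃ β : Measure (ℝ × RSpace d × RSpace d),
      IsLimitingBohmianMeasure T Ω ψ G (map (e ∘ n) atTop) β := by
  have hev : ∀ᶠ k in atTop, e k ∈ Ioc (0 : ℝ) 1 := he (Ioc_mem_nhdsGT one_pos)
  -- The assumptions hold only for ε in (0,1], so the first k₀ terms are discarded and the extracted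
  -- indices shifted back by k₀.
  obtain ⟨k₀, hk₀⟩ := eventually_atTop.1 hev
  have hmem : ∀ k, e (k + k₀) ∈ Ioc (0 : ℝ) 1 := fun k => hk₀ _ (by omega)
  obtain ⟨n, hn, β, hβ, hlim⟩ := exists_subseq_tendsto_integral
    (fun k => bohmianMeasureSlab T (e (k + k₀)) (ψ (e (k + k₀))) (G (e (k + k₀))))
    (C ^ 2 * T.toNNReal)
    fun k => bohmianMeasureSlab_univ_le (hψm _ (hmem k)) (hC _ (hmem k))
  refine ⟨fun k => n k + k₀, fun a b h => by simpa using hn h, β, fun K hK _ => hβ K hK,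
    fun φ hφ hφc _ => tendsto_map'_iff.2 ((hlim φ hφ hφc).congr fun k => ?_)⟩
  exact (integral_integral_bohmianMeasure (hψm _ (hmem _)) (hGm _ (hmem _)) (hC _ (hmem _))
    (hH1 _ (hmem _)) hφ hφc).symm

end Existence

/-! ### Pointwise inequalities for the Bohmian velocity. -/

section Pointwise

variable {d : ℕ}

theorem EuclideanSpace.norm_le_sum {d : ℕ} (v : RSpace d) : ‖v‖ ≤ ∑ k, ‖v k‖ := by
  have h : v = ∑ k, EuclideanSpace.single k (v k) := by
    ext i
    simp [Finset.sum_apply]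
  conv_lhs => rw [h]
  refine (norm_sum_le _ _).trans (le_of_eq (Finset.sum_congr rfl fun k _ => ?_))
  simp

/-- Each component of |a|²(u - q) is the imaginary part of the conjugate of a times ε g_k - i q_k a,
since the second term contributes q_k |a|². The velocity error is thus controlled with weight ρ,
without a lower bound on ρ. -/
theorem norm_sq_mul_norm_velocityOf_sub_le (ε : ℝ) (a : ℂ) (g : EuclideanSpace ℂ (Fin d))
    (q : RSpace d) : ‖a‖ ^ 2 * ‖velocityOf ε a g - q‖ ≤
      ‖a‖ * ∑ k, ‖ε * g k - Complex.I * (q k : ℂ) * a‖ := by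
  rcases eq_or_ne a 0 with rfl | ha
  · simp
  have hn : ‖a‖ ^ 2 ≠ 0 := by positivity
  have hcomp : ∀ k, ‖a‖ ^ 2 * ‖(velocityOf ε a g - q) k‖ ≤
      ‖a‖ * ‖ε * g k - Complex.I * (q k : ℂ) * a‖ := by
    intro k
    have h1 : ‖a‖ ^ 2 * (velocityOf ε a g - q) k =
        (starRingEnd ℂ a * (ε * g k - Complex.I * (q k : ℂ) * a)).im := by
      have h2 : (starRingEnd ℂ a * (Complex.I * (q k : ℂ) * a)).im = ‖a‖ ^ 2 * q k := by
        have : starRingEnd ℂ a * (Complex.I * (q k : ℂ) * a) =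
            ((‖a‖ ^ 2 * q k : ℝ) : ℂ) * Complex.I := by
          have := Complex.conj_mul' a
          push_cast
          rw [← this]; ring
        rw [this, Complex.im_ofReal_mul, Complex.I_im, mul_one]
      have h3 : (starRingEnd ℂ a * (ε * g k)).im = ε * (starRingEnd ℂ a * g k).im := by
        rw [mul_left_comm, Complex.im_ofReal_mul]
      rw [mul_sub, Complex.sub_im, h2, h3]
      simp only [velocityOf, PiLp.sub_apply, PiLp.smul_apply, smul_eq_mul]
      field_simp
    have h4 : ‖a‖ ^ 2 * ‖(velocityOf ε a g - q) k‖ = ‖‖a‖ ^ 2 * (velocityOf ε a g - q) k‖ := by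
      rw [norm_mul, Real.norm_of_nonneg (by positivity : (0 : ℝ) ≤ ‖a‖ ^ 2)]
    rw [h4, h1]
    refine (Complex.abs_im_le_norm _).trans (le_of_eq ?_)
    rw [norm_mul, RCLike.norm_conj]
  calc ‖a‖ ^ 2 * ‖velocityOf ε a g - q‖ ≤ ‖a‖ ^ 2 * ∑ k, ‖(velocityOf ε a g - q) k‖ := by
        gcongr; exact EuclideanSpace.norm_le_sum _
    _ ≤ _ := by
        rw [Finset.mul_sum, Finset.mul_sum]
        exact Finset.sum_le_sum fun k _ => hcomp k

/-- Subtracting a real multiple of the wave function does not change the current. -/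
theorem norm_sq_mul_inner_velocityOf_sq_le (ε : ℝ) (a : ℂ) (g : EuclideanSpace ℂ (Fin d))
    (e : RSpace d) (h : ℝ) :
    ‖a‖ ^ 2 * (inner ℝ (velocityOf ε a g) e) ^ 2 ≤ ‖ε * dirComp e g - h * a‖ ^ 2 := by
  rcases eq_or_ne a 0 with rfl | ha
  · simp; positivity
  have hn : 0 < ‖a‖ := norm_pos_iff.2 ha
  have h1 : ‖a‖ ^ 2 * inner ℝ (velocityOf ε a g) e =
      (starRingEnd ℂ a * (ε * dirComp e g - h * a)).im := by
    have h2 : (starRingEnd ℂ a * (h * a)).im = 0 := by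
      have : starRingEnd ℂ a * (h * a) = ((‖a‖ ^ 2 * h : ℝ) : ℂ) := by
        have := Complex.conj_mul' a
        push_cast
        rw [← this]; ring
      rw [this]
      exact Complex.ofReal_im _
    have h3 : (starRingEnd ℂ a * (ε * dirComp e g)).im =
        ∑ k, e k * (ε * (starRingEnd ℂ a * g k).im) := by
      rw [mul_left_comm, Complex.im_ofReal_mul, dirComp, Finset.mul_sum, Complex.im_sum,
        Finset.mul_sum]
      refine Finset.sum_congr rfl fun k _ => ?_
      rw [mul_left_comm, Complex.im_ofReal_mul]
      ring
    rw [mul_sub, Complex.sub_im, h2, h3, sub_zero, velocityOf, real_inner_smul_left]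
    rw [mul_inv_cancel_left₀ (by positivity)]
    simp [PiLp.inner_apply]
  have h5 : |‖a‖ ^ 2 * inner ℝ (velocityOf ε a g) e| ≤ ‖a‖ * ‖ε * dirComp e g - h * a‖ := by
    rw [h1]
    refine (Complex.abs_im_le_norm _).trans (le_of_eq ?_)
    rw [norm_mul, RCLike.norm_conj]
  -- One factor |a| is cancelled here: squaring then leaves the weight |a|² and a bound without any
  -- ρ.
  have h6 : ‖a‖ * |inner ℝ (velocityOf ε a g) e| ≤ ‖ε * dirComp e g - h * a‖ := by
    rw [abs_mul, abs_of_pos (by positivity : 0 < ‖a‖ ^ 2), pow_two, mul_assoc] at h5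
    exact le_of_mul_le_mul_left h5 hn
  calc ‖a‖ ^ 2 * (inner ℝ (velocityOf ε a g) e) ^ 2
      = (‖a‖ * |inner ℝ (velocityOf ε a g) e|) ^ 2 := by rw [mul_pow, sq_abs]
    _ ≤ _ := by gcongr

end Pointwise

/-! ### The multi-phase measure and its integrals. -/

section MultiPhase

variable {d N : ℕ} {Ω : Set (ℝ × RSpace d)} {b : Fin N → ℝ × RSpace d → ℂ}
  {S : Fin N → ℝ × RSpace d → ℝ}

/-- The projection of phase space-time to space-time. -/
def baseProj {d : ℕ} (z : ℝ × RSpace d × RSpace d) : ℝ × RSpace d := (z.1, z.2.1)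

theorem continuous_baseProj : Continuous (baseProj (d := d)) := by
  unfold baseProj; fun_prop

theorem isOpen_overSet (hΩ : IsOpen Ω) : IsOpen (overSet Ω) := hΩ.preimage continuous_baseProj

theorem image_baseProj_subset {K : Set (ℝ × RSpace d × RSpace d)} (h : K ⊆ overSet Ω) :
    baseProj '' K ⊆ Ω := by
  rintro _ ⟨z, hz, rfl⟩; exact h hz

theorem eq_zero_of_notMem_image_baseProj {Z : Type*} [Zero Z]
    {φ : ℝ × RSpace d × RSpace d → Z} {y : ℝ × RSpace d}
    (hy : y ∉ baseProj '' tsupport φ) (p : RSpace d) : φ (y.1, y.2, p) = 0 :=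
  image_eq_zero_of_notMem_tsupport fun h => hy ⟨_, h, rfl⟩

theorem continuousOn_graph (hΩ : IsOpen Ω) {S : ℝ × RSpace d → ℝ} (hS : ContDiffOn ℝ ∞ S Ω) :
    ContinuousOn (fun y : ℝ × RSpace d => (y.1, y.2, spaceGrad S y.1 y.2)) Ω :=
  continuousOn_fst.prodMk (continuousOn_snd.prodMk (continuousOn_spaceGrad hΩ hS))

/-- The points whose graph value lies in K form a subset of the projection of K, a compact subset of
Ω on which |b_j|² is integrable. -/
theorem multiPhaseMeasure_lt_top (hΩ : IsOpen Ω) (hb : ∀ j, ContDiffOn ℝ ∞ (b j) Ω)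
    (hS : ∀ j, ContDiffOn ℝ ∞ (S j) Ω) {K : Set (ℝ × RSpace d × RSpace d)} (hK : IsCompact K)
    (hKΩ : K ⊆ overSet Ω) (j : Fin N) :
    ((volume.restrict Ω).withDensity fun y => ENNReal.ofReal (‖b j y‖ ^ 2)).map
      (fun y => (y.1, y.2, spaceGrad (S j) y.1 y.2)) K < ⊤ := by
  have hq : AEMeasurable (fun y : ℝ × RSpace d => (y.1, y.2, spaceGrad (S j) y.1 y.2))
      ((volume.restrict Ω).withDensity fun y => ENNReal.ofReal (‖b j y‖ ^ 2)) :=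
    ((continuousOn_graph hΩ (hS j)).aemeasurable hΩ.measurableSet).mono_ac
      (withDensity_absolutelyContinuous _ _)
  have hKp : IsCompact (baseProj '' K) := hK.image continuous_baseProj
  rw [Measure.map_apply_of_aemeasurable hq hK.measurableSet]
  refine (measure_mono (fun y hy => ?_ : _ ⊆ baseProj '' K)).trans_lt ?_
  · exact ⟨_, hy, rfl⟩
  rw [withDensity_apply _ hKp.measurableSet, Measure.restrict_restrict hKp.measurableSet,
    inter_eq_left.2 (image_baseProj_subset hKΩ)]
  have hi : IntegrableOn (fun y => ‖b j y‖ ^ 2) (baseProj '' K) :=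
    (((hb j).continuousOn.norm.pow 2).mono (image_baseProj_subset hKΩ)).integrableOn_compact hKp
  have := hi.2
  rw [hasFiniteIntegral_iff_ofReal (Eventually.of_forall fun y => by positivity)] at this
  exact this

theorem locallyFiniteOver_multiPhaseMeasure (hΩ : IsOpen Ω) (hb : ∀ j, ContDiffOn ℝ ∞ (b j) Ω)
    (hS : ∀ j, ContDiffOn ℝ ∞ (S j) Ω) : LocallyFiniteOver Ω (multiPhaseMeasure Ω b S) := by
  intro K hK hKΩ
  rw [multiPhaseMeasure, Measure.finsetSum_apply]
  exact ENNReal.sum_lt_top.2 fun j _ => multiPhaseMeasure_lt_top hΩ hb hS hK hKΩ j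

/-- Finiteness is asked on the support alone because the measures in question are controlled only
over Ω. -/
theorem integrable_of_tsupport_measure_lt_top {X : Type*} [TopologicalSpace X] [MeasurableSpace X]
    [OpensMeasurableSpace X] {m : Measure X} {φ : X → ℝ} (hφ : Continuous φ)
    (hφc : HasCompactSupport φ) (hm : m (tsupport φ) < ⊤) : Integrable φ m := by
  obtain ⟨M, hM⟩ := hφ.bounded_above_of_compact_support hφc
  rw [← integrableOn_iff_integrable_of_support_subset (subset_tsupport φ)]
  exact Measure.integrableOn_of_bounded hm.ne hφ.stronglyMeasurable.aestronglyMeasurable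
    (Eventually.of_forall fun z => hM z)

/-- K is left free: it is the projected support of φ in some uses and the support of a space-time
cutoff in another. -/
theorem integral_multiPhaseMeasure (hΩ : IsOpen Ω) (hb : ∀ j, ContDiffOn ℝ ∞ (b j) Ω)
    (hS : ∀ j, ContDiffOn ℝ ∞ (S j) Ω) {φ : ℝ × RSpace d × RSpace d → ℝ} (hφ : Continuous φ)
    (hφc : HasCompactSupport φ) (hφΩ : tsupport φ ⊆ overSet Ω)
    {K : Set (ℝ × RSpace d)} (hKΩ : K ⊆ Ω)
    (hφK : baseProj '' tsupport φ ⊆ K) :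
    ∫ z, φ z ∂(multiPhaseMeasure Ω b S) =
      ∑ j, ∫ y in K, ‖b j y‖ ^ 2 * φ (y.1, y.2, spaceGrad (S j) y.1 y.2) := by
  rw [multiPhaseMeasure, integral_finsetSum_measure fun j _ =>
    integrable_of_tsupport_measure_lt_top hφ hφc (multiPhaseMeasure_lt_top hΩ hb hS hφc hφΩ j)]
  refine Finset.sum_congr rfl fun j _ => ?_
  rw [integral_map_withDensity_norm_sq
    ((hb j).continuousOn.aestronglyMeasurable hΩ.measurableSet)
    ((continuousOn_graph hΩ (hS j)).aemeasurable hΩ.measurableSet) hφ]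
  refine setIntegral_eq_of_subset_of_forall_sdiff_eq_zero hΩ.measurableSet hKΩ fun y hy => ?_
  rw [eq_zero_of_notMem_image_baseProj (fun h => hy.2 (hφK h)), mul_zero]

end MultiPhase

/-! ### Limits of products and squares. -/

section General

variable {ι α : Type*} {l : Filter ι} [MeasurableSpace α] {μ : Measure α}

theorem tendsto_integral_norm_mul_norm {f g : ι → α → ℂ} {C : NNReal}
    (hfm : ∀ᶠ i in l, AEStronglyMeasurable (f i) μ)
    (hgm : ∀ᶠ i in l, AEStronglyMeasurable (g i) μ)
    (hf : ∀ᶠ i in l, eLpNorm (f i) 2 μ ≤ C)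
    (hg : Tendsto (fun i => eLpNorm (g i) 2 μ) l (𝓝 0)) :
    Tendsto (fun i => ∫ y, ‖f i y‖ * ‖g i y‖ ∂μ) l (𝓝 0) := by
  have h0 : Tendsto (fun i => (C : ENNReal) * eLpNorm (g i) 2 μ) l (𝓝 (C * 0)) :=
    ENNReal.Tendsto.const_mul hg (Or.inr ENNReal.coe_ne_top)
  rw [mul_zero] at h0
  have h1 : Tendsto (fun i => (∫⁻ y, ‖f i y * g i y‖ₑ ∂μ).toReal) l (𝓝 0) := by
    have : Tendsto (fun i => ∫⁻ y, ‖f i y * g i y‖ₑ ∂μ) l (𝓝 0) := by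
      refine tendsto_of_tendsto_of_tendsto_of_le_of_le' tendsto_const_nhds h0
        (Eventually.of_forall fun i => zero_le) ?_
      filter_upwards [hfm, hgm, hf] with i h1 h2 h3
      exact (lintegral_enorm_mul_le h1 h2).trans (by gcongr)
    simpa [Function.comp_def] using (ENNReal.tendsto_toReal ENNReal.zero_ne_top).comp this
  refine h1.congr' ?_
  filter_upwards [hfm, hgm] with i h1 h2
  have h3 : AEStronglyMeasurable (fun y => f i y * g i y) μ := h1.mul h2
  rw [← integral_norm_eq_lintegral_enorm h3]
  simp

/-- Weighted integrals of squares are stable under perturbations which are small in `L²`. -/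
theorem tendsto_integral_mul_norm_sq_sub_zero {w : α → ℝ} {M : NNReal}
    (hwm : AEStronglyMeasurable w μ) (hw : ∀ᵐ y ∂μ, ‖w y‖ ≤ M) {X X' : ι → α → ℂ} {C : NNReal}
    (hXm : ∀ᶠ i in l, AEStronglyMeasurable (X i) μ) (hX'm : ∀ᶠ i in l, AEStronglyMeasurable (X' i) μ)
    (hX : Tendsto (fun i => eLpNorm (fun y => X i y - X' i y) 2 μ) l (𝓝 0))
    (hX' : ∀ᶠ i in l, eLpNorm (X' i) 2 μ ≤ C) :
    Tendsto (fun i => ∫ y, w y * ‖X i y‖ ^ 2 ∂μ - ∫ y, w y * ‖X' i y‖ ^ 2 ∂μ) l (𝓝 0) := by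
  have hconj : ∀ f : α → ℂ, AEStronglyMeasurable f μ →
      AEStronglyMeasurable (fun y => starRingEnd ℂ (f y)) μ := fun f hf =>
    Complex.continuous_conj.comp_aestronglyMeasurable hf
  have hnorm : ∀ f g : α → ℂ, eLpNorm (fun y => starRingEnd ℂ (f y) - starRingEnd ℂ (g y)) 2 μ =
      eLpNorm (fun y => f y - g y) 2 μ := fun f g =>
    eLpNorm_congr_norm_ae (Eventually.of_forall fun y => by rw [← map_sub, RCLike.norm_conj])
  have h := tendsto_integral_mul_sub_zero (l := l) (μ := μ) (w := fun y => (w y : ℂ)) (M := M)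
    (C := C) (Complex.continuous_ofReal.comp_aestronglyMeasurable hwm)
    (hw.mono fun y hy => by simpa using hy) hXm hX'm
    (Z := fun i y => starRingEnd ℂ (X i y)) (Z' := fun i y => starRingEnd ℂ (X' i y))
    (hXm.mono fun i hi => hconj _ hi) (hX'm.mono fun i hi => hconj _ hi) hX
    (by simpa only [hnorm] using hX) hX' (hX'.mono fun i hi => by
      refine le_trans (le_of_eq ?_) hi
      exact eLpNorm_congr_norm_ae (Eventually.of_forall fun y => RCLike.norm_conj _))
  have hre : ∀ f : α → ℂ, ∫ y, (w y : ℂ) * (f y * starRingEnd ℂ (f y)) ∂μ =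
      ((∫ y, w y * ‖f y‖ ^ 2 ∂μ : ℝ) : ℂ) := by
    intro f
    refine Eq.trans ?_ (integral_ofReal (𝕜 := ℂ))
    refine integral_congr_ae (Eventually.of_forall fun y => ?_)
    simp [Complex.mul_conj']
  simp only [hre] at h
  have := (Complex.continuous_re.tendsto _).comp h
  simpa [Function.comp_def] using this

end General

/-! ### One phase: convergence to the mono-kinetic measure. -/

section WKB

variable {d N : ℕ} {Ω : Set (ℝ × RSpace d)} {b : Fin N → ℝ × RSpace d → ℂ}
  {S : Fin N → ℝ × RSpace d → ℝ} {T : ℝ}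
  {ψ : ℝ → ℝ → RSpace d → ℂ} {G : ℝ → ℝ → RSpace d → EuclideanSpace ℂ (Fin d)} {C : NNReal}

theorem eventually_aestronglyMeasurable_restrict {F : Type*} [TopologicalSpace F]
    {f : ℝ → ℝ → RSpace d → F}
    (hf : ∀ ε ∈ Ioc (0 : ℝ) 1, AEStronglyMeasurable (fun y : ℝ × RSpace d => f ε y.1 y.2)
      (volume.restrict (Icc 0 T ×ˢ univ)))
    {K : Set (ℝ × RSpace d)} (hK : K ⊆ Icc 0 T ×ˢ univ) :
    ∀ᶠ ε in 𝓝[>] (0 : ℝ), AEStronglyMeasurable (fun y : ℝ × RSpace d => f ε y.1 y.2)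
      (volume.restrict K) := by
  filter_upwards [Ioc_mem_nhdsGT one_pos] with ε hε
  exact (hf ε hε).mono_set hK

theorem integral_bohmianMeasureSlab_eq_setIntegral {ε : ℝ} {f : ℝ → RSpace d → ℂ}
    {g : ℝ → RSpace d → EuclideanSpace ℂ (Fin d)}
    (hf : AEStronglyMeasurable (fun y : ℝ × RSpace d => f y.1 y.2)
      (volume.restrict (Icc 0 T ×ˢ univ)))
    (hg : AEStronglyMeasurable (fun y : ℝ × RSpace d => g y.1 y.2)
      (volume.restrict (Icc 0 T ×ˢ univ)))
    {φ : ℝ × RSpace d × RSpace d → ℝ} (hφ : Continuous φ) {K : Set (ℝ × RSpace d)}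
    (hK : K ⊆ Icc 0 T ×ˢ univ) (hφK : baseProj '' tsupport φ ⊆ K) :
    ∫ z, φ z ∂(bohmianMeasureSlab T ε f g) =
      ∫ y in K, ‖f y.1 y.2‖ ^ 2 * φ (y.1, y.2, velocityOf ε (f y.1 y.2) (g y.1 y.2)) := by
  rw [integral_bohmianMeasureSlab hf hg hφ]
  refine setIntegral_eq_of_subset_of_forall_sdiff_eq_zero
    (measurableSet_Icc.prod MeasurableSet.univ) hK fun y hy => ?_
  rw [eq_zero_of_notMem_image_baseProj (fun h => hy.2 (hφK h)), mul_zero]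

/-- A uniformly continuous bounded function is Lipschitz up to a small error. -/
theorem exists_abs_sub_le_add_mul_norm {φ : ℝ × RSpace d × RSpace d → ℝ} (hφ : Continuous φ)
    (hφc : HasCompactSupport φ) {η : ℝ} (hη : 0 < η) :
    ∃ c : ℝ, 0 ≤ c ∧ ∀ t x p q, |φ (t, x, p) - φ (t, x, q)| ≤ η + c * ‖p - q‖ := by
  obtain ⟨M, hM⟩ := hφ.bounded_above_of_compact_support hφc
  have hM0 : 0 ≤ M := (norm_nonneg _).trans (hM 0)
  obtain ⟨δ, hδ, h⟩ := Metric.uniformContinuous_iff.1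
    (hφc.uniformContinuous_of_continuous hφ) η hη
  refine ⟨2 * M / δ, by positivity, fun t x p q => ?_⟩
  by_cases hpq : ‖p - q‖ < δ
  · have h1 : dist (t, x, p) (t, x, q) < δ := by
      rw [Prod.dist_eq, Prod.dist_eq, dist_self, dist_self, dist_eq_norm]
      simpa using hpq
    have h2 := h h1
    rw [Real.dist_eq] at h2
    have : 0 ≤ 2 * M / δ * ‖p - q‖ := by positivity
    linarith
  · push Not at hpq
    have h1 : |φ (t, x, p) - φ (t, x, q)| ≤ 2 * M := by
      have h2 := hM (t, x, p)
      have h3 := hM (t, x, q)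
      rw [Real.norm_eq_abs] at h2 h3
      exact (abs_sub _ _).trans (by linarith)
    have h4 : 2 * M ≤ 2 * M / δ * ‖p - q‖ := by
      rw [div_mul_eq_mul_div, le_div_iff₀ hδ]
      gcongr
    linarith

theorem inner_coordVec (q : RSpace d) (k : Fin d) : inner ℝ q (coordVec k) = q k := by
  simp [coordVec, EuclideanSpace.inner_single_right]

theorem dirComp_coordVec (g : EuclideanSpace ℂ (Fin d)) (k : Fin d) :
    dirComp (coordVec k) g = g k := by
  rw [dirComp, Finset.sum_eq_single k]
  · simp [coordVec]
  · intro j _ hj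
    simp [coordVec, hj]
  · simp

/-- The Bohmian measures of a single wave packet converge to the mono-kinetic measure. -/
theorem tendsto_integral_bohmianMeasureSlab_single {b : Fin 1 → ℝ × RSpace d → ℂ}
    {S : Fin 1 → ℝ × RSpace d → ℝ} (hΩ : IsOpen Ω) (hΩT : Ω ⊆ Icc 0 T ×ˢ univ)
    (hb : ∀ j, ContDiffOn ℝ ∞ (b j) Ω) (hS : ∀ j, ContDiffOn ℝ ∞ (S j) Ω)
    (hψm : ∀ ε ∈ Ioc (0 : ℝ) 1, AEStronglyMeasurable (fun y : ℝ × RSpace d => ψ ε y.1 y.2)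
      (volume.restrict (Icc 0 T ×ˢ univ)))
    (hGm : ∀ ε ∈ Ioc (0 : ℝ) 1, AEStronglyMeasurable (fun y : ℝ × RSpace d => G ε y.1 y.2)
      (volume.restrict (Icc 0 T ×ˢ univ)))
    (hwkb : HasWKBForm Ω b S ψ G)
    {φ : ℝ × RSpace d × RSpace d → ℝ} (hφ : Continuous φ) (hφc : HasCompactSupport φ)
    (hφΩ : tsupport φ ⊆ overSet Ω) :
    Tendsto (fun ε => ∫ z, φ z ∂(bohmianMeasureSlab T ε (ψ ε) (G ε))) (𝓝[>] 0)
      (𝓝 (∫ z, φ z ∂(multiPhaseMeasure Ω b S))) := by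
  let K : Set (ℝ × RSpace d) := baseProj '' tsupport φ
  have hK : IsCompact K := hφc.isCompact.image continuous_baseProj
  have hKΩ : K ⊆ Ω := image_baseProj_subset hφΩ
  have hKT : K ⊆ Icc 0 T ×ˢ univ := hKΩ.trans hΩT
  let q : ℝ × RSpace d → RSpace d := fun y => spaceGrad (S 0) y.1 y.2
  have hq : ContinuousOn q K := (continuousOn_spaceGrad hΩ (hS 0)).mono hKΩ
  let w : ℝ × RSpace d → ℝ := fun y => φ (y.1, y.2, q y)
  have hw : ContinuousOn w K := hφ.comp_continuousOn
    (continuousOn_fst.prodMk (continuousOn_snd.prodMk hq))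
  have hbK : ∀ j, ContinuousOn (b j) K := fun j => (hb j).continuousOn.mono hKΩ
  have hSK : ∀ j, ContinuousOn (S j) K := fun j => (hS j).continuousOn.mono hKΩ
  have hψK := eventually_aestronglyMeasurable_restrict hψm hKT
  have hGK := eventually_aestronglyMeasurable_restrict hGm hKT
  have hAm : ∀ ε, AEStronglyMeasurable (ampSum b S ε) (volume.restrict K) := fun ε =>
    (ContinuousOn.ampSum hbK hSK ε).aestronglyMeasurable hK.measurableSet
  obtain ⟨C₁, hC₁⟩ := exists_eLpNorm_ampSum_le (μ := volume) S hK hbK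
  have hconv : Tendsto (fun ε : ℝ => eLpNorm (fun y : ℝ × RSpace d =>
      ψ ε y.1 y.2 - ampSum b S ε y) 2 (volume.restrict K)) (𝓝[>] 0) (𝓝 0) := (hwkb K hK hKΩ).1
  -- the limit of the position densities
  have hdens : ∀ v : ℝ × RSpace d → ℝ, ContinuousOn v K →
      Tendsto (fun ε : ℝ => ∫ y in K, v y * ‖ψ ε y.1 y.2‖ ^ 2) (𝓝[>] 0)
        (𝓝 (∫ y in K, v y * ‖b 0 y‖ ^ 2)) := by
    intro v hv
    obtain ⟨M, hM⟩ := hK.exists_bound_of_continuousOn hv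
    have h1 := tendsto_integral_mul_norm_sq_sub_zero (l := 𝓝[>] (0 : ℝ)) (M := M.toNNReal)
      (hv.aestronglyMeasurable hK.measurableSet)
      ((ae_restrict_iff' hK.measurableSet).2 (Eventually.of_forall fun y hy =>
        (hM y hy).trans (Real.le_coe_toNNReal M))) hψK (Eventually.of_forall hAm) hconv
      (Eventually.of_forall hC₁)
    -- With a single phase the modulus does not oscillate, so the density converges without any
    -- appeal to nonstationary phase.
    have h2 : ∀ ε y, ‖ampSum b S ε y‖ = ‖b 0 y‖ := fun ε y => by
      simp [ampSum, norm_oscExp]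
    simp only [h2] at h1
    have h3 := h1.add_const (∫ y in K, v y * ‖b 0 y‖ ^ 2)
    rw [zero_add] at h3
    exact h3.congr fun ε => sub_add_cancel _ _
  have hψbdd : ∀ᶠ ε in 𝓝[>] (0 : ℝ), eLpNorm (fun y : ℝ × RSpace d => ψ ε y.1 y.2) 2
      (volume.restrict K) ≤ (1 + C₁ : NNReal) := by
    filter_upwards [hconv.eventually_lt_const one_pos, hψK] with ε h1 h2
    have h3 : (fun y : ℝ × RSpace d => ψ ε y.1 y.2) =
        (fun y => ψ ε y.1 y.2 - ampSum b S ε y) + ampSum b S ε := by ext; simp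
    rw [h3]
    refine (eLpNorm_add_le (h2.sub (hAm ε)) (hAm ε) (by norm_num)).trans ?_
    push_cast
    exact add_le_add h1.le (hC₁ ε)
  -- the velocity error
  let Y : Fin d → ℝ → ℝ × RSpace d → ℂ := fun k ε y =>
    ε * G ε y.1 y.2 k - Complex.I * (q y k : ℂ) * ψ ε y.1 y.2
  have hYm : ∀ k, ∀ᶠ ε in 𝓝[>] (0 : ℝ), AEStronglyMeasurable (Y k ε) (volume.restrict K) := by
    intro k
    have hqk : ContinuousOn (fun y => Complex.I * (q y k : ℂ)) K :=
      continuousOn_const.mul (Complex.continuous_ofReal.comp_continuousOn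
        ((EuclideanSpace.proj (𝕜 := ℝ) k).continuous.comp_continuousOn hq))
    filter_upwards [hψK, hGK] with ε h1 h2
    exact (((EuclideanSpace.proj (𝕜 := ℂ) k).continuous.comp_aestronglyMeasurable h2).const_mul
      _).sub ((hqk.aestronglyMeasurable hK.measurableSet).mul h1)
  -- For one phase the leading part of ε∂_kψ is i q_k times the leading part of ψ. Hence Y k is the
  -- gradient error minus i q_k times the error of ψ.
  have hY : ∀ k, Tendsto (fun ε => eLpNorm (Y k ε) 2 (volume.restrict K)) (𝓝[>] 0) (𝓝 0) := by
    intro k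
    have hqk : ContinuousOn (fun y => Complex.I * (q y k : ℂ)) K :=
      continuousOn_const.mul (Complex.continuous_ofReal.comp_continuousOn
        ((EuclideanSpace.proj (𝕜 := ℝ) k).continuous.comp_continuousOn hq))
    obtain ⟨M, hM⟩ := hK.exists_bound_of_continuousOn hqk
    have h1 := hwkb.tendsto_dirComp hΩ hb hS hK hKΩ hGK (coordVec k)
    have h2 : Tendsto (fun ε : ℝ => eLpNorm (fun y : ℝ × RSpace d =>
        ε * dirComp (coordVec k) (G ε y.1 y.2) - ampSum (gradAmp b S (coordVec k)) S ε y) 2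
          (volume.restrict K) + (M.toNNReal : ENNReal) * eLpNorm (fun y : ℝ × RSpace d =>
      ψ ε y.1 y.2 - ampSum b S ε y) 2 (volume.restrict K)) (𝓝[>] 0) (𝓝 (0 + M.toNNReal * 0)) :=
      h1.add (ENNReal.Tendsto.const_mul hconv (Or.inr ENNReal.coe_ne_top))
    rw [mul_zero, add_zero] at h2
    refine tendsto_of_tendsto_of_tendsto_of_le_of_le' tendsto_const_nhds h2
      (Eventually.of_forall fun i => zero_le) ?_
    filter_upwards [hψK, hGK] with ε h3 h4
    have h5 : Y k ε = (fun y : ℝ × RSpace d =>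
        ε * dirComp (coordVec k) (G ε y.1 y.2) - ampSum (gradAmp b S (coordVec k)) S ε y) -
        fun y => Complex.I * (q y k : ℂ) * (ψ ε y.1 y.2 - ampSum b S ε y) := by
      ext y
      simp only [Y, Pi.sub_apply, dirComp_coordVec, ampSum, gradAmp, Finset.univ_unique,
        Finset.sum_singleton, Fin.default_eq_zero, inner_coordVec, q]
      ring
    have h6 : AEStronglyMeasurable (fun y : ℝ × RSpace d =>
        ε * dirComp (coordVec k) (G ε y.1 y.2) - ampSum (gradAmp b S (coordVec k)) S ε y)
        (volume.restrict K) :=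
      (((continuous_dirComp _).comp_aestronglyMeasurable h4).const_mul _).sub
        ((ContinuousOn.ampSum (fun j => (continuousOn_gradAmp hΩ hb hS _ j).mono hKΩ) hSK
          ε).aestronglyMeasurable hK.measurableSet)
    rw [h5]
    refine (eLpNorm_sub_le h6 ((hqk.aestronglyMeasurable hK.measurableSet).mul
      (h3.sub (hAm ε))) (by norm_num)).trans (add_le_add le_rfl ?_)
    refine (eLpNorm_le_nnreal_smul_eLpNorm_of_ae_le_mul (c := M.toNNReal) ?_ 2).trans
      (le_of_eq rfl)
    refine (ae_restrict_iff' hK.measurableSet).2 (Eventually.of_forall fun y hy => ?_)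
    rw [Pi.mul_apply, nnnorm_mul]
    refine mul_le_mul_left ?_ _
    exact NNReal.coe_le_coe.1 ((hM y hy).trans (Real.le_coe_toNNReal M))
  have hD : Tendsto (fun ε => ∑ k, ∫ y in K, ‖ψ ε y.1 y.2‖ * ‖Y k ε y‖) (𝓝[>] 0) (𝓝 0) := by
    have := tendsto_finsetSum (Finset.univ : Finset (Fin d)) fun k _ =>
      tendsto_integral_norm_mul_norm hψK (hYm k) hψbdd (hY k)
    simpa using this
  rw [integral_multiPhaseMeasure hΩ hb hS hφ hφc hφΩ hKΩ subset_rfl]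
  have hcomm : ∫ y in K, ‖b 0 y‖ ^ 2 * φ (y.1, y.2, spaceGrad (S 0) y.1 y.2) =
      ∫ y in K, w y * ‖b 0 y‖ ^ 2 :=
    integral_congr_ae (Eventually.of_forall fun y => mul_comm _ _)
  simp only [Finset.univ_unique, Finset.sum_singleton, Fin.default_eq_zero, hcomm]
  have hmain := hdens w hw
  have herr : Tendsto (fun ε => ∫ z, φ z ∂(bohmianMeasureSlab T ε (ψ ε) (G ε)) -
      ∫ y in K, w y * ‖ψ ε y.1 y.2‖ ^ 2) (𝓝[>] 0) (𝓝 0) := by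
    rw [Metric.tendsto_nhds]
    intro δ hδ
    let B : ℝ := ∫ y in K, 1 * ‖b 0 y‖ ^ 2
    have hB0 : 0 ≤ B := integral_nonneg fun y => by positivity
    have hB := hdens (fun _ => 1) continuousOn_const
    -- The mass of ρ on K is eventually below B + 1, so this η contributes at most δ/2; the
    -- Lipschitz part is absorbed by the vanishing velocity error.
    obtain ⟨c, hc, hφc'⟩ := exists_abs_sub_le_add_mul_norm hφ hφc
      (η := δ / (2 * (B + 1))) (by positivity)
    have hDc : Tendsto (fun ε => c * ∑ k, ∫ y in K, ‖ψ ε y.1 y.2‖ * ‖Y k ε y‖) (𝓝[>] 0)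
        (𝓝 0) := by simpa using hD.const_mul c
    filter_upwards [hB.eventually_lt_const (show B < B + 1 by linarith),
      hDc.eventually_lt_const (half_pos hδ), hψK, hGK, hψbdd,
      eventually_all.2 hYm, eventually_all.2 fun k => (hY k).eventually_lt_const one_pos,
      Ioc_mem_nhdsGT one_pos] with ε h1 h2 h3 h4 h5 h6 h7 h8
    have Lψ : MemLp (fun y : ℝ × RSpace d => ψ ε y.1 y.2) 2 (volume.restrict K) :=
      ⟨h3, h5.trans_lt ENNReal.coe_lt_top⟩
    have LY : ∀ k, MemLp (Y k ε) 2 (volume.restrict K) := fun k =>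
      ⟨h6 k, (h7 k).trans ENNReal.one_lt_top⟩
    have Iψ := Lψ.integrable_norm_sq'
    have IY : ∀ k, Integrable (fun y : ℝ × RSpace d => ‖ψ ε y.1 y.2‖ * ‖Y k ε y‖)
        (volume.restrict K) := fun k => by
      simpa using (Lψ.integrable_mul_two (LY k)).norm
    obtain ⟨M, hM⟩ := hφ.bounded_above_of_compact_support hφc
    have hum : AEMeasurable (fun y : ℝ × RSpace d =>
        (y.1, y.2, velocityOf ε (ψ ε y.1 y.2) (G ε y.1 y.2))) (volume.restrict K) :=
      measurable_fst.aemeasurable.prodMk (measurable_snd.aemeasurable.prodMk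
        (aemeasurable_velocityOf h3 h4 ε))
    have I1 : Integrable (fun y : ℝ × RSpace d => ‖ψ ε y.1 y.2‖ ^ 2 *
        φ (y.1, y.2, velocityOf ε (ψ ε y.1 y.2) (G ε y.1 y.2))) (volume.restrict K) :=
      Iψ.mul_bdd (hφ.measurable.comp_aemeasurable hum).aestronglyMeasurable
        (Eventually.of_forall fun y => hM _)
    have I2 : Integrable (fun y : ℝ × RSpace d => w y * ‖ψ ε y.1 y.2‖ ^ 2)
        (volume.restrict K) :=
      Iψ.bdd_mul (hw.aestronglyMeasurable hK.measurableSet) (Eventually.of_forall fun y => hM _)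
    rw [integral_bohmianMeasureSlab_eq_setIntegral (hψm ε h8) (hGm ε h8) hφ hKT subset_rfl,
      dist_zero_right]
    rw [← integral_sub I1 I2]
    have Isum : Integrable (fun y : ℝ × RSpace d => ∑ k, ‖ψ ε y.1 y.2‖ * ‖Y k ε y‖)
        (volume.restrict K) := integrable_finsetSum _ fun k _ => IY k
    calc ‖∫ y in K, (‖ψ ε y.1 y.2‖ ^ 2 *
          φ (y.1, y.2, velocityOf ε (ψ ε y.1 y.2) (G ε y.1 y.2)) - w y * ‖ψ ε y.1 y.2‖ ^ 2)‖
        ≤ ∫ y in K, (δ / (2 * (B + 1)) * ‖ψ ε y.1 y.2‖ ^ 2 +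
            c * ∑ k, ‖ψ ε y.1 y.2‖ * ‖Y k ε y‖) := by
          refine norm_integral_le_of_norm_le ((Iψ.const_mul _).add (Isum.const_mul c))
            (Eventually.of_forall fun y => ?_)
          have e1 := hφc' y.1 y.2 (velocityOf ε (ψ ε y.1 y.2) (G ε y.1 y.2)) (q y)
          have e2 := norm_sq_mul_norm_velocityOf_sub_le ε (ψ ε y.1 y.2) (G ε y.1 y.2) (q y)
          rw [Finset.mul_sum] at e2
          rw [mul_comm (w y), ← mul_sub, norm_mul, Real.norm_of_nonneg (by positivity),
            Real.norm_eq_abs]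
          calc _ ≤ ‖ψ ε y.1 y.2‖ ^ 2 * (δ / (2 * (B + 1)) +
                c * ‖velocityOf ε (ψ ε y.1 y.2) (G ε y.1 y.2) - q y‖) := by gcongr
            _ = δ / (2 * (B + 1)) * ‖ψ ε y.1 y.2‖ ^ 2 + c * (‖ψ ε y.1 y.2‖ ^ 2 *
                ‖velocityOf ε (ψ ε y.1 y.2) (G ε y.1 y.2) - q y‖) := by ring
            _ ≤ _ := by gcongr
      _ = δ / (2 * (B + 1)) * (∫ y in K, 1 * ‖ψ ε y.1 y.2‖ ^ 2) +
            c * ∑ k, ∫ y in K, ‖ψ ε y.1 y.2‖ * ‖Y k ε y‖ := by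
          rw [integral_add (Iψ.const_mul _) (Isum.const_mul c), integral_const_mul,
            integral_const_mul, integral_finsetSum _ fun k _ => IY k]
          simp
      _ < δ / 2 + δ / 2 := by
          refine add_lt_add_of_le_of_lt ?_ h2
          calc _ ≤ δ / (2 * (B + 1)) * (B + 1) := by gcongr
            _ = δ / 2 := by field_simp
      _ = δ := add_halves δ
  have := herr.add hmain
  simpa only [sub_add_cancel, zero_add] using this

end WKB

/-! ### A pair of points at maximal distance. -/

section Diameter

variable {V : Type*} [NormedAddCommGroup V] [InnerProductSpace ℝ V]

/-- A difference of maximal length of distinct points is attained only once. -/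
theorem exists_unique_sub {ι : Type*} [Finite ι] [Nontrivial ι] {g : ι → V}
    (hg : Function.Injective g) : ∃ j₀ k₀, j₀ ≠ k₀ ∧
      ∀ j k, g j - g k = g j₀ - g k₀ → j = j₀ ∧ k = k₀ := by
  obtain ⟨⟨j₀, k₀⟩, hmax⟩ := Finite.exists_max fun p : ι × ι => ‖g p.1 - g p.2‖
  refine ⟨j₀, k₀, fun h => ?_, fun j k hjk => ?_⟩
  · obtain ⟨a, c, hac⟩ := exists_pair_ne ι
    have h1 := hmax (a, c)
    simp only [h, sub_self, norm_zero] at h1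
    exact hac (hg (sub_eq_zero.1 (norm_le_zero_iff.1 h1)))
  · have h1 := hmax (j, k₀)
    have h2 := hmax (j₀, k)
    simp only at h1 h2
    set v := g j₀ - g k₀ with hv
    set r := g j - g j₀ with hr
    have e1 : g j - g k₀ = v + r := by rw [hv, hr]; abel
    have e2 : g j₀ - g k = v - r := by rw [← hjk, hr]; abel
    rw [e1] at h1
    rw [e2] at h2
    -- Both v + r and v - r are differences of points of the family, hence no longer than v. The
    -- parallelogram law then forces r = 0.
    have h3 : ‖v + r‖ ^ 2 + ‖v - r‖ ^ 2 = 2 * (‖v‖ ^ 2 + ‖r‖ ^ 2) := by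
      have := parallelogram_law_with_norm ℝ v r
      nlinarith
    have h4 : ‖v + r‖ ^ 2 ≤ ‖v‖ ^ 2 := by gcongr
    have h5 : ‖v - r‖ ^ 2 ≤ ‖v‖ ^ 2 := by gcongr
    have h6 : ‖r‖ = 0 := by
      have : ‖r‖ ^ 2 ≤ 0 := by linarith
      exact pow_eq_zero_iff (two_ne_zero) |>.1 (le_antisymm this (sq_nonneg _))
    have h7 : g j = g j₀ := sub_eq_zero.1 (norm_eq_zero.1 h6)
    have h8 : j = j₀ := hg h7
    refine ⟨h8, hg ?_⟩
    have := hjk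
    rw [h7] at this
    exact sub_right_injective this

end Diameter

/-! ### Selecting a single pair of phases by resonance. -/

section Resonance

variable {E : Type*} [NormedAddCommGroup E] [NormedSpace ℝ E] [FiniteDimensional ℝ E]
  [MeasurableSpace E] [BorelSpace E] {μ : Measure E} [μ.IsAddHaarMeasure]

/-- Only the resonant pair of phases contributes to the limit. -/
theorem tendsto_integral_oscExp_mul_ampSum_mul_conj {ι : Type*} [Fintype ι] {U : Set E}
    (hU : IsOpen U) {χ : E → ℂ} (hχ : Continuous χ) (hχc : HasCompactSupport χ)
    (hχU : tsupport χ ⊆ U) {F F' : ι → E → ℂ} (hF : ∀ j, ContinuousOn (F j) U)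
    (hF' : ∀ j, ContinuousOn (F' j) U) {S : ι → E → ℝ} (hS : ∀ j, ContDiffOn ℝ ∞ (S j) U)
    {B : E → ℂ} (hB : ContinuousOn B U) {θ : E → ℝ} (hθ : ContDiffOn ℝ ∞ θ U) {j₁ k₁ : ι}
    (hres : ∀ y, S j₁ y - S k₁ y + θ y = 0)
    (hcrit : ∀ j k, (j, k) ≠ (j₁, k₁) → ∀ y ∈ U,
      fderiv ℝ (fun z => S j z - S k z + θ z) y ≠ 0) :
    Tendsto (fun ε => ∫ y, χ y * (B y * oscExp θ ε y *
        (ampSum F S ε y * starRingEnd ℂ (ampSum F' S ε y))) ∂μ) (𝓝[>] 0)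
      (𝓝 (∫ y, χ y * (B y * (F j₁ y * starRingEnd ℂ (F' k₁ y))) ∂μ)) := by
  classical
  have hconj : ∀ j, ContinuousOn (fun y => starRingEnd ℂ (F' j y)) U := fun j =>
    Complex.continuous_conj.comp_continuousOn (hF' j)
  have hexp : ∀ ε, ∫ y, χ y * (B y * oscExp θ ε y *
        (ampSum F S ε y * starRingEnd ℂ (ampSum F' S ε y))) ∂μ =
      ∑ p : ι × ι, ∫ y, χ y * (B y * (F p.1 y * starRingEnd ℂ (F' p.2 y))) *
        oscExp (fun z => S p.1 z - S p.2 z + θ z) ε y ∂μ := by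
    intro ε
    have hI : ∀ p : ι × ι, Integrable (fun y => χ y * (B y * (F p.1 y * starRingEnd ℂ (F' p.2 y))) *
        oscExp (fun z => S p.1 z - S p.2 z + θ z) ε y) μ := by
      intro p
      simp_rw [mul_assoc (χ _)]
      exact integrable_mul_of_tsupport_subset hU hχ hχc hχU
        ((hB.mul ((hF p.1).mul (hconj p.2))).mul
          ((((hS p.1).continuousOn.sub (hS p.2).continuousOn).add hθ.continuousOn).oscExp ε))
    have hpt : ∀ y, χ y * (B y * oscExp θ ε y *
        (ampSum F S ε y * starRingEnd ℂ (ampSum F' S ε y))) =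
        ∑ p : ι × ι, χ y * (B y * (F p.1 y * starRingEnd ℂ (F' p.2 y))) *
          oscExp (fun z => S p.1 z - S p.2 z + θ z) ε y := by
      intro y
      simp only [ampSum, map_sum, map_mul]
      rw [Finset.sum_mul_sum, ← Finset.univ_product_univ, ← Finset.sum_product', Finset.mul_sum,
        Finset.mul_sum]
      refine Finset.sum_congr rfl fun p _ => ?_
      rw [← oscExp_mul, ← oscExp_mul_conj]
      ring
    simp_rw [hpt]
    exact integral_finsetSum _ fun p _ => hI p
  simp_rw [hexp]
  have hdiag : ∫ y, χ y * (B y * (F j₁ y * starRingEnd ℂ (F' k₁ y))) ∂μ =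
      ∑ p : ι × ι, if p = (j₁, k₁) then
        ∫ y, χ y * (B y * (F j₁ y * starRingEnd ℂ (F' k₁ y))) ∂μ else 0 := by simp
  rw [hdiag]
  refine tendsto_finsetSum _ fun p _ => ?_
  by_cases hp : p = (j₁, k₁)
  · subst hp
    -- At resonance the total phase vanishes identically, so the integral does not depend on ε.
    simp [oscExp, hres]
  · simp only [hp, if_false]
    exact tendsto_integral_mul_oscExp hU hχ hχc hχU (hB.mul ((hF p.1).mul (hconj p.2)))
      (((hS p.1).sub (hS p.2)).add hθ) (hcrit p.1 p.2 hp)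

theorem norm_sq_sub_ofReal_mul (x a : ℂ) (h : ℝ) :
    ‖x - h * a‖ ^ 2 = ‖x‖ ^ 2 - 2 * h * (x * starRingEnd ℂ a).re + h ^ 2 * ‖a‖ ^ 2 := by
  simp only [← Complex.normSq_eq_norm_sq, Complex.normSq_apply, Complex.sub_re, Complex.sub_im,
    Complex.mul_re, Complex.mul_im, Complex.ofReal_re, Complex.ofReal_im, Complex.conj_re,
    Complex.conj_im]
  ring

end Resonance

/-! ### Several phases: the energy gap. -/

section Oscillation

variable {d N : ℕ} {Ω : Set (ℝ × RSpace d)} {b : Fin N → ℝ × RSpace d → ℂ}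
  {S : Fin N → ℝ × RSpace d → ℝ}

/-- For at least two phases, a suitable real multiple of the superposition can be subtracted from
the leading part of a directional derivative in such a way that the energy decreases. -/
theorem exists_energy_gap [Nontrivial (Fin N)] (hΩ : IsOpen Ω) (hΩne : Ω.Nonempty)
    (hb : ∀ j, ContDiffOn ℝ ∞ (b j) Ω) (hS : ∀ j, ContDiffOn ℝ ∞ (S j) Ω)
    (hgrad : ∀ j k, j ≠ k → ∀ t x, (t, x) ∈ Ω → spaceGrad (S j) t x ≠ spaceGrad (S k) t x)
    (hb0 : ∀ j, ∀ y ∈ Ω, b j y ≠ 0) :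
    ∃ (e : RSpace d) (χ : ℝ × RSpace d → ℝ) (h : ℝ → ℝ × RSpace d → ℝ) (M γ : ℝ),
      Continuous χ ∧ HasCompactSupport χ ∧ tsupport χ ⊆ Ω ∧ (∀ y, 0 ≤ χ y) ∧
      (∀ ε, ContinuousOn (h ε) Ω) ∧ (∀ ε, ∀ y ∈ tsupport χ, |h ε y| ≤ M) ∧ 0 < γ ∧
      ∀ᶠ ε in 𝓝[>] (0 : ℝ),
        ∫ y, χ y * ‖ampSum (gradAmp b S e) S ε y - h ε y * ampSum b S ε y‖ ^ 2 ≤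
          (∑ j, ∫ y, χ y * (‖b j y‖ ^ 2 * (inner ℝ (spaceGrad (S j) y.1 y.2) e) ^ 2)) - γ := by
  obtain ⟨y₀, hy₀⟩ := hΩne
  have hinj : Function.Injective fun j => spaceGrad (S j) y₀.1 y₀.2 := fun j k hjk => by
    by_contra hne
    exact hgrad j k hne y₀.1 y₀.2 hy₀ hjk
  obtain ⟨j₀, k₀, hne, huniq⟩ := exists_unique_sub hinj
  -- In this direction e·(∇S_{j₀} - ∇S_{k₀}) is |e|² > 0 at y₀, hence positive nearby; this gives
  -- the gain its sign.
  let e : RSpace d := spaceGrad (S j₀) y₀.1 y₀.2 - spaceGrad (S k₀) y₀.1 y₀.2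
  let θ : ℝ × RSpace d → ℝ := fun y => S j₀ y - S k₀ y
  have hθ : ContDiffOn ℝ ∞ θ Ω := (hS j₀).sub (hS k₀)
  let Θ : Fin N → Fin N → ℝ × RSpace d → ℝ := fun j k y => S j y - S k y + θ y
  have hΘ : ∀ j k, ContDiffOn ℝ ∞ (Θ j k) Ω := fun j k => ((hS j).sub (hS k)).add hθ
  have hSd : ∀ j, ∀ y ∈ Ω, DifferentiableAt ℝ (S j) y := fun j y hy =>
    ((hS j).contDiffAt (hΩ.mem_nhds hy)).differentiableAt (by simp)
  let a : Fin N → ℝ × RSpace d → ℝ := fun j y => inner ℝ (spaceGrad (S j) y.1 y.2) e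
  have ha : ∀ j, ContinuousOn (a j) Ω := fun j => continuousOn_inner_spaceGrad hΩ (hS j) e
  -- A critical point of S_j - S_k + S_{j₀} - S_{k₀} at y₀ would give ∇S_k - ∇S_j = ∇S_{j₀} -
  -- ∇S_{k₀} there, which uniqueness of the maximal difference excludes. Continuity extends this to
  -- a neighbourhood.
  have hev1 : ∀ j k, (j, k) ≠ (k₀, j₀) → ∀ᶠ y in 𝓝 y₀, fderiv ℝ (Θ j k) y ≠ 0 := by
    intro j k hjk
    have hc : ContinuousAt (fderiv ℝ (Θ j k)) y₀ :=
      ((hΘ j k).continuousOn_fderiv_of_isOpen hΩ (by simp)).continuousAt (hΩ.mem_nhds hy₀)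
    refine hc.eventually_ne fun h0 => hjk ?_
    have h1 : fderiv ℝ (Θ j k) y₀ = fderiv ℝ (S j) y₀ - fderiv ℝ (S k) y₀ +
        (fderiv ℝ (S j₀) y₀ - fderiv ℝ (S k₀) y₀) := by
      exact (((hSd j _ hy₀).hasFDerivAt.sub (hSd k _ hy₀).hasFDerivAt).add
        ((hSd j₀ _ hy₀).hasFDerivAt.sub (hSd k₀ _ hy₀).hasFDerivAt)).fderiv
    have h2 : spaceGrad (S k) y₀.1 y₀.2 - spaceGrad (S j) y₀.1 y₀.2 =
        spaceGrad (S j₀) y₀.1 y₀.2 - spaceGrad (S k₀) y₀.1 y₀.2 := by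
      refine ext_inner_right ℝ fun f => ?_
      rw [inner_sub_left, inner_sub_left, inner_spaceGrad (hSd k _ hy₀),
        inner_spaceGrad (hSd j _ hy₀), inner_spaceGrad (hSd j₀ _ hy₀),
        inner_spaceGrad (hSd k₀ _ hy₀)]
      have := congrArg (fun L => L (0, f)) (h1.symm.trans h0)
      simp only [_root_.add_apply, _root_.sub_apply, _root_.zero_apply] at this
      linarith
    obtain ⟨h3, h4⟩ := huniq k j h2
    rw [h3, h4]
  have hev2 : ∀ᶠ y in 𝓝 y₀, 0 < a j₀ y - a k₀ y := by
    have hc : ContinuousAt (fun y => a j₀ y - a k₀ y) y₀ :=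
      ((ha j₀).sub (ha k₀)).continuousAt (hΩ.mem_nhds hy₀)
    have h0 : 0 < a j₀ y₀ - a k₀ y₀ := by
      simp only [a]
      rw [← inner_sub_left]
      exact real_inner_self_pos.2 (sub_ne_zero.2 (hinj.ne hne))
    exact hc.eventually (lt_mem_nhds h0)
  have hev : ∀ᶠ y in 𝓝 y₀, y ∈ Ω ∧ 0 < a j₀ y - a k₀ y ∧
      ∀ p : Fin N × Fin N, p ≠ (k₀, j₀) → fderiv ℝ (Θ p.1 p.2) y ≠ 0 := by
    refine (hΩ.eventually_mem hy₀).and (hev2.and (eventually_all.2 fun p => ?_))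
    by_cases hp : p = (k₀, j₀)
    · exact Eventually.of_forall fun y h => absurd hp h
    · exact (hev1 p.1 p.2 hp).mono fun y h _ => h
  obtain ⟨U, hU, hUo, hyU⟩ := eventually_nhds_iff.1 hev
  obtain ⟨χ, hχ, hχc, hχU, hχ1, hχy⟩ := exists_smooth_cutoff (isCompact_singleton (x := y₀)) hUo
    (singleton_subset_iff.2 hyU)
  have hUΩ : U ⊆ Ω := fun y hy => (hU y hy).1
  have hχΩ : tsupport χ ⊆ Ω := hχU.trans hUΩ
  let χC : ℝ × RSpace d → ℂ := fun y => χ y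
  have hχC : Continuous χC := Complex.continuous_ofReal.comp hχ.continuous
  have hsupp : tsupport χC ⊆ tsupport χ := closure_mono fun y hy h => hy (by simp [χC, h])
  have hχCc : HasCompactSupport χC := hχc.of_isClosed_subset (isClosed_tsupport _) hsupp
  have hbc : ∀ j, ContinuousOn (b j) Ω := fun j => (hb j).continuousOn
  let B : ℝ × RSpace d → ℂ := fun y => b j₀ y * starRingEnd ℂ (b k₀ y)
  have hB : ContinuousOn B Ω := (hbc j₀).mul (Complex.continuous_conj.comp_continuousOn (hbc k₀))
  -- real valued integrands
  have hint : ∀ f : ℝ × RSpace d → ℝ, ContinuousOn f Ω → Integrable (fun y => χ y * f y) volume := by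
    intro f hf
    refine (continuous_of_continuousAt_tsupport fun y hy => ?_).integrable_of_hasCompactSupport
      hχc.mul_right
    exact hχ.continuous.continuousAt.mul
      (hf.continuousAt (hΩ.mem_nhds (hχΩ (tsupport_mul_subset_left hy))))
  have hAc : ∀ ε, ContinuousOn (ampSum b S ε) Ω := fun ε =>
    ContinuousOn.ampSum hbc (fun j => (hS j).continuousOn) ε
  have hgA : ∀ j, ContinuousOn (gradAmp b S e j) Ω := continuousOn_gradAmp hΩ hb hS e
  have hDc : ∀ ε, ContinuousOn (ampSum (gradAmp b S e) S ε) Ω := fun ε =>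
    ContinuousOn.ampSum hgA (fun j => (hS j).continuousOn) ε
  -- the gain
  let L : ℝ := ∫ y, χ y * ((a j₀ y - a k₀ y) * (‖b j₀ y‖ ^ 2 * ‖b k₀ y‖ ^ 2))
  have hLc : ContinuousOn (fun y => (a j₀ y - a k₀ y) * (‖b j₀ y‖ ^ 2 * ‖b k₀ y‖ ^ 2)) Ω :=
    ((ha j₀).sub (ha k₀)).mul (((hbc j₀).norm.pow 2).mul ((hbc k₀).norm.pow 2))
  have hL : 0 < L := by
    have hcont : Continuous fun y => χ y * ((a j₀ y - a k₀ y) * (‖b j₀ y‖ ^ 2 * ‖b k₀ y‖ ^ 2)) :=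
      continuous_of_continuousAt_tsupport fun y hy => hχ.continuous.continuousAt.mul
        (hLc.continuousAt (hΩ.mem_nhds (hχΩ (tsupport_mul_subset_left hy))))
    refine hcont.integral_pos_of_hasCompactSupport_nonneg_nonzero (x := y₀) hχc.mul_right
      (fun y => ?_) ?_
    · by_cases hy : y ∈ tsupport χ
      · exact mul_nonneg (hχ1 y).1 (mul_nonneg (hU y (hχU hy)).2.1.le (by positivity))
      · simp [image_eq_zero_of_notMem_tsupport hy]
    · rw [hχy y₀ rfl, one_mul]
      have h1 := (hU y₀ hyU).2.1
      have h2 := hb0 j₀ y₀ hy₀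
      have h3 := hb0 k₀ y₀ hy₀
      positivity
  -- the bounds
  obtain ⟨m₁, hm₁⟩ := hχc.isCompact.exists_bound_of_continuousOn (hB.mono hχΩ)
  obtain ⟨m₂, hm₂⟩ := hχc.isCompact.exists_bound_of_continuousOn
    ((continuousOn_finsetSum Finset.univ fun j _ => (hbc j).norm).mono hχΩ)
  have hm₁0 : 0 ≤ m₁ := (norm_nonneg _).trans (hm₁ y₀ (subset_tsupport _ (by simp [hχy y₀ rfl])))
  let H : ℝ := ∫ y, χ y * (m₁ ^ 2 * m₂ ^ 2)
  have hH : 0 ≤ H := integral_nonneg fun y => mul_nonneg (hχ1 y).1 (by positivity)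
  -- The gain is δL and the cost at most δ²H; this choice makes the cost at most half the gain, and
  -- H + 1 avoids division by zero.
  let δ : ℝ := L / (2 * (H + 1))
  have hδ : 0 < δ := by positivity
  -- The interference part of ρ is 2 Re(B e^{iθ/ε}), so its rescaled derivative along e oscillates,
  -- to leading order, like -Im(B e^{iθ/ε}). This is the real multiplier that best correlates with
  -- the part of ε e·∇ψ carrying no current.
  let h : ℝ → ℝ × RSpace d → ℝ := fun ε y => -δ * (B y * oscExp θ ε y).im
  have hoscθ : ∀ ε, ContinuousOn (fun y => B y * oscExp θ ε y) Ω := fun ε =>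
    hB.mul (hθ.continuousOn.oscExp ε)
  have hhc : ∀ ε, ContinuousOn (h ε) Ω := fun ε =>
    continuousOn_const.mul (Complex.continuous_im.comp_continuousOn (hoscθ ε))
  have hhb : ∀ ε, ∀ y ∈ tsupport χ, |h ε y| ≤ δ * m₁ := by
    intro ε y hy
    rw [abs_mul, abs_neg, abs_of_pos hδ]
    gcongr
    refine (Complex.abs_im_le_norm _).trans ?_
    rw [norm_mul, norm_oscExp, mul_one]
    exact hm₁ y hy
  -- The linear term tends to -δL and is combined with a slack of δL/4 for the limit; with the cost
  -- δL/2 this leaves a gap δL/4.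
  refine ⟨e, χ, h, δ * m₁, δ * L / 4, hχ.continuous, hχc, hχΩ, fun y => (hχ1 y).1, hhc, hhb,
    by positivity, ?_⟩
  -- the main term
  have T1 : Tendsto (fun ε => ∫ y, χ y * ‖ampSum (gradAmp b S e) S ε y‖ ^ 2) (𝓝[>] 0)
      (𝓝 (∑ j, ∫ y, χ y * (‖b j y‖ ^ 2 * (inner ℝ (spaceGrad (S j) y.1 y.2) e) ^ 2))) := by
    have h1 := tendsto_integral_ampSum_mul_conj (μ := volume) hΩ hχC hχCc (hsupp.trans hχΩ)
      hgA hgA hS fun j k hjk y hy =>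
        fderiv_ne_zero_of_spaceGrad_ne (hSd j y hy) (hSd k y hy) (hgrad j k hjk y.1 y.2 hy)
    have h2 := (Complex.continuous_re.tendsto _).comp h1
    have h3 : ∀ f : ℝ × RSpace d → ℂ, (∫ y, χC y * (f y * starRingEnd ℂ (f y))) =
        ((∫ y, χ y * ‖f y‖ ^ 2 : ℝ) : ℂ) := by
      intro f
      refine Eq.trans ?_ (integral_ofReal (𝕜 := ℂ))
      refine integral_congr_ae (Eventually.of_forall fun y => ?_)
      simp [Complex.mul_conj', χC]
    simp only [h3, Function.comp_def, ← Complex.ofReal_sum, Complex.ofReal_re] at h2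
    have h4 : ∀ j y, ‖gradAmp b S e j y‖ ^ 2 =
        ‖b j y‖ ^ 2 * (inner ℝ (spaceGrad (S j) y.1 y.2) e) ^ 2 := fun j y => by
      simp only [gradAmp, norm_mul, Complex.norm_I, one_mul, Complex.norm_real, mul_pow,
        Real.norm_eq_abs, sq_abs]
      ring
    simpa only [h4] using h2
  -- the resonant term
  have hres : ∀ y, S k₀ y - S j₀ y + θ y = 0 := fun y => by simp only [θ]; ring
  have hcrit : ∀ j k, (j, k) ≠ (k₀, j₀) → ∀ y ∈ U,
      fderiv ℝ (fun z => S j z - S k z + θ z) y ≠ 0 := fun j k hjk y hy => (hU y hy).2.2 _ hjk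
  -- With Z = B e^{iθ/ε} and Y the product of the gradient part and the conjugate superposition, 2
  -- Im Z Re Y is the real part of -i(ZY + Z conj Y). In each summand only the pair (k₀, j₀)
  -- resonates.
  have T2 : Tendsto (fun ε => ∫ y, χ y * (-2 * h ε y * (ampSum (gradAmp b S e) S ε y *
      starRingEnd ℂ (ampSum b S ε y)).re)) (𝓝[>] 0) (𝓝 (-δ * L)) := by
    have t1 := tendsto_integral_oscExp_mul_ampSum_mul_conj (μ := volume) hUo hχC hχCc
      (hsupp.trans hχU) (fun j => (hgA j).mono hUΩ) (fun j => (hbc j).mono hUΩ)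
      (fun j => (hS j).mono hUΩ) (hB.mono hUΩ) (hθ.mono hUΩ) hres hcrit
    have t2 := tendsto_integral_oscExp_mul_ampSum_mul_conj (μ := volume) hUo hχC hχCc
      (hsupp.trans hχU) (fun j => (hbc j).mono hUΩ) (fun j => (hgA j).mono hUΩ)
      (fun j => (hS j).mono hUΩ) (hB.mono hUΩ) (hθ.mono hUΩ) hres hcrit
    have t3 := (Complex.continuous_re.tendsto _).comp ((t1.add t2).const_mul (-δ * Complex.I))
    have hconjc : ∀ f : ℝ × RSpace d → ℂ, ContinuousOn f Ω →
        ContinuousOn (fun y => starRingEnd ℂ (f y)) Ω := fun f hf =>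
      Complex.continuous_conj.comp_continuousOn hf
    have hCint : ∀ f : ℝ × RSpace d → ℂ, ContinuousOn f Ω → Integrable (fun y => χC y * f y) volume :=
      fun f hf => integrable_mul_of_tsupport_subset hΩ hχC hχCc (hsupp.trans hχΩ) hf
    have hcombine : ∀ f g : ℝ × RSpace d → ℂ, ContinuousOn f Ω → ContinuousOn g Ω →
        (-δ * Complex.I * ((∫ y, χC y * f y) + ∫ y, χC y * g y)).re =
          ∫ y, χ y * (-δ * Complex.I * (f y + g y)).re := by
      intro f g hf hg
      rw [← integral_add (hCint f hf) (hCint g hg), ← integral_const_mul]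
      have hI : Integrable (fun y => -δ * Complex.I * (χC y * f y + χC y * g y)) volume :=
        ((hCint f hf).add (hCint g hg)).const_mul _
      have h0 := integral_re hI
      refine Eq.trans h0.symm (integral_congr_ae (Eventually.of_forall fun y => ?_))
      have h1 : -δ * Complex.I * (χC y * f y + χC y * g y) =
          (χ y : ℂ) * (-δ * Complex.I * (f y + g y)) := by simp only [χC]; ring
      change (-δ * Complex.I * (χC y * f y + χC y * g y)).re = _
      rw [h1, Complex.re_ofReal_mul]
    have hlimit : (-δ * Complex.I * ((∫ y, χC y * (B y * (gradAmp b S e k₀ y *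
        starRingEnd ℂ (b j₀ y)))) + ∫ y, χC y * (B y * (b k₀ y *
          starRingEnd ℂ (gradAmp b S e j₀ y))))).re = -δ * L := by
      rw [hcombine (fun y => B y * (gradAmp b S e k₀ y * starRingEnd ℂ (b j₀ y)))
        (fun y => B y * (b k₀ y * starRingEnd ℂ (gradAmp b S e j₀ y)))
        (hB.mul ((hgA k₀).mul (hconjc _ (hbc j₀))))
        (hB.mul ((hbc k₀).mul (hconjc _ (hgA j₀)))), ← integral_const_mul]
      refine integral_congr_ae (Eventually.of_forall fun y => ?_)
      -- The two resonant contributions are i a_{k₀} and -i a_{j₀} times |b_{j₀}|²|b_{k₀}|²;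
      -- multiplied by -iδ their sum is real and negative where a_{j₀} > a_{k₀}.
      have h1 : -δ * Complex.I * (B y * (gradAmp b S e k₀ y * starRingEnd ℂ (b j₀ y)) +
          B y * (b k₀ y * starRingEnd ℂ (gradAmp b S e j₀ y))) =
          ((-δ * ((a j₀ y - a k₀ y) * (‖b j₀ y‖ ^ 2 * ‖b k₀ y‖ ^ 2)) : ℝ) : ℂ) := by
        have e1 := Complex.mul_conj' (b j₀ y)
        have e2 := Complex.mul_conj' (b k₀ y)
        push_cast
        rw [← e1, ← e2]
        simp only [B, gradAmp, map_mul, Complex.conj_I, Complex.conj_ofReal, a]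
        linear_combination (-δ * (b j₀ y * starRingEnd ℂ (b j₀ y)) * (b k₀ y * starRingEnd ℂ (b k₀ y)) *
          ((inner ℝ (spaceGrad (S k₀) y.1 y.2) e : ℝ) - (inner ℝ (spaceGrad (S j₀) y.1 y.2) e : ℝ) : ℂ)) *
            Complex.I_sq
      simp only [h1, Complex.ofReal_re]
      ring
    rw [hlimit] at t3
    refine t3.congr fun ε => ?_
    simp only [Function.comp_apply]
    rw [hcombine (fun y => B y * oscExp θ ε y * (ampSum (gradAmp b S e) S ε y *
        starRingEnd ℂ (ampSum b S ε y))) (fun y => B y * oscExp θ ε y * (ampSum b S ε y *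
        starRingEnd ℂ (ampSum (gradAmp b S e) S ε y))) ((hoscθ ε).mul ((hDc ε).mul (hconjc _ (hAc ε))))
      ((hoscθ ε).mul ((hAc ε).mul (hconjc _ (hDc ε))))]
    refine integral_congr_ae (Eventually.of_forall fun y => ?_)
    simp only [h]
    congr 1
    simp only [Complex.mul_re, Complex.mul_im, Complex.add_re, Complex.add_im, Complex.conj_re,
      Complex.conj_im, Complex.I_re, Complex.I_im, Complex.neg_re, Complex.neg_im,
      Complex.ofReal_re, Complex.ofReal_im]
    ring
  have T3 : ∀ ε, ∫ y, χ y * (h ε y ^ 2 * ‖ampSum b S ε y‖ ^ 2) ≤ δ ^ 2 * H := by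
    intro ε
    rw [← integral_const_mul]
    refine integral_mono (hint _ (((hhc ε).pow 2).mul ((hAc ε).norm.pow 2)))
      ((hint _ continuousOn_const).const_mul _) fun y => ?_
    by_cases hy : y ∈ tsupport χ
    · have h1 : ‖ampSum b S ε y‖ ≤ m₂ :=
        (norm_ampSum_le b S ε y).trans ((le_abs_self _).trans (hm₂ y hy))
      have h2 : h ε y ^ 2 ≤ (δ * m₁) ^ 2 := sq_le_sq' (abs_le.1 (hhb ε y hy)).1
        (abs_le.1 (hhb ε y hy)).2
      have h3 := (hχ1 y).1
      calc χ y * (h ε y ^ 2 * ‖ampSum b S ε y‖ ^ 2) ≤ χ y * ((δ * m₁) ^ 2 * m₂ ^ 2) := by gcongr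
        _ = δ ^ 2 * (χ y * (m₁ ^ 2 * m₂ ^ 2)) := by ring
    · simp [image_eq_zero_of_notMem_tsupport hy]
  have T4 := T1.add T2
  have hδH : δ ^ 2 * H ≤ δ * L / 2 := by
    have : δ * (H + 1) = L / 2 := by simp only [δ]; field_simp
    nlinarith
  have hlt : (∑ j, ∫ y, χ y * (‖b j y‖ ^ 2 * (inner ℝ (spaceGrad (S j) y.1 y.2) e) ^ 2)) + -δ * L <
      (∑ j, ∫ y, χ y * (‖b j y‖ ^ 2 * (inner ℝ (spaceGrad (S j) y.1 y.2) e) ^ 2)) - 3 * (δ * L) / 4 := by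
    have : 0 < δ * L := by positivity
    linarith
  filter_upwards [T4.eventually_lt_const hlt] with ε hε
  have hsplit : ∫ y, χ y * ‖ampSum (gradAmp b S e) S ε y - h ε y * ampSum b S ε y‖ ^ 2 =
      ((∫ y, χ y * ‖ampSum (gradAmp b S e) S ε y‖ ^ 2) +
        ∫ y, χ y * (-2 * h ε y * (ampSum (gradAmp b S e) S ε y *
          starRingEnd ℂ (ampSum b S ε y)).re)) +
        ∫ y, χ y * (h ε y ^ 2 * ‖ampSum b S ε y‖ ^ 2) := by
    have I1 := hint (fun y => ‖ampSum (gradAmp b S e) S ε y‖ ^ 2) ((hDc ε).norm.pow 2)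
    have I2 := hint (fun y => -2 * h ε y * (ampSum (gradAmp b S e) S ε y *
          starRingEnd ℂ (ampSum b S ε y)).re) ((continuousOn_const.mul (hhc ε)).mul
        (Complex.continuous_re.comp_continuousOn ((hDc ε).mul
          (Complex.continuous_conj.comp_continuousOn (hAc ε)))))
    have I3 := hint (fun y => h ε y ^ 2 * ‖ampSum b S ε y‖ ^ 2) (((hhc ε).pow 2).mul ((hAc ε).norm.pow 2))
    have I12 : Integrable (fun y => χ y * ‖ampSum (gradAmp b S e) S ε y‖ ^ 2 +
        χ y * (-2 * h ε y * (ampSum (gradAmp b S e) S ε y *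
          starRingEnd ℂ (ampSum b S ε y)).re)) volume := I1.add I2
    rw [← integral_add I1 I2, ← integral_add I12 I3]
    refine integral_congr_ae (Eventually.of_forall fun y => ?_)
    simp only [norm_sq_sub_ofReal_mul]
    ring
  rw [hsplit]
  have := T3 ε
  linarith

end Oscillation

/-! ### Comparison of limiting Bohmian measures with the multi-phase measure. -/

section Comparison

variable {d N : ℕ} {Ω : Set (ℝ × RSpace d)} {b : Fin N → ℝ × RSpace d → ℂ}
  {S : Fin N → ℝ × RSpace d → ℝ} {T : ℝ}
  {ψ : ℝ → ℝ → RSpace d → ℂ} {G : ℝ → ℝ → RSpace d → EuclideanSpace ℂ (Fin d)} {C : NNReal}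

/-- For at least two phases the limiting Bohmian measures differ from the multi-phase measure. -/
theorem restrict_ne_multiPhaseMeasure [Nontrivial (Fin N)] (hΩ : IsOpen Ω) (hΩne : Ω.Nonempty)
    (hΩT : Ω ⊆ Icc 0 T ×ˢ univ)
    (hb : ∀ j, ContDiffOn ℝ ∞ (b j) Ω) (hS : ∀ j, ContDiffOn ℝ ∞ (S j) Ω)
    (hgrad : ∀ j k, j ≠ k → ∀ t x, (t, x) ∈ Ω → spaceGrad (S j) t x ≠ spaceGrad (S k) t x)
    (hb0 : ∀ j, ∀ y ∈ Ω, b j y ≠ 0)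
    (hψm : ∀ ε ∈ Ioc (0 : ℝ) 1, AEStronglyMeasurable (fun y : ℝ × RSpace d => ψ ε y.1 y.2)
      (volume.restrict (Icc 0 T ×ˢ univ)))
    (hGm : ∀ ε ∈ Ioc (0 : ℝ) 1, AEStronglyMeasurable (fun y : ℝ × RSpace d => G ε y.1 y.2)
      (volume.restrict (Icc 0 T ×ˢ univ)))
    (hwkb : HasWKBForm Ω b S ψ G) {l : Filter ℝ} [l.NeBot] (hl : l ≤ 𝓝[>] 0)
    {β : Measure (ℝ × RSpace d × RSpace d)}
    (hlim : ∀ φ : ℝ × RSpace d × RSpace d → ℝ, Continuous φ → HasCompactSupport φ →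
      tsupport φ ⊆ overSet Ω → Tendsto (fun ε => ∫ z, φ z ∂(bohmianMeasureSlab T ε (ψ ε) (G ε)))
        l (𝓝 (∫ z, φ z ∂β))) :
    β.restrict (overSet Ω) ≠ multiPhaseMeasure Ω b S := by
  intro hβ
  obtain ⟨e, χ, h, M, γ, hχ, hχc, hχΩ, hχ0, hhc, hhM, hγ, hgap⟩ :=
    exists_energy_gap hΩ hΩne hb hS hgrad hb0
  let K : Set (ℝ × RSpace d) := tsupport χ
  have hK : IsCompact K := hχc
  have hKT : K ⊆ Icc 0 T ×ˢ univ := hχΩ.trans hΩT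
  have hbK : ∀ j, ContinuousOn (b j) K := fun j => (hb j).continuousOn.mono hχΩ
  have hSK : ∀ j, ContinuousOn (S j) K := fun j => (hS j).continuousOn.mono hχΩ
  have hgK : ∀ j, ContinuousOn (gradAmp b S e j) K := fun j =>
    (continuousOn_gradAmp hΩ hb hS e j).mono hχΩ
  -- a cutoff in momentum
  obtain ⟨R, hR⟩ := hK.exists_bound_of_continuousOn (continuousOn_finsetSum Finset.univ fun j _ =>
    ((continuousOn_spaceGrad hΩ (hS j)).mono hχΩ).norm)
  have hR' : ∀ j, ∀ y ∈ K, spaceGrad (S j) y.1 y.2 ∈ Metric.closedBall (0 : RSpace d) R := by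
    intro j y hy
    rw [mem_closedBall_zero_iff]
    refine le_trans ?_ ((le_abs_self _).trans (hR y hy))
    exact Finset.single_le_sum (f := fun j => ‖spaceGrad (S j) y.1 y.2‖)
      (fun i _ => norm_nonneg _) (Finset.mem_univ j)
  obtain ⟨κ, hκ, hκc, -, hκ1, hκR⟩ := exists_smooth_cutoff
    (isCompact_closedBall (0 : RSpace d) R) isOpen_univ (subset_univ _)
  -- A localized second momentum moment in direction e. The cutoff κ equals 1 at every ∇S_j over K,
  -- so it is invisible to w; on the Bohmian side κ ≤ 1 can only decrease the integral.
  let φ : ℝ × RSpace d × RSpace d → ℝ := fun z =>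
    χ (z.1, z.2.1) * ((inner ℝ z.2.2 e) ^ 2 * κ z.2.2)
  have hφ : Continuous φ := by
    have := hκ.continuous
    simp only [φ]
    fun_prop
  have hφs : Function.support φ ⊆ {z | (z.1, z.2.1) ∈ K ∧ z.2.2 ∈ tsupport κ} := by
    intro z hz
    simp only [φ, Function.mem_support, ne_eq, mul_eq_zero, not_or] at hz
    exact ⟨subset_tsupport _ hz.1, subset_tsupport _ hz.2.2⟩
  have hcl : IsClosed {z : ℝ × RSpace d × RSpace d | (z.1, z.2.1) ∈ K ∧ z.2.2 ∈ tsupport κ} :=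
    ((isClosed_tsupport χ).preimage (by fun_prop : Continuous fun z : ℝ × RSpace d × RSpace d =>
      (z.1, z.2.1))).inter ((isClosed_tsupport κ).preimage (by fun_prop :
        Continuous fun z : ℝ × RSpace d × RSpace d => z.2.2))
  have hφt : tsupport φ ⊆ {z | (z.1, z.2.1) ∈ K ∧ z.2.2 ∈ tsupport κ} := closure_minimal hφs hcl
  have hcomp : IsCompact {z : ℝ × RSpace d × RSpace d | (z.1, z.2.1) ∈ K ∧ z.2.2 ∈ tsupport κ} := by
    have h1 : IsCompact ((fun p : (ℝ × RSpace d) × RSpace d => (p.1.1, p.1.2, p.2)) ''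
        (K ×ˢ tsupport κ)) := (hK.prod hκc).image (by fun_prop)
    refine h1.of_isClosed_subset hcl fun z hz => ⟨((z.1, z.2.1), z.2.2), ⟨hz.1, hz.2⟩, rfl⟩
  have hφc : HasCompactSupport φ := hcomp.of_isClosed_subset (isClosed_tsupport _) hφt
  have hφΩ : tsupport φ ⊆ overSet Ω := fun z hz => hχΩ (hφt hz).1
  have hφK : baseProj '' tsupport φ ⊆ K := by
    rintro _ ⟨z, hz, rfl⟩
    exact (hφt hz).1
  let W : ℝ := ∑ j, ∫ y, χ y * (‖b j y‖ ^ 2 * (inner ℝ (spaceGrad (S j) y.1 y.2) e) ^ 2)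
  have hχK : ∀ f : ℝ × RSpace d → ℝ, ∫ y, χ y * f y = ∫ y in K, χ y * f y := fun f =>
    (setIntegral_eq_integral_of_forall_compl_eq_zero fun y hy => by
      simp [image_eq_zero_of_notMem_tsupport hy]).symm
  have hW : ∫ z, φ z ∂β = W := by
    have h1 : ∫ z, φ z ∂β = ∫ z in overSet Ω, φ z ∂β :=
      (setIntegral_eq_integral_of_forall_compl_eq_zero fun z hz =>
        image_eq_zero_of_notMem_tsupport fun h => hz (hφΩ h)).symm
    rw [h1, hβ, integral_multiPhaseMeasure hΩ hb hS hφ hφc hφΩ hχΩ hφK]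
    refine Finset.sum_congr rfl fun j _ => ?_
    rw [hχK]
    refine setIntegral_congr_fun hK.measurableSet fun y hy => ?_
    simp only [φ, hκR _ (hR' j y hy)]
    ring
  -- the energy estimate
  have hψK := eventually_aestronglyMeasurable_restrict hψm hKT
  have hGK := eventually_aestronglyMeasurable_restrict hGm hKT
  have hAm : ∀ ε, AEStronglyMeasurable (ampSum b S ε) (volume.restrict K) := fun ε =>
    (ContinuousOn.ampSum hbK hSK ε).aestronglyMeasurable hK.measurableSet
  have hDm : ∀ ε, AEStronglyMeasurable (ampSum (gradAmp b S e) S ε) (volume.restrict K) := fun ε =>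
    (ContinuousOn.ampSum hgK hSK ε).aestronglyMeasurable hK.measurableSet
  have hhm : ∀ ε, AEStronglyMeasurable (fun y => (h ε y : ℂ)) (volume.restrict K) := fun ε =>
    (Complex.continuous_ofReal.comp_continuousOn
      ((hhc ε).mono hχΩ)).aestronglyMeasurable hK.measurableSet
  obtain ⟨C₁, hC₁⟩ := exists_eLpNorm_ampSum_le (μ := volume) S hK hbK
  obtain ⟨C₂, hC₂⟩ := exists_eLpNorm_ampSum_le (μ := volume) S hK hgK
  have hconv : Tendsto (fun ε : ℝ => eLpNorm (fun y : ℝ × RSpace d =>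
      ψ ε y.1 y.2 - ampSum b S ε y) 2 (volume.restrict K)) (𝓝[>] 0) (𝓝 0) := (hwkb K hK hχΩ).1
  have hgconv := hwkb.tendsto_dirComp hΩ hb hS hK hχΩ hGK e
  have hmul : ∀ ε (f : ℝ × RSpace d → ℂ), eLpNorm (fun y => h ε y * f y) 2 (volume.restrict K) ≤
      M.toNNReal * eLpNorm f 2 (volume.restrict K) := by
    intro ε f
    refine (eLpNorm_le_nnreal_smul_eLpNorm_of_ae_le_mul (c := M.toNNReal) ?_ 2).trans
      (le_of_eq rfl)
    refine (ae_restrict_iff' hK.measurableSet).2 (Eventually.of_forall fun y hy => ?_)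
    rw [nnnorm_mul]
    refine mul_le_mul_left ?_ _
    refine NNReal.coe_le_coe.1 (le_trans ?_ (Real.le_coe_toNNReal M))
    simpa using hhM ε y hy
  -- The same multiplier h is applied to the true wave function and to the leading superposition. As
  -- h is bounded on K uniformly in ε, the L² error still vanishes, and the gap passes from X' to X.
  let X : ℝ → ℝ × RSpace d → ℂ := fun ε y => ε * dirComp e (G ε y.1 y.2) - h ε y * ψ ε y.1 y.2
  let X' : ℝ → ℝ × RSpace d → ℂ := fun ε y =>
    ampSum (gradAmp b S e) S ε y - h ε y * ampSum b S ε y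
  have hXm : ∀ᶠ ε in 𝓝[>] (0 : ℝ), AEStronglyMeasurable (X ε) (volume.restrict K) := by
    filter_upwards [hψK, hGK] with ε h1 h2
    exact (((continuous_dirComp e).comp_aestronglyMeasurable h2).const_mul _).sub ((hhm ε).mul h1)
  have hX'm : ∀ ε, AEStronglyMeasurable (X' ε) (volume.restrict K) := fun ε =>
    (hDm ε).sub ((hhm ε).mul (hAm ε))
  have hX' : ∀ ε, eLpNorm (X' ε) 2 (volume.restrict K) ≤ (C₂ + M.toNNReal * C₁ : NNReal) := by
    intro ε
    refine (eLpNorm_sub_le (hDm ε) ((hhm ε).mul (hAm ε)) (by norm_num)).trans ?_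
    push_cast
    exact add_le_add (hC₂ ε) ((hmul ε _).trans (by gcongr; exact hC₁ ε))
  have hXX' : Tendsto (fun ε => eLpNorm (fun y => X ε y - X' ε y) 2 (volume.restrict K)) (𝓝[>] 0)
      (𝓝 0) := by
    have h2 := hgconv.add (ENNReal.Tendsto.const_mul (a := (M.toNNReal : ENNReal)) hconv
      (Or.inr ENNReal.coe_ne_top))
    rw [mul_zero, add_zero] at h2
    refine tendsto_of_tendsto_of_tendsto_of_le_of_le' tendsto_const_nhds h2
      (Eventually.of_forall fun i => zero_le) ?_
    filter_upwards [hψK, hGK] with ε h3 h4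
    have h5 : (fun y => X ε y - X' ε y) = (fun y : ℝ × RSpace d =>
        ε * dirComp e (G ε y.1 y.2) - ampSum (gradAmp b S e) S ε y) -
        fun y => h ε y * (ψ ε y.1 y.2 - ampSum b S ε y) := by
      ext y
      simp only [X, X', Pi.sub_apply]
      ring
    rw [h5]
    refine (eLpNorm_sub_le ((((continuous_dirComp e).comp_aestronglyMeasurable h4).const_mul
      _).sub (hDm ε)) ((hhm ε).mul (h3.sub (hAm ε))) (by norm_num)).trans (add_le_add le_rfl ?_)
    exact hmul ε fun y => ψ ε y.1 y.2 - ampSum b S ε y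
  obtain ⟨m, hm⟩ := hχ.bounded_above_of_compact_support hχc
  have hpert := tendsto_integral_mul_norm_sq_sub_zero (l := 𝓝[>] (0 : ℝ)) (M := m.toNNReal)
    (w := χ) (μ := volume.restrict K) hχ.aestronglyMeasurable
    (Eventually.of_forall fun y => (hm y).trans (Real.le_coe_toNNReal m)) hXm
    (Eventually.of_forall hX'm) hXX' (Eventually.of_forall hX')
  have hle : ∀ᶠ ε in 𝓝[>] (0 : ℝ),
      ∫ z, φ z ∂(bohmianMeasureSlab T ε (ψ ε) (G ε)) ≤ W - γ / 2 := by
    filter_upwards [hgap, hpert.eventually_lt_const (half_pos hγ), hXm, hψK, hGK,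
      hXX'.eventually_lt_const one_pos, Ioc_mem_nhdsGT one_pos] with ε h1 h2 h3 h4 h5 h6 h7
    have LX : MemLp (X ε) 2 (volume.restrict K) := by
      have e1 : MemLp (fun y => X ε y - X' ε y) 2 (volume.restrict K) :=
        ⟨h3.sub (hX'm ε), h6.trans ENNReal.one_lt_top⟩
      have e2 : MemLp (X' ε) 2 (volume.restrict K) :=
        ⟨hX'm ε, (hX' ε).trans_lt ENNReal.coe_lt_top⟩
      simpa [Pi.add_def] using e1.add e2
    have IX : Integrable (fun y => χ y * ‖X ε y‖ ^ 2) (volume.restrict K) :=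
      LX.integrable_norm_sq'.bdd_mul hχ.aestronglyMeasurable (Eventually.of_forall hm)
    -- The inequality ρ(u·e)² ≤ |ε e·∇ψ - hψ|² is used pointwise with h = h ε y, together with κ ≤
    -- 1.
    have e3 : ∫ z, φ z ∂(bohmianMeasureSlab T ε (ψ ε) (G ε)) ≤ ∫ y in K, χ y * ‖X ε y‖ ^ 2 := by
      rw [integral_bohmianMeasureSlab_eq_setIntegral (hψm ε h7) (hGm ε h7) hφ hKT hφK]
      refine integral_mono_of_nonneg (Eventually.of_forall fun y => ?_) IX
        (Eventually.of_forall fun y => ?_)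
      · exact mul_nonneg (by positivity) (mul_nonneg (hχ0 _)
          (mul_nonneg (sq_nonneg _) (hκ1 _).1))
      · have e4 := norm_sq_mul_inner_velocityOf_sq_le ε (ψ ε y.1 y.2) (G ε y.1 y.2) e (h ε y)
        have e5 := hκ1 (velocityOf ε (ψ ε y.1 y.2) (G ε y.1 y.2))
        have e6 := hχ0 y
        simp only [φ]
        calc ‖ψ ε y.1 y.2‖ ^ 2 * (χ y * ((inner ℝ (velocityOf ε (ψ ε y.1 y.2) (G ε y.1 y.2)) e) ^ 2 *
              κ (velocityOf ε (ψ ε y.1 y.2) (G ε y.1 y.2))))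
            = (χ y * (‖ψ ε y.1 y.2‖ ^ 2 *
              (inner ℝ (velocityOf ε (ψ ε y.1 y.2) (G ε y.1 y.2)) e) ^ 2)) *
                κ (velocityOf ε (ψ ε y.1 y.2) (G ε y.1 y.2)) := by ring
          _ ≤ (χ y * (‖ψ ε y.1 y.2‖ ^ 2 *
              (inner ℝ (velocityOf ε (ψ ε y.1 y.2) (G ε y.1 y.2)) e) ^ 2)) * 1 := by
              gcongr
              exact e5.2
          _ ≤ χ y * ‖X ε y‖ ^ 2 := by
              rw [mul_one]
              gcongr
    rw [hχK] at h1
    simp only [X'] at h2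
    linarith
  -- The eventual bound survives along any nontrivial filter finer than ε → 0+, while equality with
  -- w would make the limit W itself.
  have := le_of_tendsto (hlim φ hφ hφc hφΩ) (hl hle)
  rw [hW] at this
  linarith

/-- Limiting Bohmian measures of a single phase coincide with the mono-kinetic measure. -/
theorem restrict_eq_multiPhaseMeasure_single {b : Fin 1 → ℝ × RSpace d → ℂ}
    {S : Fin 1 → ℝ × RSpace d → ℝ} (hΩ : IsOpen Ω) (hΩT : Ω ⊆ Icc 0 T ×ˢ univ)
    (hb : ∀ j, ContDiffOn ℝ ∞ (b j) Ω) (hS : ∀ j, ContDiffOn ℝ ∞ (S j) Ω)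
    (hψm : ∀ ε ∈ Ioc (0 : ℝ) 1, AEStronglyMeasurable (fun y : ℝ × RSpace d => ψ ε y.1 y.2)
      (volume.restrict (Icc 0 T ×ˢ univ)))
    (hGm : ∀ ε ∈ Ioc (0 : ℝ) 1, AEStronglyMeasurable (fun y : ℝ × RSpace d => G ε y.1 y.2)
      (volume.restrict (Icc 0 T ×ˢ univ)))
    (hwkb : HasWKBForm Ω b S ψ G) {l : Filter ℝ} [l.NeBot] (hl : l ≤ 𝓝[>] 0)
    {β : Measure (ℝ × RSpace d × RSpace d)} (hβ : LocallyFiniteOver Ω β)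
    (hlim : ∀ φ : ℝ × RSpace d × RSpace d → ℝ, Continuous φ → HasCompactSupport φ →
      tsupport φ ⊆ overSet Ω → Tendsto (fun ε => ∫ z, φ z ∂(bohmianMeasureSlab T ε (ψ ε) (G ε)))
        l (𝓝 (∫ z, φ z ∂β))) :
    β.restrict (overSet Ω) = multiPhaseMeasure Ω b S := by
  -- The measure w has no mass outside Ω, so equality can be tested after restricting both sides.
  have hw : (multiPhaseMeasure Ω b S).restrict (overSet Ω) = multiPhaseMeasure Ω b S := by
    refine Measure.restrict_eq_self_of_ae_mem ?_
    rw [ae_iff, multiPhaseMeasure, Measure.finsetSum_apply]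
    refine Finset.sum_eq_zero fun j _ => ?_
    have hq : AEMeasurable (fun y : ℝ × RSpace d => (y.1, y.2, spaceGrad (S j) y.1 y.2))
        ((volume.restrict Ω).withDensity fun y => ENNReal.ofReal (‖b j y‖ ^ 2)) :=
      ((continuousOn_graph hΩ (hS j)).aemeasurable hΩ.measurableSet).mono_ac
        (withDensity_absolutelyContinuous _ _)
    have hmeas : MeasurableSet {z : ℝ × RSpace d × RSpace d | z ∉ overSet Ω} :=
      (isOpen_overSet hΩ).measurableSet.compl
    rw [Measure.map_apply_of_aemeasurable hq hmeas]
    refine withDensity_absolutelyContinuous _ _ ?_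
    have : (fun y : ℝ × RSpace d => (y.1, y.2, spaceGrad (S j) y.1 y.2)) ⁻¹'
        {z | z ∉ overSet Ω} = Ωᶜ := rfl
    rw [this, Measure.restrict_apply hΩ.measurableSet.compl]
    simp
  rw [← hw]
  refine restrict_eq_of_forall_integral_eq (isOpen_overSet hΩ) hβ
    (locallyFiniteOver_multiPhaseMeasure hΩ hb hS) fun φ hφ hφc hφΩ => ?_
  exact tendsto_nhds_unique (hlim φ hφ hφc hφΩ)
    ((tendsto_integral_bohmianMeasureSlab_single hΩ hΩT hb hS hψm hGm hwkb hφ hφc hφΩ).mono_left hl)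

end Comparison

/-! ### The Fourier transform of test functions in momentum. -/

section MomentumTransform

open FourierTransform

variable {d : ℕ}

/-- The Fourier transform of a function on phase space-time in the momentum variable. -/
def momentumTransform (φ : ℝ × RSpace d × RSpace d → ℝ) (y : ℝ × RSpace d) (η : RSpace d) : ℂ :=
  ∫ p, (φ (y.1, y.2, p) : ℂ) * Complex.exp (Complex.I * ((inner ℝ η p : ℝ) : ℂ))

/-- The argument -η/(2π) converts the kernel e^{iη·p} to Mathlib's e^{-2πi⟨p,·⟩}, giving access to
its decay estimates and inversion formula. -/
theorem momentumTransform_eq_fourier (φ : ℝ × RSpace d × RSpace d → ℝ) (y : ℝ × RSpace d)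
    (η : RSpace d) : momentumTransform φ y η =
      𝓕 (fun p => (φ (y.1, y.2, p) : ℂ)) ((-(2 * Real.pi)⁻¹ : ℝ) • η) := by
  rw [momentumTransform, Real.fourier_eq']
  refine integral_congr_ae (Eventually.of_forall fun p => ?_)
  have h : -2 * Real.pi * inner ℝ p ((-(2 * Real.pi)⁻¹ : ℝ) • η) = inner ℝ η p := by
    rw [real_inner_smul_right, real_inner_comm]
    field_simp
  simp only [h, smul_eq_mul]
  rw [mul_comm, mul_comm Complex.I]

theorem momentumTransform_eq_zero {φ : ℝ × RSpace d × RSpace d → ℝ} {y : ℝ × RSpace d}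
    (hy : y ∉ baseProj '' tsupport φ) (η : RSpace d) : momentumTransform φ y η = 0 := by
  rw [momentumTransform]
  refine integral_eq_zero_of_ae (Eventually.of_forall fun p => ?_)
  have : φ (y.1, y.2, p) = 0 := image_eq_zero_of_notMem_tsupport fun h => hy ⟨_, h, rfl⟩
  simp [this]

theorem contDiff_slice {φ : ℝ × RSpace d × RSpace d → ℝ} (hφ : ContDiff ℝ ∞ φ) (y : ℝ × RSpace d) :
    ContDiff ℝ ∞ fun p => (φ (y.1, y.2, p) : ℂ) :=
  Complex.ofRealCLM.contDiff.comp (hφ.comp (by fun_prop))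

theorem hasCompactSupport_slice {φ : ℝ × RSpace d × RSpace d → ℝ} (hφc : HasCompactSupport φ)
    (y : ℝ × RSpace d) : HasCompactSupport fun p => (φ (y.1, y.2, p) : ℂ) := by
  refine HasCompactSupport.intro (K := (fun z : ℝ × RSpace d × RSpace d => z.2.2) '' tsupport φ)
    (IsCompact.image hφc (by fun_prop)) fun p hp => ?_
  have : φ (y.1, y.2, p) = 0 := image_eq_zero_of_notMem_tsupport fun h => hp ⟨_, h, rfl⟩
  simp [this]

/-- A slice is φ composed with an affine embedding whose linear part L does not depend on y. Its
derivatives are thus bounded by M‖L‖ⁿ and vanish outside a fixed compact set Q of momenta, whence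
the uniformity in y. -/
theorem exists_integral_norm_iteratedFDeriv_slice_le {φ : ℝ × RSpace d × RSpace d → ℝ}
    (hφ : ContDiff ℝ ∞ φ) (hφc : HasCompactSupport φ) (n : ℕ) :
    ∃ C, ∀ y : ℝ × RSpace d,
      ∫ p, ‖iteratedFDeriv ℝ n (fun p => (φ (y.1, y.2, p) : ℂ)) p‖ ≤ C := by
  let f : ℝ × RSpace d × RSpace d → ℂ := fun z => φ z
  have hf : ContDiff ℝ ∞ f := Complex.ofRealCLM.contDiff.comp hφ
  have hfc : HasCompactSupport f := hφc.comp_left Complex.ofReal_zero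
  obtain ⟨M, hM⟩ := (hfc.iteratedFDeriv (𝕜 := ℝ) n).exists_bound_of_continuous
    (hf.continuous_iteratedFDeriv (m := n) (by exact_mod_cast le_top))
  let L : RSpace d →L[ℝ] ℝ × RSpace d × RSpace d :=
    (ContinuousLinearMap.inr ℝ ℝ (RSpace d × RSpace d)).comp
      (ContinuousLinearMap.inr ℝ (RSpace d) (RSpace d))
  let Q : Set (RSpace d) := (fun z : ℝ × RSpace d × RSpace d => z.2.2) '' tsupport f
  have hQ : IsCompact Q := hfc.isCompact.image (by fun_prop)
  have hM0 : 0 ≤ M := (norm_nonneg _).trans (hM 0)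
  refine ⟨∫ p, Q.indicator (fun _ => M * ‖L‖ ^ n) p, fun y => ?_⟩
  refine integral_mono_of_nonneg (Eventually.of_forall fun p => norm_nonneg _) ?_
    (Eventually.of_forall fun p => ?_)
  · exact (integrable_indicator_iff hQ.measurableSet).2 (integrableOn_const hQ.measure_lt_top.ne)
  · let c : ℝ × RSpace d × RSpace d := (y.1, y.2, 0)
    have h1 : (fun p => (φ (y.1, y.2, p) : ℂ)) = (fun z => f (c + z)) ∘ L := by
      ext p; simp [f, c, L]
    have h2 : iteratedFDeriv ℝ n (fun p => (φ (y.1, y.2, p) : ℂ)) p =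
        (iteratedFDeriv ℝ n f (c + L p)).compContinuousLinearMap fun _ => L := by
      have hg : ContDiff ℝ ∞ fun z => f (c + z) := hf.comp (by fun_prop)
      rw [h1, L.iteratedFDeriv_comp_right hg p (i := n) (by exact_mod_cast le_top),
        iteratedFDeriv_comp_add_left]
    simp only [h2]
    by_cases hp : p ∈ Q
    · rw [indicator_of_mem hp]
      refine (ContinuousMultilinearMap.norm_compContinuousLinearMap_le _ _).trans ?_
      simp only [Finset.prod_const, Finset.card_univ, Fintype.card_fin]
      gcongr
      exact hM _
    · have h3 : c + L p ∉ tsupport f := fun h => hp ⟨_, h, by simp [c, L]⟩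
      have h4 : iteratedFDeriv ℝ n f (c + L p) = 0 :=
        Function.notMem_support.1 fun h => h3 (support_iteratedFDeriv_subset n h)
      rw [indicator_of_notMem hp]
      refine (ContinuousMultilinearMap.norm_compContinuousLinearMap_le _ _).trans (le_of_eq ?_)
      rw [h4, norm_zero, zero_mul]

/-- The transform of a test function decays rapidly, uniformly in space-time. -/
theorem exists_norm_momentumTransform_le {φ : ℝ × RSpace d × RSpace d → ℝ} (hφ : ContDiff ℝ ∞ φ)
    (hφc : HasCompactSupport φ) :
    ∃ g : RSpace d → ℝ, Integrable g ∧ (∀ η, 0 ≤ g η) ∧ ∀ y η, ‖momentumTransform φ y η‖ ≤ g η := by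
  choose c hc using exists_integral_norm_iteratedFDeriv_slice_le hφ hφc
  have hpow : ∀ n : ℕ, ∃ B, ∀ (y : ℝ × RSpace d) (η : RSpace d),
      ‖η‖ ^ n * ‖momentumTransform φ y η‖ ≤ B := by
    intro n
    refine ⟨(2 * Real.pi) ^ n * (2 ^ n * ∑ p ∈ Finset.range 1 ×ˢ Finset.range (n + 1), c p.2),
      fun y η => ?_⟩
    have hcs := hasCompactSupport_slice hφc y
    have hsm := contDiff_slice hφ y
    have h := Real.pow_mul_norm_iteratedFDeriv_fourier_le (K := ⊤) (N := ⊤)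
      (f := fun p => (φ (y.1, y.2, p) : ℂ)) hsm (fun k m _ _ => by
        refine Continuous.integrable_of_hasCompactSupport ?_ ?_
        · exact (continuous_norm.pow k).mul (hsm.continuous_iteratedFDeriv (m := m)
            (by exact_mod_cast le_top)).norm
        · exact (hcs.iteratedFDeriv (𝕜 := ℝ) m).norm.mul_left) (k := 0) (n := n) le_top le_top
      ((-(2 * Real.pi)⁻¹ : ℝ) • η)
    rw [norm_iteratedFDeriv_zero, ← momentumTransform_eq_fourier, norm_smul, mul_pow] at h
    have h2 : ‖(-(2 * Real.pi)⁻¹ : ℝ)‖ ^ n = ((2 * Real.pi) ^ n)⁻¹ := by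
      rw [norm_neg, norm_inv, inv_pow, Real.norm_of_nonneg (by positivity)]
    rw [h2] at h
    have h3 : (2 * Real.pi) ^ 0 * (2 * ((0 : ℕ) : ℝ) + 2) ^ n *
        ∑ p ∈ Finset.range (0 + 1) ×ˢ Finset.range (n + 1),
          ∫ v : RSpace d, ‖v‖ ^ p.1 * ‖iteratedFDeriv ℝ p.2 (fun p => (φ (y.1, y.2, p) : ℂ)) v‖ ≤
        2 ^ n * ∑ p ∈ Finset.range 1 ×ˢ Finset.range (n + 1), c p.2 := by
      simp only [pow_zero, one_mul, Nat.cast_zero, mul_zero, zero_add]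
      gcongr with p hp
      have : p.1 = 0 := by
        simpa using (Finset.mem_product.1 hp).1
      simp only [this, pow_zero, one_mul]
      exact hc _ y
    have hpi : (0 : ℝ) < (2 * Real.pi) ^ n := by positivity
    have h4 := mul_le_mul_of_nonneg_left (h.trans h3) hpi.le
    refine le_trans (le_of_eq ?_) h4
    field_simp
  obtain ⟨B₀, hB₀⟩ := hpow 0
  -- Decay of order d + 1 suffices, since (1 + |η|)^{-(d+1)} is integrable in dimension d.
  obtain ⟨B₁, hB₁⟩ := hpow (d + 1)
  have hpos : 0 ≤ B₀ + B₁ := add_nonneg ((by positivity : (0 : ℝ) ≤ _).trans (hB₀ 0 0))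
    ((by positivity : (0 : ℝ) ≤ _).trans (hB₁ 0 0))
  refine ⟨fun η => 2 ^ d * (B₀ + B₁) * (1 + ‖η‖) ^ (-((d + 1 : ℕ) : ℝ)), ?_, fun η => ?_, fun y η => ?_⟩
  · refine (integrable_one_add_norm ?_).const_mul _
    simp
  · positivity
  · have h1 : (0 : ℝ) < 1 + ‖η‖ := by positivity
    beta_reduce
    rw [Real.rpow_neg h1.le, Real.rpow_natCast, ← div_eq_mul_inv, le_div_iff₀ (by positivity)]
    -- Convexity gives (1 + r)^{d+1} ≤ 2^d (1 + r^{d+1}), the origin of the factor 2^d in the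
    -- majorant.
    have h2 := add_pow_le (zero_le_one' ℝ) (norm_nonneg η) (d + 1)
    simp only [one_pow, Nat.add_sub_cancel] at h2
    have h3 := hB₀ y η
    have h4 := hB₁ y η
    rw [pow_zero, one_mul] at h3
    calc ‖momentumTransform φ y η‖ * (1 + ‖η‖) ^ (d + 1)
        ≤ ‖momentumTransform φ y η‖ * (2 ^ d * (1 + ‖η‖ ^ (d + 1))) := by gcongr
      _ = 2 ^ d * (‖momentumTransform φ y η‖ + ‖η‖ ^ (d + 1) * ‖momentumTransform φ y η‖) := by ring
      _ ≤ 2 ^ d * (B₀ + B₁) := by gcongr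

/-- The momentum integral runs over a fixed compact set, where parametric integrals of continuous
functions are continuous. -/
theorem continuous_momentumTransform {φ : ℝ × RSpace d × RSpace d → ℝ} (hφ : Continuous φ)
    (hφc : HasCompactSupport φ) :
    Continuous fun z : (ℝ × RSpace d) × RSpace d => momentumTransform φ z.1 z.2 := by
  let Q : Set (RSpace d) := (fun z : ℝ × RSpace d × RSpace d => z.2.2) '' tsupport φ
  have hQ : IsCompact Q := hφc.isCompact.image (by fun_prop)
  have h : ∀ z : (ℝ × RSpace d) × RSpace d, momentumTransform φ z.1 z.2 =
      ∫ p in Q, (φ (z.1.1, z.1.2, p) : ℂ) * Complex.exp (Complex.I * ((inner ℝ z.2 p : ℝ) : ℂ)) := by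
    intro z
    refine (setIntegral_eq_integral_of_forall_compl_eq_zero fun p hp => ?_).symm
    have : φ (z.1.1, z.1.2, p) = 0 := image_eq_zero_of_notMem_tsupport fun h => hp ⟨_, h, rfl⟩
    simp [this]
  simp_rw [h]
  refine continuous_parametric_integral_of_continuous (f := fun (z : (ℝ × RSpace d) × RSpace d) p =>
    (φ (z.1.1, z.1.2, p) : ℂ) * Complex.exp (Complex.I * ((inner ℝ z.2 p : ℝ) : ℂ))) ?_ hQ
  simp only [Function.uncurry_def]
  fun_prop

/-- Fourier inversion in the momentum variable. -/
theorem integral_exp_mul_momentumTransform {φ : ℝ × RSpace d × RSpace d → ℝ} (hφ : ContDiff ℝ ∞ φ)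
    (hφc : HasCompactSupport φ) (y : ℝ × RSpace d) (q : RSpace d) :
    ∫ η, Complex.exp (-(Complex.I * ((inner ℝ η q : ℝ) : ℂ))) * momentumTransform φ y η =
      (2 * Real.pi : ℝ) ^ d * φ (y.1, y.2, q) := by
  let f : SchwartzMap (RSpace d) ℂ :=
    (hasCompactSupport_slice hφc y).toSchwartzMap (contDiff_slice hφ y)
  have hf : ⇑f = fun p => (φ (y.1, y.2, p) : ℂ) := rfl
  have hinv : 𝓕⁻ (𝓕 ⇑f) q = f q :=
    f.integrable.fourierInv_fourier_eq (by
      rw [← SchwartzMap.fourier_coe]; exact (𝓕 f).integrable) f.continuous.continuousAt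
  let H : RSpace d → ℂ := fun w =>
    Complex.exp (((2 * Real.pi * inner ℝ w q : ℝ) : ℂ) * Complex.I) • 𝓕 ⇑f w
  have h1 : ∀ η : RSpace d, Complex.exp (-(Complex.I * ((inner ℝ η q : ℝ) : ℂ))) *
      momentumTransform φ y η = H ((-(2 * Real.pi)⁻¹ : ℝ) • η) := by
    intro η
    simp only [H, momentumTransform_eq_fourier, hf, smul_eq_mul]
    congr 2
    have : 2 * Real.pi * inner ℝ ((-(2 * Real.pi)⁻¹ : ℝ) • η) q = - inner ℝ η q := by
      rw [real_inner_smul_left]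
      field_simp
    rw [this]
    push_cast
    ring
  simp_rw [h1]
  -- The factor (2π)^d is the Jacobian of the substitution η ↦ -η/(2π).
  rw [Measure.integral_comp_smul, ← Real.fourierInv_eq', hinv, hf, finrank_euclideanSpace_fin]
  have h2 : |((-(2 * Real.pi)⁻¹ : ℝ) ^ d)⁻¹| = (2 * Real.pi) ^ d := by
    rw [abs_inv, abs_pow, abs_neg, abs_inv, inv_pow, inv_inv, abs_of_pos (by positivity)]
  rw [h2, Complex.real_smul]
  push_cast
  ring

end MomentumTransform

/-! ### WKB states translated at scale ε. -/

section Translation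

variable {d N : ℕ} {Ω : Set (ℝ × RSpace d)} {b : Fin N → ℝ × RSpace d → ℂ}
  {S : Fin N → ℝ × RSpace d → ℝ}

/-- Pointwise convergence of uniformly bounded functions on a set of finite measure implies
convergence in `L²`. -/
theorem tendsto_eLpNorm_two_of_bounded {α ι : Type*} [MeasurableSpace α] {μ : Measure α}
    [IsFiniteMeasure μ] {l : Filter ι} [l.IsCountablyGenerated] {f : ι → α → ℂ} {M : NNReal}
    (hm : ∀ᶠ i in l, AEStronglyMeasurable (f i) μ) (hM : ∀ᶠ i in l, ∀ᵐ y ∂μ, ‖f i y‖ₑ ≤ M)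
    (hf : ∀ᵐ y ∂μ, Tendsto (fun i => f i y) l (𝓝 0)) :
    Tendsto (fun i => eLpNorm (f i) 2 μ) l (𝓝 0) := by
  have h1 : Tendsto (fun i => ∫⁻ y, ‖f i y‖ₑ ^ (2 : ℝ) ∂μ) l (𝓝 (∫⁻ _, 0 ∂μ)) := by
    refine tendsto_lintegral_filter_of_dominated_convergence' (fun _ => (M : ENNReal) ^ (2 : ℝ))
      ?_ ?_ ?_ ?_
    · filter_upwards [hm] with i hi
      exact hi.enorm.pow_const _
    · filter_upwards [hM] with i hi
      filter_upwards [hi] with y hy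
      gcongr
    · rw [lintegral_const]
      exact ENNReal.mul_ne_top (ENNReal.rpow_ne_top_of_nonneg (by norm_num) ENNReal.coe_ne_top)
        (measure_ne_top _ _)
    · filter_upwards [hf] with y hy
      have h2 : Tendsto (fun i => ‖f i y‖ₑ ^ (2 : ℝ)) l (𝓝 (‖(0 : ℂ)‖ₑ ^ (2 : ℝ))) :=
        (ENNReal.continuous_rpow_const.tendsto _).comp ((continuous_enorm.tendsto _).comp hy)
      simpa using h2
  rw [lintegral_zero] at h1
  have h3 := ((ENNReal.continuous_rpow_const (y := 1 / 2)).tendsto _).comp h1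
  rw [ENNReal.zero_rpow_of_pos (by norm_num)] at h3
  refine h3.congr fun i => ?_
  rw [eLpNorm_eq_lintegral_rpow_enorm_toReal (by norm_num) (by norm_num)]
  simp

theorem eventually_add_smul_mem_cthickening (K : Set (ℝ × RSpace d)) {δ : ℝ} (hδ : 0 < δ)
    (ξ : RSpace d) :
    ∀ᶠ ε : ℝ in 𝓝[>] 0, ∀ y ∈ K, y + ((0 : ℝ), ε • ξ) ∈ Metric.cthickening δ K := by
  have h1 : Tendsto (fun ε : ℝ => ‖ε • ξ‖) (𝓝[>] 0) (𝓝 0) := by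
    have : Tendsto (fun ε : ℝ => ‖ε • ξ‖) (𝓝 0) (𝓝 ‖(0 : ℝ) • ξ‖) :=
      (by fun_prop : Continuous fun ε : ℝ => ‖ε • ξ‖).tendsto 0
    rw [zero_smul, norm_zero] at this
    exact this.mono_left nhdsWithin_le_nhds
  filter_upwards [h1.eventually_lt_const hδ] with ε hε y hy
  refine Metric.mem_cthickening_of_dist_le _ y _ _ hy ?_
  rw [dist_eq_norm, add_sub_cancel_left, Prod.norm_def]
  simpa using hε.le

/-- A single phase, translated at scale `ε`, is to leading order a phase with the same
oscillations. -/
theorem tendsto_eLpNorm_amp_translate {b : ℝ × RSpace d → ℂ} {S : ℝ × RSpace d → ℝ}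
    (hΩ : IsOpen Ω) (hb : ContinuousOn b Ω) (hS : ContDiffOn ℝ ∞ S Ω) {K : Set (ℝ × RSpace d)}
    (hK : IsCompact K) (hKΩ : K ⊆ Ω) (ξ : RSpace d) :
    Tendsto (fun ε : ℝ => eLpNorm (fun y =>
      b (y + (0, ε • ξ)) * oscExp S ε (y + (0, ε • ξ)) -
        b y * Complex.exp (Complex.I * ((inner ℝ (spaceGrad S y.1 y.2) ξ : ℝ) : ℂ)) *
          oscExp S ε y) 2 (volume.restrict K)) (𝓝[>] 0) (𝓝 0) := by
  obtain ⟨δ, hδ, hδΩ⟩ := hK.exists_cthickening_subset_open hΩ hKΩ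
  have hK' : IsCompact (Metric.cthickening δ K) := hK.cthickening
  have hshift : ∀ᶠ ε : ℝ in 𝓝[>] 0, ∀ y ∈ K, y + ((0 : ℝ), ε • ξ) ∈ Metric.cthickening δ K :=
    eventually_add_smul_mem_cthickening K hδ ξ
  obtain ⟨M, hM⟩ := hK'.exists_bound_of_continuousOn (hb.mono hδΩ)
  have hKK' : K ⊆ Metric.cthickening δ K := Metric.self_subset_cthickening K
  have : IsFiniteMeasure (volume.restrict K) := isFiniteMeasure_restrict.2 hK.measure_lt_top.ne
  have hexpn : ∀ r : ℝ, ‖Complex.exp (Complex.I * (r : ℂ))‖ = 1 := fun r => by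
    rw [mul_comm]; exact Complex.norm_exp_ofReal_mul_I r
  refine tendsto_eLpNorm_two_of_bounded (M := (2 * M).toNNReal) ?_ ?_ ?_
  · filter_upwards [hshift] with ε hε
    refine ContinuousOn.aestronglyMeasurable ?_ hK.measurableSet
    have h1 : ContinuousOn (fun y : ℝ × RSpace d => y + ((0 : ℝ), ε • ξ)) K := by fun_prop
    have h2 : MapsTo (fun y : ℝ × RSpace d => y + ((0 : ℝ), ε • ξ)) K Ω :=
      fun y hy => hδΩ (hε y hy)
    have h3 : ContinuousOn (oscExp S ε) Ω := hS.continuousOn.oscExp ε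
    refine ((hb.comp h1 h2).mul (h3.comp h1 h2)).sub (((hb.mono hKΩ).mul ?_).mul (h3.mono hKΩ))
    exact (continuousOn_const.mul (Complex.continuous_ofReal.comp_continuousOn
      ((continuousOn_inner_spaceGrad hΩ hS ξ).mono hKΩ))).cexp
  · filter_upwards [hshift] with ε hε
    refine (ae_restrict_iff' hK.measurableSet).2 (Eventually.of_forall fun y hy => ?_)
    rw [← ofReal_norm]
    refine ENNReal.ofReal_le_ofReal ((norm_sub_le _ _).trans ?_)
    rw [norm_mul, norm_mul, norm_mul, norm_oscExp, norm_oscExp, hexpn, mul_one, mul_one, mul_one]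
    linarith [hM _ (hε y hy), hM _ (hKK' hy)]
  · refine (ae_restrict_iff' hK.measurableSet).2 (Eventually.of_forall fun y hy => ?_)
    have hyΩ := hKΩ hy
    have hd : DifferentiableAt ℝ S y :=
      (hS.contDiffAt (hΩ.mem_nhds hyΩ)).differentiableAt (by simp)
    -- The phase increment divided by ε is a difference quotient in the direction (0, ξ) and tends
    -- to ξ·∇S.
    have h1 : Tendsto (fun ε : ℝ => ε⁻¹ • (S (y + ε • ((0 : ℝ), ξ)) - S y)) (𝓝[>] 0)
        (𝓝 (inner ℝ (spaceGrad S y.1 y.2) ξ)) := by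
      rw [inner_spaceGrad hd]
      exact (hd.hasFDerivAt.hasLineDerivAt ((0 : ℝ), ξ)).tendsto_slope_zero_right
    have h2 : Tendsto (fun ε : ℝ => y + ((0 : ℝ), ε • ξ)) (𝓝[>] 0) (𝓝 y) := by
      have : Tendsto (fun ε : ℝ => y + ((0 : ℝ), ε • ξ)) (𝓝 0) (𝓝 (y + ((0 : ℝ), (0 : ℝ) • ξ))) :=
        (by fun_prop : Continuous fun ε : ℝ => y + ((0 : ℝ), ε • ξ)).tendsto 0
      rw [zero_smul, ← Prod.zero_eq_mk, add_zero] at this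
      exact this.mono_left nhdsWithin_le_nhds
    have h3 : Tendsto (fun ε : ℝ => b (y + ((0 : ℝ), ε • ξ)) *
        Complex.exp (Complex.I * ((ε⁻¹ • (S (y + ε • ((0 : ℝ), ξ)) - S y) : ℝ) : ℂ)) -
        b y * Complex.exp (Complex.I * ((inner ℝ (spaceGrad S y.1 y.2) ξ : ℝ) : ℂ))) (𝓝[>] 0)
        (𝓝 (b y * Complex.exp (Complex.I * ((inner ℝ (spaceGrad S y.1 y.2) ξ : ℝ) : ℂ)) -
        b y * Complex.exp (Complex.I * ((inner ℝ (spaceGrad S y.1 y.2) ξ : ℝ) : ℂ)))) := by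
      refine Tendsto.sub_const (((hb.continuousAt (hΩ.mem_nhds hyΩ)).tendsto.comp h2).mul ?_) _
      have : Continuous fun r : ℝ => Complex.exp (Complex.I * (r : ℂ)) := by fun_prop
      exact (this.tendsto _).comp h1
    rw [sub_self] at h3
    rw [tendsto_zero_iff_norm_tendsto_zero] at h3 ⊢
    refine h3.congr fun ε => ?_
    -- The unimodular factor e^{iS(y)/ε}, which has no limit, is split off; the remaining factor
    -- converges pointwise.
    have h4 : oscExp S ε (y + (0, ε • ξ)) =
        Complex.exp (Complex.I * ((ε⁻¹ • (S (y + ε • ((0 : ℝ), ξ)) - S y) : ℝ) : ℂ)) *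
          oscExp S ε y := by
      rw [oscExp, oscExp, ← Complex.exp_add]
      congr 1
      have : y + ((0 : ℝ), ε • ξ) = y + ε • ((0 : ℝ), ξ) := by simp
      rw [this, smul_eq_mul]
      push_cast
      ring
    rw [h4, ← mul_assoc, ← sub_mul, norm_mul, norm_oscExp, mul_one]

/-- The amplitudes `b_j e^{i ξ · ∇S_j}`. -/
def shiftAmp (b : Fin N → ℝ × RSpace d → ℂ) (S : Fin N → ℝ × RSpace d → ℝ) (ξ : RSpace d)
    (j : Fin N) (y : ℝ × RSpace d) : ℂ :=
  b j y * Complex.exp (Complex.I * ((inner ℝ (spaceGrad (S j) y.1 y.2) ξ : ℝ) : ℂ))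

theorem continuousOn_shiftAmp (hΩ : IsOpen Ω) (hb : ∀ j, ContDiffOn ℝ ∞ (b j) Ω)
    (hS : ∀ j, ContDiffOn ℝ ∞ (S j) Ω) (ξ : RSpace d) (j : Fin N) :
    ContinuousOn (shiftAmp b S ξ j) Ω :=
  (hb j).continuousOn.mul ((continuousOn_const.mul (Complex.continuous_ofReal.comp_continuousOn
    (continuousOn_inner_spaceGrad hΩ (hS j) ξ))).cexp)

variable {ψ : ℝ → ℝ → RSpace d → ℂ} {G : ℝ → ℝ → RSpace d → EuclideanSpace ℂ (Fin d)}

/-- Wave functions of WKB form, translated at scale `ε`. -/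
theorem HasWKBForm.tendsto_translate (h : HasWKBForm Ω b S ψ G) (hΩ : IsOpen Ω)
    (hb : ∀ j, ContDiffOn ℝ ∞ (b j) Ω) (hS : ∀ j, ContDiffOn ℝ ∞ (S j) Ω)
    (hψm : ∀ K : Set (ℝ × RSpace d), IsCompact K → K ⊆ Ω → ∀ᶠ ε in 𝓝[>] (0 : ℝ),
      AEStronglyMeasurable (fun y : ℝ × RSpace d => ψ ε y.1 y.2) (volume.restrict K))
    {K : Set (ℝ × RSpace d)} (hK : IsCompact K) (hKΩ : K ⊆ Ω) (ξ : RSpace d) :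
    (∀ᶠ ε in 𝓝[>] (0 : ℝ), AEStronglyMeasurable
      (fun y : ℝ × RSpace d => ψ ε y.1 (y.2 + ε • ξ)) (volume.restrict K)) ∧
    Tendsto (fun ε : ℝ => eLpNorm (fun y : ℝ × RSpace d =>
      ψ ε y.1 (y.2 + ε • ξ) - ampSum (shiftAmp b S ξ) S ε y) 2 (volume.restrict K))
      (𝓝[>] 0) (𝓝 0) := by
  obtain ⟨δ, hδ, hδΩ⟩ := hK.exists_cthickening_subset_open hΩ hKΩ
  let K' := Metric.cthickening δ K
  have hK' : IsCompact K' := hK.cthickening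
  have hshift : ∀ᶠ ε : ℝ in 𝓝[>] 0, ∀ y ∈ K, y + ((0 : ℝ), ε • ξ) ∈ K' :=
    eventually_add_smul_mem_cthickening K hδ ξ
  -- Translation preserves volume, so the translated remainder on K is bounded by the remainder on
  -- the compact neighbourhood K'.
  have hpres : ∀ w : ℝ × RSpace d, MeasurePreserving (fun y => y + w)
      (volume.restrict ((fun y => y + w) ⁻¹' K')) (volume.restrict K') := fun w =>
    (measurePreserving_add_right volume w).restrict_preimage hK'.measurableSet
  have hle : ∀ w : ℝ × RSpace d, (∀ y ∈ K, y + w ∈ K') →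
      volume.restrict K ≤ volume.restrict ((fun y => y + w) ⁻¹' K') := fun w hw =>
    Measure.restrict_mono (fun y hy => hw y hy) le_rfl
  have hmeas : ∀ᶠ ε in 𝓝[>] (0 : ℝ), AEStronglyMeasurable
      (fun y : ℝ × RSpace d => ψ ε y.1 (y.2 + ε • ξ)) (volume.restrict K) := by
    filter_upwards [hψm K' hK' hδΩ, hshift] with ε h1 h2
    have h3 := (h1.comp_measurePreserving (hpres (0, ε • ξ))).mono_measure (hle _ h2)
    refine h3.congr (Eventually.of_forall fun y => ?_)
    simp
  refine ⟨hmeas, ?_⟩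
  have hlim := ((h K' hK' hδΩ).1).add (tendsto_finsetSum Finset.univ fun j _ =>
    tendsto_eLpNorm_amp_translate hΩ (hb j).continuousOn (hS j) hK hKΩ ξ)
  rw [Finset.sum_const_zero, add_zero] at hlim
  refine tendsto_of_tendsto_of_tendsto_of_le_of_le' tendsto_const_nhds hlim
    (Eventually.of_forall fun i => zero_le) ?_
  have hAK' : ∀ ε, ContinuousOn (ampSum b S ε) K' := fun ε =>
    ContinuousOn.ampSum (fun j => (hb j).continuousOn.mono hδΩ)
      (fun j => (hS j).continuousOn.mono hδΩ) ε
  filter_upwards [hmeas, hshift, hψm K' hK' hδΩ] with ε h1 h2 h3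
  let w : ℝ × RSpace d := (0, ε • ξ)
  have hcs : ContinuousOn (fun y : ℝ × RSpace d => y + w) K := by fun_prop
  have m0 : ∀ j, AEStronglyMeasurable (fun y => b j (y + w) * oscExp (S j) ε (y + w) -
      b j y * Complex.exp (Complex.I * ((inner ℝ (spaceGrad (S j) y.1 y.2) ξ : ℝ) : ℂ)) *
        oscExp (S j) ε y) (volume.restrict K) := by
    intro j
    have hmt : MapsTo (fun y : ℝ × RSpace d => y + w) K Ω := fun y hy => hδΩ (h2 y hy)
    have ho : ContinuousOn (oscExp (S j) ε) Ω := (hS j).continuousOn.oscExp ε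
    exact ((((hb j).continuousOn.comp hcs hmt).mul (ho.comp hcs hmt)).sub
      (((continuousOn_shiftAmp hΩ hb hS ξ j).mono hKΩ).mul
        (ho.mono hKΩ))).aestronglyMeasurable hK.measurableSet
  have m1 : AEStronglyMeasurable (fun y : ℝ × RSpace d => ψ ε (y + w).1 (y + w).2 -
      wkbSum b S ε (y + w).1 (y + w).2) (volume.restrict K) := by
    have m2 : AEStronglyMeasurable (fun y : ℝ × RSpace d => ψ ε y.1 y.2 - wkbSum b S ε y.1 y.2)
        (volume.restrict K') := h3.sub ((hAK' ε).aestronglyMeasurable hK'.measurableSet)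
    exact (m2.comp_measurePreserving (hpres w)).mono_measure (hle _ h2)
  have heq : (fun y : ℝ × RSpace d => ψ ε y.1 (y.2 + ε • ξ) - ampSum (shiftAmp b S ξ) S ε y) =
      (fun y : ℝ × RSpace d => ψ ε (y + w).1 (y + w).2 - wkbSum b S ε (y + w).1 (y + w).2) +
        ∑ j, fun y => b j (y + w) * oscExp (S j) ε (y + w) -
          b j y * Complex.exp (Complex.I * ((inner ℝ (spaceGrad (S j) y.1 y.2) ξ : ℝ) : ℂ)) *
            oscExp (S j) ε y := by
    ext y
    rw [Pi.add_apply, Finset.sum_apply, Finset.sum_sub_distrib, wkbSum_eq_ampSum]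
    simp [ampSum, shiftAmp, w]
  rw [heq]
  refine (eLpNorm_add_le m1 (Finset.aestronglyMeasurable_sum _ fun j _ => m0 j)
    (by norm_num)).trans (add_le_add ?_ (eLpNorm_sum_le (fun j _ => m0 j) (by norm_num)))
  have m2 : AEStronglyMeasurable (fun y : ℝ × RSpace d => ψ ε y.1 y.2 - wkbSum b S ε y.1 y.2)
      (volume.restrict K') := h3.sub ((hAK' ε).aestronglyMeasurable hK'.measurableSet)
  rw [← eLpNorm_comp_measurePreserving m2 (hpres w)]
  exact eLpNorm_mono_measure _ (hle _ h2)

end Translation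

/-! ### Two-point correlations at distance of order ε. -/

section WignerLimit

variable {d N : ℕ} {Ω : Set (ℝ × RSpace d)} {b : Fin N → ℝ × RSpace d → ℂ}
  {S : Fin N → ℝ × RSpace d → ℝ}
  {ψ : ℝ → ℝ → RSpace d → ℂ} {G : ℝ → ℝ → RSpace d → EuclideanSpace ℂ (Fin d)}

/-- The shifts by -ξ and, after conjugation, by ξ both contribute e^{-iξ·∇S_j}: the symmetric form
of the Wigner transform sees the full displacement 2ξ. -/
theorem shiftAmp_mul_conj_neg (ξ : RSpace d) (j : Fin N) (y : ℝ × RSpace d) :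
    shiftAmp b S (-ξ) j y * starRingEnd ℂ (shiftAmp b S ξ j y) = (‖b j y‖ ^ 2 : ℝ) *
      Complex.exp (-(Complex.I * ((inner ℝ ((2 : ℝ) • ξ) (spaceGrad (S j) y.1 y.2) : ℝ) : ℂ))) := by
  rw [shiftAmp, shiftAmp, map_mul, ← Complex.exp_conj, mul_mul_mul_comm, Complex.mul_conj',
    ← Complex.exp_add]
  push_cast
  congr 2
  simp only [inner_neg_right, real_inner_smul_left, map_mul, Complex.conj_I, Complex.conj_ofReal,
    real_inner_comm ξ]
  push_cast
  ring

/-- The limit of the two-point correlations of a WKB state at distance of order `ε`. -/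
theorem tendsto_integral_correlation (hΩ : IsOpen Ω) (hb : ∀ j, ContDiffOn ℝ ∞ (b j) Ω)
    (hS : ∀ j, ContDiffOn ℝ ∞ (S j) Ω)
    (hgrad : ∀ j k, j ≠ k → ∀ t x, (t, x) ∈ Ω → spaceGrad (S j) t x ≠ spaceGrad (S k) t x)
    (hψm : ∀ K : Set (ℝ × RSpace d), IsCompact K → K ⊆ Ω → ∀ᶠ ε in 𝓝[>] (0 : ℝ),
      AEStronglyMeasurable (fun y : ℝ × RSpace d => ψ ε y.1 y.2) (volume.restrict K))
    (hwkb : HasWKBForm Ω b S ψ G) {χ : ℝ × RSpace d → ℂ} (hχ : Continuous χ)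
    (hχc : HasCompactSupport χ) (hχΩ : tsupport χ ⊆ Ω) (η : RSpace d) :
    Tendsto (fun ε : ℝ => ∫ y in tsupport χ, χ y * (ψ ε y.1 (y.2 - (ε / 2) • η) *
      starRingEnd ℂ (ψ ε y.1 (y.2 + (ε / 2) • η)))) (𝓝[>] 0)
      (𝓝 (∑ j, ∫ y, χ y * ((‖b j y‖ ^ 2 : ℝ) *
        Complex.exp (-(Complex.I * ((inner ℝ η (spaceGrad (S j) y.1 y.2) : ℝ) : ℂ)))))) := by
  let K := tsupport χ
  have hK : IsCompact K := hχc
  -- Half of η, so that a shift by εξ is the displacement εη/2 of the Wigner transform.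
  let ξ : RSpace d := (2 : ℝ)⁻¹ • η
  have hξ : ∀ ε : ℝ, ε • ξ = (ε / 2) • η := fun ε => by rw [smul_smul, div_eq_mul_inv]
  obtain ⟨m1, t1⟩ := hwkb.tendsto_translate hΩ hb hS hψm hK hχΩ (-ξ)
  obtain ⟨m2, t2⟩ := hwkb.tendsto_translate hΩ hb hS hψm hK hχΩ ξ
  obtain ⟨M, hM⟩ := hχ.bounded_above_of_compact_support hχc
  have hSK : ∀ j, ContinuousOn (S j) K := fun j => (hS j).continuousOn.mono hχΩ
  have hbK : ∀ ζ j, ContinuousOn (shiftAmp b S ζ j) K := fun ζ j =>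
    (continuousOn_shiftAmp hΩ hb hS ζ j).mono hχΩ
  obtain ⟨C₁, hC₁⟩ := exists_eLpNorm_ampSum_le (μ := volume) S hK (hbK (-ξ))
  obtain ⟨C₂, hC₂⟩ := exists_eLpNorm_ampSum_le (μ := volume) S hK (hbK ξ)
  have hAm : ∀ ζ ε, AEStronglyMeasurable (ampSum (shiftAmp b S ζ) S ε) (volume.restrict K) :=
    fun ζ ε => (ContinuousOn.ampSum (hbK ζ) hSK ε).aestronglyMeasurable hK.measurableSet
  have hconj : ∀ (f : ℝ × RSpace d → ℂ), eLpNorm (fun y => starRingEnd ℂ (f y)) 2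
      (volume.restrict K) = eLpNorm f 2 (volume.restrict K) := fun f =>
    eLpNorm_congr_norm_ae (Eventually.of_forall fun y => RCLike.norm_conj _)
  have hpert := tendsto_integral_mul_sub_zero (μ := volume.restrict K) (l := 𝓝[>] (0 : ℝ))
    (w := χ) (M := M.toNNReal) (C := max C₁ C₂)
    (X := fun ε y => ψ ε y.1 (y.2 + ε • (-ξ))) (X' := fun ε => ampSum (shiftAmp b S (-ξ)) S ε)
    (Z := fun ε y => starRingEnd ℂ (ψ ε y.1 (y.2 + ε • ξ)))
    (Z' := fun ε y => starRingEnd ℂ (ampSum (shiftAmp b S ξ) S ε y))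
    hχ.aestronglyMeasurable
    (Eventually.of_forall fun y => (hM y).trans (Real.le_coe_toNNReal M)) m1
    (Eventually.of_forall fun ε => hAm _ ε)
    (m2.mono fun ε h => Complex.continuous_conj.comp_aestronglyMeasurable h)
    (Eventually.of_forall fun ε => Complex.continuous_conj.comp_aestronglyMeasurable (hAm _ ε))
    t1 (t2.congr fun ε => by
      rw [← hconj]
      simp only [map_sub])
    (Eventually.of_forall fun ε => (hC₁ ε).trans (by exact_mod_cast le_max_left _ _))
    (Eventually.of_forall fun ε => by
      rw [hconj]
      exact (hC₂ ε).trans (by exact_mod_cast le_max_right _ _))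
  have hmain := tendsto_integral_ampSum_mul_conj (μ := (volume : Measure (ℝ × RSpace d))) hΩ hχ hχc
    hχΩ (continuousOn_shiftAmp hΩ hb hS (-ξ)) (continuousOn_shiftAmp hΩ hb hS ξ) hS
    fun j k hjk y hy => fderiv_ne_zero_of_spaceGrad_ne
      (((hS j).contDiffAt (hΩ.mem_nhds hy)).differentiableAt (by simp))
      (((hS k).contDiffAt (hΩ.mem_nhds hy)).differentiableAt (by simp)) (hgrad j k hjk _ _ hy)
  have hχK : ∀ f : ℝ × RSpace d → ℂ, ∫ y, χ y * f y = ∫ y in K, χ y * f y := fun f =>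
    (setIntegral_eq_integral_of_forall_compl_eq_zero fun y hy => by
      simp [image_eq_zero_of_notMem_tsupport hy]).symm
  have h2ξ : (2 : ℝ) • ξ = η := by rw [smul_smul]; norm_num
  simp_rw [hχK (fun y => ampSum _ _ _ y * _), shiftAmp_mul_conj_neg, h2ξ] at hmain
  have := hpert.add hmain
  rw [zero_add] at this
  refine this.congr fun ε => ?_
  rw [sub_add_cancel]
  simp only [smul_neg, hξ, ← sub_eq_add_neg, K]

end WignerLimit

/-! ### The Wigner transform tested in phase space. -/

section Slab

variable {d : ℕ} {T : ℝ} {f : ℝ → RSpace d → ℂ} {C : NNReal}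

/-- For each fixed η this is a translation in x, so the shear preserves the product measure. It
transfers joint measurability and integrability to translated functions. -/
theorem measurePreserving_slab_translate (T c : ℝ) : MeasurePreserving
    (fun z : RSpace d × (ℝ × RSpace d) => (z.1, (z.2.1, z.2.2 + c • z.1)))
    (volume.prod ((volume.restrict (Icc 0 T)).prod volume))
    (volume.prod ((volume.restrict (Icc 0 T)).prod volume)) := by
  refine (MeasurePreserving.id (volume : Measure (RSpace d))).skew_product
    (g := fun η (y : ℝ × RSpace d) => (y.1, y.2 + c • η)) ?_ (Eventually.of_forall fun η => ?_)
  · simp only [Function.uncurry_def]; fun_prop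
  · exact ((MeasurePreserving.id (volume.restrict (Icc 0 T))).prod
      (measurePreserving_add_right volume (c • η))).map_eq

/-- Translations preserve Lebesgue measure and a nonzero dilation scales it by a finite constant.
Consequently the integral defining the Wigner transform converges absolutely at every x. -/
theorem memLp_comp_add_smul {f : RSpace d → ℂ} (hf : MemLp f 2 volume) (x : RSpace d) {c : ℝ}
    (hc : c ≠ 0) : MemLp (fun η => f (x + c • η)) 2 volume := by
  have h1 : MemLp (fun z => f (x + z)) 2 volume :=
    hf.comp_measurePreserving (measurePreserving_add_left volume x)
  have h2 : Measure.map (fun η : RSpace d => c • η) volume =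
      ENNReal.ofReal |(c ^ Module.finrank ℝ (RSpace d))⁻¹| • volume :=
    Measure.map_addHaar_smul volume hc
  have h3 : MemLp (fun z => f (x + z)) 2 (Measure.map (fun η : RSpace d => c • η) volume) := by
    rw [h2]
    exact h1.smul_measure ENNReal.ofReal_ne_top
  exact h3.comp_of_map (by fun_prop)

/-- The Wigner transform tested in the momentum variable. -/
theorem integral_mul_wignerTransform {f : RSpace d → ℂ} (hf : MemLp f 2 volume) {ε : ℝ}
    (hε : 0 < ε) {φ : ℝ × RSpace d × RSpace d → ℝ} (hφ : Continuous φ)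
    (hφc : HasCompactSupport φ) (t : ℝ) (x : RSpace d) :
    ∫ p, (φ (t, x, p) : ℂ) * wignerTransform ε f x p =
      ((2 * Real.pi : ℝ) : ℂ)⁻¹ ^ d * ∫ η, momentumTransform φ (t, x) η *
        (f (x - (ε / 2) • η) * starRingEnd ℂ (f (x + (ε / 2) • η))) := by
  let h : RSpace d → ℂ := fun η => f (x - (ε / 2) • η) * starRingEnd ℂ (f (x + (ε / 2) • η))
  have hh : Integrable h := by
    have h1 := memLp_comp_add_smul hf x (c := -(ε / 2)) (neg_ne_zero.2 (by positivity))
    have h2 := (memLp_comp_add_smul hf x (c := ε / 2) (by positivity)).star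
    simpa [h, sub_eq_add_neg] using h1.integrable_mul_two h2
  have hφi : Integrable fun p => (φ (t, x, p) : ℂ) :=
    Continuous.integrable_of_hasCompactSupport (by fun_prop) (hasCompactSupport_slice hφc (t, x))
  have hI : Integrable (fun z : RSpace d × RSpace d => (φ (t, x, z.1) : ℂ) * (h z.2 *
      Complex.exp (Complex.I * ((inner ℝ z.2 z.1 : ℝ) : ℂ)))) (volume.prod volume) := by
    have h1 := (hφi.mul_prod hh).bdd_mul (c := 1) (f := fun z : RSpace d × RSpace d =>
      Complex.exp (Complex.I * ((inner ℝ z.2 z.1 : ℝ) : ℂ)))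
      (Continuous.aestronglyMeasurable (by fun_prop)) (Eventually.of_forall fun z => by
        rw [mul_comm Complex.I, Complex.norm_exp_ofReal_mul_I])
    refine h1.congr (Eventually.of_forall fun z => ?_)
    ring
  calc ∫ p, (φ (t, x, p) : ℂ) * wignerTransform ε f x p
      = ∫ p, ((2 * Real.pi : ℝ) : ℂ)⁻¹ ^ d * ∫ η, (φ (t, x, p) : ℂ) * (h η *
          Complex.exp (Complex.I * ((inner ℝ η p : ℝ) : ℂ))) := by
        refine integral_congr_ae (Eventually.of_forall fun p => ?_)
        simp only [wignerTransform, h]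
        rw [integral_const_mul]
        ring
    _ = ((2 * Real.pi : ℝ) : ℂ)⁻¹ ^ d * ∫ η, ∫ p, (φ (t, x, p) : ℂ) * (h η *
          Complex.exp (Complex.I * ((inner ℝ η p : ℝ) : ℂ))) := by
        rw [integral_const_mul, integral_integral_swap hI]
    _ = _ := by
        congr 1
        refine integral_congr_ae (Eventually.of_forall fun η => ?_)
        simp only [momentumTransform]
        rw [← integral_mul_const]
        refine integral_congr_ae (Eventually.of_forall fun p => ?_)
        simp only [h]
        ring

variable {φ : ℝ × RSpace d × RSpace d → ℝ} {g : RSpace d → ℝ}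

/-- The correlations, tested against the momentum transform of a test function, are integrable
jointly in the displacement and in space-time. -/
theorem integrable_correlation
    (hfm : AEStronglyMeasurable (fun y : ℝ × RSpace d => f y.1 y.2)
      (volume.restrict (Icc 0 T ×ˢ univ)))
    (hC : ∀ t ∈ Icc 0 T, eLpNorm (f t) 2 volume ≤ C)
    (hφ : Continuous φ) (hφc : HasCompactSupport φ) (hg : Integrable g)
    (hφg : ∀ y η, ‖momentumTransform φ y η‖ ≤ g η) (c : ℝ) :
    Integrable (fun z : RSpace d × (ℝ × RSpace d) => momentumTransform φ z.2 z.1 *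
      (f z.2.1 (z.2.2 - c • z.1) * starRingEnd ℂ (f z.2.1 (z.2.2 + c • z.1))))
      (volume.prod ((volume.restrict (Icc 0 T)).prod volume)) ∧
    ∀ η, ‖∫ y, momentumTransform φ y η *
      (f y.1 (y.2 - c • η) * starRingEnd ℂ (f y.1 (y.2 + c • η)))
        ∂((volume.restrict (Icc 0 T)).prod volume)‖ ≤ g η * (C ^ 2 * T.toNNReal) := by
  have hL := memLp_slab hfm hC
  have hbd := eLpNorm_slab_le hfm hC
  rw [volume_restrict_slab] at hfm hL hbd
  have hg0 : ∀ η, 0 ≤ g η := fun η => (norm_nonneg _).trans (hφg 0 η)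
  let ν : Measure (ℝ × RSpace d) := (volume.restrict (Icc 0 T)).prod volume
  have hq : Integrable (fun y : ℝ × RSpace d => ‖f y.1 y.2‖ ^ 2) ν := hL.integrable_norm_sq'
  have hqC : ∫ y, ‖f y.1 y.2‖ ^ 2 ∂ν ≤ C ^ 2 * T.toNNReal := by
    rw [integral_eq_lintegral_of_nonneg_ae (Eventually.of_forall fun y => by positivity)
      hq.aestronglyMeasurable]
    refine ENNReal.toReal_le_of_le_ofReal (by positivity) ?_
    have h1 : ∀ y : ℝ × RSpace d, ENNReal.ofReal (‖f y.1 y.2‖ ^ 2) = ‖f y.1 y.2‖ₑ ^ 2 := fun y => by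
      rw [ENNReal.ofReal_pow (norm_nonneg _), ofReal_norm]
    simp_rw [h1]
    refine hbd.trans (le_of_eq ?_)
    rw [ENNReal.ofReal_mul (by positivity), ENNReal.ofReal_pow (by positivity),
      ENNReal.ofReal_coe_nnreal, ENNReal.ofReal_coe_nnreal]
    rfl
  have hprod : Integrable (fun z : RSpace d × (ℝ × RSpace d) => g z.1 * ‖f z.2.1 z.2.2‖ ^ 2)
      (volume.prod ν) := hg.mul_prod hq
  have hA : ∀ a : ℝ, AEStronglyMeasurable (fun z : RSpace d × (ℝ × RSpace d) =>
      f z.2.1 (z.2.2 + a • z.1)) (volume.prod ν) := fun a =>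
    (hfm.comp_snd (μ := volume)).comp_measurePreserving (measurePreserving_slab_translate T a)
  have hB : ∀ a : ℝ, Integrable (fun z : RSpace d × (ℝ × RSpace d) =>
      g z.1 * ‖f z.2.1 (z.2.2 + a • z.1)‖ ^ 2) (volume.prod ν) := fun a =>
    (measurePreserving_slab_translate T a).integrable_comp_of_integrable hprod
  -- The inequality 2rs ≤ r² + s² reduces the correlation to translated densities, all of the same
  -- mass. The resulting majorant in η does not depend on c, hence not on ε.
  have hpt : ∀ y η, ‖momentumTransform φ y η *
      (f y.1 (y.2 - c • η) * starRingEnd ℂ (f y.1 (y.2 + c • η)))‖ ≤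
      g η * ((‖f y.1 (y.2 + (-c) • η)‖ ^ 2 + ‖f y.1 (y.2 + c • η)‖ ^ 2) / 2) := by
    intro y η
    rw [norm_mul, norm_mul, RCLike.norm_conj, neg_smul, ← sub_eq_add_neg]
    refine mul_le_mul (hφg y η) ?_ (by positivity) (hg0 η)
    nlinarith [sq_nonneg (‖f y.1 (y.2 - c • η)‖ - ‖f y.1 (y.2 + c • η)‖)]
  constructor
  · refine Integrable.mono' (((hB (-c)).add (hB c)).div_const 2) ?_
      (Eventually.of_forall fun z => (hpt z.2 z.1).trans (le_of_eq ?_))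
    · refine AEStronglyMeasurable.mul ?_ (AEStronglyMeasurable.mul ?_ ?_)
      · exact ((continuous_momentumTransform hφ hφc).comp continuous_swap).aestronglyMeasurable
      · simpa [sub_eq_add_neg] using hA (-c)
      · exact Complex.continuous_conj.comp_aestronglyMeasurable (hA c)
    · simp only [Pi.add_apply]; ring
  · intro η
    have hmp : ∀ a : ℝ, MeasurePreserving (fun y : ℝ × RSpace d => (y.1, y.2 + a • η)) ν ν :=
      fun a => (MeasurePreserving.id (volume.restrict (Icc 0 T))).prod
        (measurePreserving_add_right volume (a • η))
    have hi : ∀ a : ℝ, Integrable (fun y : ℝ × RSpace d => ‖f y.1 (y.2 + a • η)‖ ^ 2) ν :=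
      fun a => (hmp a).integrable_comp_of_integrable hq
    have he : ∀ a : ℝ, ∫ y, ‖f y.1 (y.2 + a • η)‖ ^ 2 ∂ν = ∫ y, ‖f y.1 y.2‖ ^ 2 ∂ν := by
      intro a
      have h1 : MeasurableEmbedding fun y : ℝ × RSpace d => (y.1, y.2 + a • η) :=
        ((Homeomorph.refl ℝ).prodCongr (Homeomorph.addRight (a • η))).measurableEmbedding
      exact (hmp a).integral_comp h1 fun y : ℝ × RSpace d => ‖f y.1 y.2‖ ^ 2
    refine (norm_integral_le_of_norm_le (((hi (-c)).add (hi c)).div_const 2 |>.const_mul (g η))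
      (Eventually.of_forall fun y => hpt y η)).trans ?_
    rw [integral_const_mul, integral_div, integral_add' (hi _) (hi _), he, he, add_self_div_two]
    exact mul_le_mul_of_nonneg_left hqC (hg0 η)

/-- The Wigner transform, tested against a function on phase space-time. -/
theorem integral_wignerTransform {ψ : ℝ → RSpace d → ℂ}
    (hψm : AEStronglyMeasurable (fun y : ℝ × RSpace d => ψ y.1 y.2)
      (volume.restrict (Icc 0 T ×ˢ univ)))
    (hC : ∀ t ∈ Icc 0 T, eLpNorm (ψ t) 2 volume ≤ C) (hψ : ∀ t ∈ Icc 0 T, MemLp (ψ t) 2 volume)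
    (hφ : Continuous φ) (hφc : HasCompactSupport φ) (hg : Integrable g)
    (hφg : ∀ y η, ‖momentumTransform φ y η‖ ≤ g η) {ε : ℝ} (hε : 0 < ε) :
    ∫ t in Icc 0 T, ∫ x, ∫ p, (φ (t, x, p) : ℂ) * wignerTransform ε (ψ t) x p =
      ((2 * Real.pi : ℝ) : ℂ)⁻¹ ^ d * ∫ η, ∫ y, momentumTransform φ y η *
        (ψ y.1 (y.2 - (ε / 2) • η) * starRingEnd ℂ (ψ y.1 (y.2 + (ε / 2) • η)))
          ∂((volume.restrict (Icc 0 T)).prod volume) := by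
  have hI := (integrable_correlation hψm hC hφ hφc hg hφg (ε / 2)).1
  have hJ := hI.integral_prod_right
  rw [integral_integral_swap (f := fun η (y : ℝ × RSpace d) => momentumTransform φ y η *
    (ψ y.1 (y.2 - (ε / 2) • η) * starRingEnd ℂ (ψ y.1 (y.2 + (ε / 2) • η)))) hI, integral_prod _ hJ, ← integral_const_mul]
  refine setIntegral_congr_fun measurableSet_Icc fun t ht => ?_
  simp only
  rw [← integral_const_mul]
  exact integral_congr_ae (Eventually.of_forall fun x =>
    integral_mul_wignerTransform (hψ t ht) hε hφ hφc t x)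

end Slab

/-! ### Identification of the Wigner measure. -/

section WignerMeasure

variable {d N : ℕ} {Ω : Set (ℝ × RSpace d)} {b : Fin N → ℝ × RSpace d → ℂ}
  {S : Fin N → ℝ × RSpace d → ℝ} {T : ℝ}
  {ψ : ℝ → ℝ → RSpace d → ℂ} {G : ℝ → ℝ → RSpace d → EuclideanSpace ℂ (Fin d)} {C : NNReal}

/-- Fourier inversion, integrated against the density of one phase. -/
theorem integral_integral_momentumTransform_phase (hΩ : IsOpen Ω) {b : ℝ × RSpace d → ℂ}
    {S : ℝ × RSpace d → ℝ} (hb : ContinuousOn b Ω) (hS : ContDiffOn ℝ ∞ S Ω)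
    {φ : ℝ × RSpace d × RSpace d → ℝ} (hφ : ContDiff ℝ ∞ φ) (hφc : HasCompactSupport φ)
    (hφΩ : tsupport φ ⊆ overSet Ω) :
    Integrable (fun η => ∫ y, momentumTransform φ y η * ((‖b y‖ ^ 2 : ℝ) *
      Complex.exp (-(Complex.I * ((inner ℝ η (spaceGrad S y.1 y.2) : ℝ) : ℂ))))) ∧
    ∫ η, ∫ y, momentumTransform φ y η * ((‖b y‖ ^ 2 : ℝ) *
      Complex.exp (-(Complex.I * ((inner ℝ η (spaceGrad S y.1 y.2) : ℝ) : ℂ)))) =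
      (2 * Real.pi : ℝ) ^ d *
        ((∫ y in baseProj '' tsupport φ, ‖b y‖ ^ 2 * φ (y.1, y.2, spaceGrad S y.1 y.2) : ℝ) : ℂ) := by
  let K := baseProj '' tsupport φ
  have hK : IsCompact K := IsCompact.image hφc continuous_baseProj
  have hKΩ : K ⊆ Ω := image_baseProj_subset hφΩ
  obtain ⟨g, hg, hg0, hφg⟩ := exists_norm_momentumTransform_le hφ hφc
  obtain ⟨M, hM⟩ := hK.exists_bound_of_continuousOn ((hb.mono hKΩ).norm.pow 2)
  let F : RSpace d → ℝ × RSpace d → ℂ := fun η y => momentumTransform φ y η * ((‖b y‖ ^ 2 : ℝ) *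
      Complex.exp (-(Complex.I * ((inner ℝ η (spaceGrad S y.1 y.2) : ℝ) : ℂ))))
  have hF : ∀ η, ∫ y, F η y = ∫ y in K, F η y := fun η =>
    (setIntegral_eq_integral_of_forall_compl_eq_zero fun y hy => by
      simp [F, momentumTransform_eq_zero hy]).symm
  have : IsFiniteMeasure (volume.restrict K) := isFiniteMeasure_restrict.2 hK.measure_lt_top.ne
  -- The majorant g(η)M on the finite measure space K licenses exchanging the η and y integrals
  -- before inversion.
  have hI : Integrable (Function.uncurry F) (volume.prod (volume.restrict K)) := by
    refine Integrable.mono' (hg.mul_prod (integrable_const M)) ?_ ?_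
    · rw [← Measure.restrict_univ (μ := (volume : Measure (RSpace d))), Measure.prod_restrict]
      refine ContinuousOn.aestronglyMeasurable ?_ (MeasurableSet.univ.prod hK.measurableSet)
      have h1 : ContinuousOn (fun z : RSpace d × (ℝ × RSpace d) => (‖b z.2‖ ^ 2 : ℝ))
          (univ ×ˢ K) :=
        ((hb.mono hKΩ).norm.pow 2).comp continuousOn_snd fun z hz => hz.2
      have h2 : ContinuousOn (fun z : RSpace d × (ℝ × RSpace d) =>
          (inner ℝ z.1 (spaceGrad S z.2.1 z.2.2) : ℝ)) (univ ×ˢ K) :=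
        continuousOn_fst.inner (((continuousOn_spaceGrad hΩ hS).mono hKΩ).comp continuousOn_snd
          fun z hz => hz.2)
      have h3 : Continuous (fun z : RSpace d × (ℝ × RSpace d) => momentumTransform φ z.2 z.1) :=
        (continuous_momentumTransform hφ.continuous hφc).comp continuous_swap
      exact h3.continuousOn.mul ((Complex.continuous_ofReal.comp_continuousOn h1).mul
        (continuousOn_const.mul (Complex.continuous_ofReal.comp_continuousOn h2)).neg.cexp)
    · have h1 : ∀ᵐ z ∂(volume : Measure (RSpace d)).prod (volume.restrict K), z.2 ∈ K :=
        Measure.quasiMeasurePreserving_snd.ae (ae_restrict_mem hK.measurableSet)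
      filter_upwards [h1] with z hz
      have h2 : ‖Complex.exp (-(Complex.I *
          ((inner ℝ z.1 (spaceGrad S z.2.1 z.2.2) : ℝ) : ℂ)))‖ = 1 := by
        have := Complex.norm_exp_ofReal_mul_I (-inner ℝ z.1 (spaceGrad S z.2.1 z.2.2))
        rwa [Complex.ofReal_neg, neg_mul, mul_comm] at this
      simp only [Function.uncurry_def, F]
      rw [norm_mul, norm_mul, h2, mul_one, Complex.norm_real]
      exact mul_le_mul (hφg _ _) (hM _ hz) (norm_nonneg _) (hg0 _)
  refine ⟨(hI.integral_prod_left).congr (Eventually.of_forall fun η => (hF η).symm), ?_⟩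
  calc ∫ η, ∫ y, F η y = ∫ η, ∫ y in K, F η y := by simp_rw [hF]
    _ = ∫ y in K, ∫ η, F η y := integral_integral_swap hI
    _ = ∫ y in K, ((2 * Real.pi : ℝ) : ℂ) ^ d *
          ((‖b y‖ ^ 2 * φ (y.1, y.2, spaceGrad S y.1 y.2) : ℝ) : ℂ) := by
        refine integral_congr_ae (Eventually.of_forall fun y => ?_)
        have h1 : ∀ η, F η y = ((‖b y‖ ^ 2 : ℝ) : ℂ) *
            (Complex.exp (-(Complex.I * ((inner ℝ η (spaceGrad S y.1 y.2) : ℝ) : ℂ))) *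
              momentumTransform φ y η) := fun η => by simp only [F]; ring
        simp only [h1]
        rw [integral_const_mul, integral_exp_mul_momentumTransform hφ hφc]
        push_cast
        ring
    _ = _ := by rw [integral_const_mul, integral_complex_ofReal]

/-- The Wigner measure of a superposition of WKB states with distinct phase gradients. -/
theorem isWignerMeasure_multiPhaseMeasure (hΩ : IsOpen Ω) (hΩT : Ω ⊆ Icc 0 T ×ˢ univ)
    (hb : ∀ j, ContDiffOn ℝ ∞ (b j) Ω) (hS : ∀ j, ContDiffOn ℝ ∞ (S j) Ω)
    (hgrad : ∀ j k, j ≠ k → ∀ t x, (t, x) ∈ Ω → spaceGrad (S j) t x ≠ spaceGrad (S k) t x)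
    (hψm : ∀ ε ∈ Ioc (0 : ℝ) 1, AEStronglyMeasurable (fun y : ℝ × RSpace d => ψ ε y.1 y.2)
      (volume.restrict (Icc 0 T ×ˢ univ)))
    (hψ : ∀ ε ∈ Ioc (0 : ℝ) 1, ∀ t ∈ Icc 0 T, MemLp (ψ ε t) 2 volume)
    (hC : ∀ ε ∈ Ioc (0 : ℝ) 1, ∀ t ∈ Icc 0 T, eLpNorm (ψ ε t) 2 volume ≤ C)
    (hwkb : HasWKBForm Ω b S ψ G) :
    IsWignerMeasure T Ω ψ (𝓝[>] 0) (multiPhaseMeasure Ω b S) := by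
  refine ⟨locallyFiniteOver_multiPhaseMeasure hΩ hb hS, fun φ hφ hφc hφΩ => ?_⟩
  obtain ⟨g, hg, hg0, hφg⟩ := exists_norm_momentumTransform_le hφ hφc
  have hK : IsCompact (baseProj '' tsupport φ) := IsCompact.image hφc continuous_baseProj
  have hKΩ : baseProj '' tsupport φ ⊆ Ω := image_baseProj_subset hφΩ
  let ν : Measure (ℝ × RSpace d) := (volume.restrict (Icc 0 T)).prod volume
  let H : ℝ → RSpace d → ℝ × RSpace d → ℂ := fun ε η y => momentumTransform φ y η *
    (ψ ε y.1 (y.2 - (ε / 2) • η) * starRingEnd ℂ (ψ ε y.1 (y.2 + (ε / 2) • η)))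
  let Λ : RSpace d → ℂ := fun η => ∑ j, ∫ y, momentumTransform φ y η * ((‖b j y‖ ^ 2 : ℝ) *
    Complex.exp (-(Complex.I * ((inner ℝ η (spaceGrad (S j) y.1 y.2) : ℝ) : ℂ))))
  have hsmall : Ioc (0 : ℝ) 1 ∈ 𝓝[>] (0 : ℝ) := Ioc_mem_nhdsGT one_pos
  -- For fixed η the momentum transform is itself a continuous cutoff in space-time with compact
  -- support in Ω.
  have hpw : ∀ η, Tendsto (fun ε => ∫ y, H ε η y ∂ν) (𝓝[>] 0) (𝓝 (Λ η)) := by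
    intro η
    have hc : Continuous fun y => momentumTransform φ y η :=
      (continuous_momentumTransform hφ.continuous hφc).comp (by fun_prop : Continuous
        fun y : ℝ × RSpace d => (y, η))
    have hts : tsupport (fun y => momentumTransform φ y η) ⊆ baseProj '' tsupport φ :=
      closure_minimal (fun y hy => by_contra fun h => hy (momentumTransform_eq_zero h η))
        hK.isClosed
    have hcs : HasCompactSupport fun y => momentumTransform φ y η :=
      hK.of_isClosed_subset (isClosed_tsupport _) hts
    refine (tendsto_integral_correlation hΩ hb hS hgrad
      (fun K' hK' hK'Ω => eventually_aestronglyMeasurable_restrict hψm (hK'Ω.trans hΩT)) hwkb hc hcs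
      (hts.trans hKΩ) η).congr fun ε => ?_
    have h1 : ν = volume.restrict (Icc 0 T ×ˢ univ) := (volume_restrict_slab T).symm
    rw [h1]
    refine (setIntegral_eq_of_subset_of_forall_sdiff_eq_zero
      (measurableSet_Icc.prod MeasurableSet.univ) (hts.trans (hKΩ.trans hΩT)) fun y hy => ?_).symm
    have := image_eq_zero_of_notMem_tsupport hy.2
    simp only [this, zero_mul]
  -- The majorant g(η) C² T is uniform in ε; this is where the global L² bound enters, since for
  -- large η the translates leave every compact subset of Ω.
  have hdom : Tendsto (fun ε => ∫ η, ∫ y, H ε η y ∂ν) (𝓝[>] 0) (𝓝 (∫ η, Λ η)) := by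
    refine tendsto_integral_filter_of_dominated_convergence
      (fun η => g η * (C ^ 2 * T.toNNReal)) ?_ ?_ (hg.mul_const _) (Eventually.of_forall hpw)
    · filter_upwards [hsmall] with ε hε
      exact (integrable_correlation (hψm ε hε) (hC ε hε) hφ.continuous hφc hg hφg
        (ε / 2)).1.integral_prod_left.aestronglyMeasurable
    · filter_upwards [hsmall] with ε hε
      exact Eventually.of_forall (integrable_correlation (hψm ε hε) (hC ε hε) hφ.continuous hφc hg
        hφg (ε / 2)).2
  have hΛ : ((2 * Real.pi : ℝ) : ℂ)⁻¹ ^ d * ∫ η, Λ η =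
      ((∫ z, φ z ∂(multiPhaseMeasure Ω b S) : ℝ) : ℂ) := by
    have hphase := fun j => integral_integral_momentumTransform_phase hΩ (hb j).continuousOn (hS j)
      hφ hφc hφΩ
    rw [integral_finsetSum _ fun j _ => (hphase j).1,
      integral_multiPhaseMeasure hΩ hb hS hφ.continuous hφc hφΩ hKΩ subset_rfl,
      Finset.sum_congr rfl fun j _ => (hphase j).2, ← Finset.mul_sum, ← mul_assoc, ← mul_pow,
      inv_mul_cancel₀ (by exact_mod_cast Real.two_pi_pos.ne'), one_pow, one_mul, Complex.ofReal_sum]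
  rw [← hΛ]
  refine (hdom.const_mul _).congr' ?_
  filter_upwards [hsmall] with ε hε
  exact (integral_wignerTransform (hψm ε hε) (hC ε hε) (hψ ε hε) hφ.continuous hφc hg hφg
    hε.1).symm

end WignerMeasure

end

theorem corollary4p4 {d N : ℕ} (hN : 1 ≤ N) (T : ℝ)
    (Ω : Set (ℝ × RSpace d)) (hΩ : IsOpen Ω) (hΩne : Ω.Nonempty)
    (hΩT : Ω ⊆ Icc 0 T ×ˢ univ)
    (V : RSpace d → ℝ)
    -- the phases and the amplitudes
    (b : Fin N → ℝ × RSpace d → ℂ) (S : Fin N → ℝ × RSpace d → ℝ)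
    (hb : ∀ j, ContDiffOn ℝ ∞ (b j) Ω) (hS : ∀ j, ContDiffOn ℝ ∞ (S j) Ω)
    (hHJ : ∀ j, SolvesHamiltonJacobi V Ω (S j))
    (hgrad : ∀ j k, j ≠ k → ∀ t x, (t, x) ∈ Ω → spaceGrad (S j) t x ≠ spaceGrad (S k) t x)
    (hb0 : ∀ j, ∀ y ∈ Ω, b j y ≠ 0)
    -- the wave functions, with their gradients, and bounded in `L²`
    (ψ : ℝ → ℝ → RSpace d → ℂ) (G : ℝ → ℝ → RSpace d → EuclideanSpace ℂ (Fin d))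
    (hψm : ∀ ε ∈ Ioc (0 : ℝ) 1, AEStronglyMeasurable (fun y : ℝ × RSpace d => ψ ε y.1 y.2)
      (volume.restrict (Icc 0 T ×ˢ univ)))
    (hGm : ∀ ε ∈ Ioc (0 : ℝ) 1, AEStronglyMeasurable (fun y : ℝ × RSpace d => G ε y.1 y.2)
      (volume.restrict (Icc 0 T ×ˢ univ)))
    (hH1 : ∀ ε ∈ Ioc (0 : ℝ) 1, ∀ t ∈ Icc 0 T, IsH1WithGrad (ψ ε t) (G ε t))
    (hbdd : ∃ C : NNReal, ∀ ε ∈ Ioc (0 : ℝ) 1, ∀ t ∈ Icc 0 T, eLpNorm (ψ ε t) 2 volume ≤ C)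
    (hwkb : HasWKBForm Ω b S ψ G) :
    -- the Wigner measure over `Ω` is `w = ∑_j |b_j|² δ(p - ∇S_j)`
    IsWignerMeasure T Ω ψ (𝓝[>] 0) (multiPhaseMeasure Ω b S) ∧
    -- limiting Bohmian measures exist, up to extraction of a subsequence
    (∀ e : ℕ → ℝ, Tendsto e atTop (𝓝[>] 0) →
      ∃ n : ℕ → ℕ, StrictMono n ∧ ∃ β : Measure (ℝ × RSpace d × RSpace d),
        IsLimitingBohmianMeasure T Ω ψ G (map (e ∘ n) atTop) β) ∧
    -- and each of them is equal to `w` over `Ω` if and only if `N = 1`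
    (∀ e : ℕ → ℝ, Tendsto e atTop (𝓝[>] 0) → ∀ β : Measure (ℝ × RSpace d × RSpace d),
      IsLimitingBohmianMeasure T Ω ψ G (map e atTop) β →
        (β.restrict (overSet Ω) = multiPhaseMeasure Ω b S ↔ N = 1)) := by
  obtain ⟨C, hC⟩ := hbdd
  refine ⟨isWignerMeasure_multiPhaseMeasure hΩ hΩT hb hS hgrad hψm
    (fun ε hε t ht => (hH1 ε hε t ht).1) hC hwkb,
    fun e he => exists_isLimitingBohmianMeasure Ω hψm hGm hH1 hC he, fun e he β hβ => ?_⟩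
  -- The iterated integrals agree with those of the measure on phase space-time only for ε in (0,1],
  -- which holds eventually along the sequence.
  have hlim : ∀ φ : ℝ × RSpace d × RSpace d → ℝ, Continuous φ → HasCompactSupport φ →
      tsupport φ ⊆ overSet Ω → Tendsto (fun ε => ∫ z, φ z ∂(bohmianMeasureSlab T ε (ψ ε) (G ε)))
        (map e atTop) (𝓝 (∫ z, φ z ∂β)) := by
    intro φ hφ hφc hφΩ
    refine (hβ.2 φ hφ hφc hφΩ).congr' ?_
    filter_upwards [he (Ioc_mem_nhdsGT one_pos)] with ε hε
    exact integral_integral_bohmianMeasure (hψm ε hε) (hGm ε hε) (hC ε hε)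
      (hH1 ε hε) hφ hφc
  constructor
  · intro h
    by_contra hN1
    have : Nontrivial (Fin N) := Fin.nontrivial_iff_two_le.2 (by omega)
    exact restrict_ne_multiPhaseMeasure hΩ hΩne hΩT hb hS hgrad hb0 hψm hGm hwkb he hlim h
  · rintro rfl
    exact restrict_eq_multiPhaseMeasure_single hΩ hΩT hb hS hψm hGm hwkb he hβ.1 hlim
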